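/- Let $G=\langle a,b,c,d \mid aba^{-1}b^{-1}cdc^{-1}d^{-1}\rangle$ be the fundamental group of the closed orientable surface of genus $2$, let $\Omega=\{a^{\pm1},b^{\pm1},c^{\pm1},d^{\pm1}\}$, and write $A=a^{-1}$, etc. The word length of a conjugacy class of $G$ is the least length of a word in $\Omega$ representing one of its elements; $F_n$ is the set of conjugacy classes of word length $n$. Embed the Cayley graph $\Gamma$ in the hyperbolic plane so that the boundary of each octagon, read counterclockwise, is $abABcdCD$; the edges leaving each vertex are then, counterclockwise, $a,d,C,D,c,b,A,B$. After an edge $k$ has been traversed, let $\tau_1(k),\dots,\tau_7(k)$ be the other edges at its end vertex, from the rightmost to the leftmost (counterclockwise from $k^{-1}$). The Markov chain has $88$ states, the possible steps of (bi-infinite) snakes, i.e. of limits of unions of all shortest edge paths between two vertices of $\Gamma$: * $\mathrm A_k$, $\mathrm A'^{L}_k,\mathrm A'^{R}_k$, $\mathrm A''^{L}_k,\mathrm A''^{R}_k$ for $k\in\Omega$ (one edge $k$); * for each corner of an octagon, at a vertex $v$ between an edge on the left and the next edge clockwise on the right, consider the two paths of four edges around the octagon from $v$ to the opposite vertex. The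 states $\mathrm B,\mathrm C,\mathrm C',\mathrm D$ of the octagon are its first, second, third and fourth pairs of edges $(j,k)$, $j$ on the left path and $k$ on the right path; * the state $\mathrm E^{L}$ (resp. $\mathrm E^{R}$) of the octagon consists of the pair $(j,k)$ of $\mathrm D$ together with the edge next to $j$ counterclockwise (resp. next to $k$ clockwise) at the initial vertex of $j$ (resp. of $k$). The permitted transitions are as follows. * From $\mathrm A_k$: to $\mathrm A_{\tau_i(k)}$ ($2\le i\le 6$), $\mathrm A'^R_{\tau_1(k)}$, $\mathrm A'^L_{\tau_7(k)}$, and to the state $\mathrm B$ with edges $(\tau_{i+1}(k),\tau_i(k))$ ($1\le i\le 6$). * From $\mathrm A'^L_k$ (resp. $\mathrm A'^R_k$): the same, except that $\mathrm A'^L_{\tau_7(k)}$ is replaced by $\mathrm A''^L_{\tau_7(k)}$ (resp. $\mathrm A'^R_{\tau_1(k)}$ by $\mathrm A''^R_{\tau_1(k)}$). * From $\mathrm A''^L_k$ (resp. $\mathrm A''^R_k$): the same as from $\mathrm A_k$, without the two transitions that use $\tau_7(k)$ (resp. $\tau_1(k)$). * Around one octagon: $\mathrm B\to\mathrm C\to\mathrm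 C'$, and from $\mathrm C'$ to $\mathrm D$, $\mathrm E^L$ or $\mathrm E^R$. * From $\mathrm E^L$ (resp. $\mathrm E^R$): to the state $\mathrm C$ of the octagon lying between the added edge and $j$ (resp. $k$), in its corner at their common initial vertex. * From $\mathrm D$ with edges $(j,k)$: to $\mathrm A_{\tau_i(k)}$ ($2\le i\le5$), $\mathrm A'^R_{\tau_1(k)}$, $\mathrm A'^L_{\tau_6(k)}$, and to the state $\mathrm B$ with edges $(\tau_{i+1}(k),\tau_i(k))$ ($1\le i\le5$). Let $\mathbb J_n$ be the set of bi-infinite sequences $(x_i)_{i\in\mathbb Z}$ of states with all transitions permitted and $x_{i+n}=x_i$ for all $i$. Let $p_n$ send $x\in\mathbb J_n$ to the conjugacy class of the element represented by the word of length $n$ that lists the leftmost edges of $x_0,\dots,x_{n-1}$. Let $\lambda_n$ and $\mu_n$ be the uniform probability measures on $\mathbb J_n$ and on $F_n$ ($n\ge1$). Theorem. The map $p_n$ takes $\mathbb J_n$ into $F_n$, and the pushforward of $\lambda_n$ under $p_n$ approaches $\mu_n$ in total variation norm: $$\lim_{n\to\infty}\big\|(p_n)_*\lambda_n-\mu_n\big\|_{TV}=0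 .$$ -/

import Mathlib

open MeasureTheory ProbabilityTheory Filter Topology

namespace Snake

/-! ### The surface group of genus two -/

/-- The four generators of the surface group. -/
inductive Gen
  | a | b | c | d
  deriving DecidableEq

/-- The relator `a b a⁻¹ b⁻¹ c d c⁻¹ d⁻¹`. -/
def relator : FreeGroup Gen :=
  FreeGroup.of .a * FreeGroup.of .b * (FreeGroup.of .a)⁻¹ * (FreeGroup.of .b)⁻¹ *
    FreeGroup.of .c * FreeGroup.of .d * (FreeGroup.of .c)⁻¹ * (FreeGroup.of .d)⁻¹

/-- The fundamental group `⟨a, b, c, d | a b a⁻¹ b⁻¹ c d c⁻¹ d⁻¹⟩` of the closed orientable surface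
of genus two. -/
abbrev SurfaceGroup : Type := PresentedGroup ({relator} : Set (FreeGroup Gen))

/-- The generators and their inverses: `(x, true)` stands for `x` and `(x, false)` for `x⁻¹`
(written as a capital letter below). -/
abbrev Letter : Type := Gen × Bool

/-- The inverse letter. -/
def inv (k : Letter) : Letter := (k.1, !k.2)

/-- The element of the surface group that a word represents. -/
def eval (w : List Letter) : SurfaceGroup := PresentedGroup.mk {relator} (FreeGroup.mk w)

/-- The word length of a conjugacy class: the least length of a word that represents one of its
elements. -/
noncomputable def wordLength (C : ConjClasses SurfaceGroup) : ℕ :=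
  sInf {k | ∃ w : List Letter, w.length = k ∧ ConjClasses.mk (eval w) = C}

/-- The set `F_n` of conjugacy classes of word length `n`. -/
def classes (n : ℕ) : Set (ConjClasses SurfaceGroup) := {C | wordLength C = n}

/-! ### Directions in the planar Cayley graph

The Cayley graph is embedded in the hyperbolic plane so that the boundary of each of its octagons,
read counterclockwise, is the cyclic word `a b A B c d C D`.  The edges leaving a vertex are then,
in counterclockwise order, `a, d, C, D, c, b, A, B`. -/

/-- The letter of the next edge, counterclockwise, around the common initial vertex. -/
def ccw : Letter → Letter
  | (.a, true) => (.d, true)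
  | (.d, true) => (.c, false)
  | (.c, false) => (.d, false)
  | (.d, false) => (.c, true)
  | (.c, true) => (.b, true)
  | (.b, true) => (.a, false)
  | (.a, false) => (.b, false)
  | (.b, false) => (.a, true)

/-- The letter of the next edge, clockwise, around the common initial vertex. -/
def cw : Letter → Letter
  | (.d, true) => (.a, true)
  | (.c, false) => (.d, true)
  | (.d, false) => (.c, false)
  | (.c, true) => (.d, false)
  | (.b, true) => (.c, true)
  | (.a, false) => (.b, true)
  | (.b, false) => (.a, false)
  | (.a, true) => (.b, false)

/-- After the edge `k` has been traversed, the edges leaving its final vertex other than the way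
back are `turn k 1, …, turn k 7`, from the rightmost to the leftmost one. -/
def turn (k : Letter) (i : ℕ) : Letter := ccw^[i] (inv k)

/-- The rightmost continuation: the next edge of the octagon to the right of `k`. -/
def rightTurn (k : Letter) : Letter := ccw (inv k)

/-- The leftmost continuation: the next edge of the octagon to the left of `k`. -/
def leftTurn (k : Letter) : Letter := cw (inv k)

/-- The octagon that lies between the edges `ccw s` (on its left) and `s` (on its right) out of a
common vertex `v` is traversed from `v` to the opposite vertex along two paths of four edges.
`leftSide s t` is edge number `t` (`t = 0, 1, 2, 3`) of the path on the left. -/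
def leftSide (s : Letter) (t : ℕ) : Letter := rightTurn^[t] (ccw s)

/-- Edge number `t` (`t = 0, 1, 2, 3`) of the path on the right; see `leftSide`. -/
def rightSide (s : Letter) (t : ℕ) : Letter := leftTurn^[t] s

/-! ### The Markov chain -/

/-- Left or right. -/
inductive Side
  | L | R
  deriving DecidableEq

/-- The 88 Markov states, one for each kind of step of a snake up to deck transformations.

* `A k`, `A₁ h k`, `A₂ h k`: the single edge `k`.  The region of an `A` state is the part of the
  plane that lies beyond the wall crossed by `k`, but beyond neither of the two neighbouring walls
  at the initial vertex of `k`; for `A₁` (that is, `A'`) one wedge has been cut from it on the side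
  `h`, and for `A₂` (that is, `A''`) the whole extreme part on the side `h` is missing.
* `B s`, `C s`, `C₁ s`, `D s` (with `C₁` for `C'`): the two edges number `0`, `1`, `2`, `3`,
  respectively, of the two paths around the octagon between the letters `ccw s` and `s`; in terms
  of its two edges `j` on the left and `k` on the right, the state is `B_{jk}`, `C_{jk}`,
  `C'_{jk}`, `D_{jk}` with `j = leftSide s t` and `k = rightSide s t`.
* `E h s`: the two last edges `leftSide s 3` and `rightSide s 3` of this octagon together with the
  edge that diverges on the side `h`, which is the first one of the two paths around the next
  octagon: `E^L_{ijk}` has `j = leftSide s 3`, `k = rightSide s 3` and `i = ccw j`, and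
  `E^R_{ijk}` has `i = leftSide s 3`, `j = rightSide s 3` and `k = cw j`. -/
inductive State
  | A (k : Letter)
  | A₁ (h : Side) (k : Letter)
  | A₂ (h : Side) (k : Letter)
  | B (s : Letter)
  | C (s : Letter)
  | C₁ (s : Letter)
  | D (s : Letter)
  | E (h : Side) (s : Letter)
  deriving DecidableEq

open State Side

/-- The edges of a step, from left to right (the subscripts of the state). -/
def edges : State → List Letter
  | A k => [k]
  | A₁ _ k => [k]
  | A₂ _ k => [k]
  | B s => [leftSide s 0, rightSide s 0]
  | C s => [leftSide s 1, rightSide s 1]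
  | C₁ s => [leftSide s 2, rightSide s 2]
  | D s => [leftSide s 3, rightSide s 3]
  | E L s => [ccw (leftSide s 3), leftSide s 3, rightSide s 3]
  | E R s => [leftSide s 3, rightSide s 3, cw (rightSide s 3)]

/-- The leftmost edge of a step (the list `edges J` is never empty, so that the default value plays
no role). -/
def leftEdge (J : State) : Letter := (edges J).headD (.a, true)

/-- `Follows J K`: the state `K` may follow the state `J`, that is, the edges of `K` start where
those of `J` end, and the region of `K` is one of the pieces into which the region of `J` is cut
by the walls around that vertex (or around the octagon being traversed).

Out of a vertex entered along `k`, the piece beyond exactly one wall, that of `turn k i`, is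
an `A`, `A'` or `A''` region, and the piece beyond the two walls of `turn k (i + 1)` and
`turn k i` is a `B` region, of the state `B (turn k i)`. -/
inductive Follows : State → State → Prop
  -- five middle pieces of a full region; the two extreme ones have lost a wedge on the far side
  | A_A (k : Letter) (i : ℕ) : 2 ≤ i → i ≤ 6 → Follows (A k) (A (turn k i))
  | A_A₁R (k : Letter) : Follows (A k) (A₁ R (turn k 1))
  | A_A₁L (k : Letter) : Follows (A k) (A₁ L (turn k 7))
  | A_B (k : Letter) (i : ℕ) : 1 ≤ i → i ≤ 6 → Follows (A k) (B (turn k i))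
  -- on the side of the missing wedge, the extreme piece is narrower
  | A₁_A (h : Side) (k : Letter) (i : ℕ) : 2 ≤ i → i ≤ 6 → Follows (A₁ h k) (A (turn k i))
  | A₁R_A₂R (k : Letter) : Follows (A₁ R k) (A₂ R (turn k 1))
  | A₁R_A₁L (k : Letter) : Follows (A₁ R k) (A₁ L (turn k 7))
  | A₁L_A₁R (k : Letter) : Follows (A₁ L k) (A₁ R (turn k 1))
  | A₁L_A₂L (k : Letter) : Follows (A₁ L k) (A₂ L (turn k 7))
  | A₁_B (h : Side) (k : Letter) (i : ℕ) : 1 ≤ i → i ≤ 6 → Follows (A₁ h k) (B (turn k i))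
  -- the extreme edge on the side of the cut, and the `B` piece next to it, are no longer available
  | A₂_A (h : Side) (k : Letter) (i : ℕ) : 2 ≤ i → i ≤ 6 → Follows (A₂ h k) (A (turn k i))
  | A₂R_A₁L (k : Letter) : Follows (A₂ R k) (A₁ L (turn k 7))
  | A₂R_B (k : Letter) (i : ℕ) : 2 ≤ i → i ≤ 6 → Follows (A₂ R k) (B (turn k i))
  | A₂L_A₁R (k : Letter) : Follows (A₂ L k) (A₁ R (turn k 1))
  | A₂L_B (k : Letter) (i : ℕ) : 1 ≤ i → i ≤ 5 → Follows (A₂ L k) (B (turn k i))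
  -- around an octagon
  | B_C (s : Letter) : Follows (B s) (C s)
  | C_C₁ (s : Letter) : Follows (C s) (C₁ s)
  | C₁_D (s : Letter) : Follows (C₁ s) (D s)
  | C₁_E (h : Side) (s : Letter) : Follows (C₁ s) (E h s)
  -- the next octagon lies between the two edges with a common initial vertex
  | EL_C (s : Letter) : Follows (E L s) (C (leftSide s 3))
  | ER_C (s : Letter) : Follows (E R s) (C (cw (rightSide s 3)))
  -- from the last vertex of an octagon: the way back along `leftSide s 3` is `turn _ 7`
  | D_A (s : Letter) (i : ℕ) : 2 ≤ i → i ≤ 5 → Follows (D s) (A (turn (rightSide s 3) i))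
  | D_A₁R (s : Letter) : Follows (D s) (A₁ R (turn (rightSide s 3) 1))
  | D_A₁L (s : Letter) : Follows (D s) (A₁ L (turn (rightSide s 3) 6))
  | D_B (s : Letter) (i : ℕ) : 1 ≤ i → i ≤ 5 → Follows (D s) (B (turn (rightSide s 3) i))

/-- The elements of the Markov chain of period `n` (`n` need not be the least period): the
bi-infinite sequences of states that obey the transition rule and are fixed by the `n`-th power of
the shift. -/
def periodic (n : ℕ) : Set (ℤ → State) :=
  {x | (∀ i, Follows (x i) (x (i + 1))) ∧ ∀ i, x (i + n) = x i}

/-- The map `p_n`: read off the leftmost edges over one period and take the conjugacy class of the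
element that the resulting word represents. -/
def p (n : ℕ) (x : ℤ → State) : ConjClasses SurfaceGroup :=
  ConjClasses.mk (eval ((List.range n).map fun i : ℕ => leftEdge (x (i : ℤ))))

/-! ### The measures -/

instance : MeasurableSpace State := ⊤

instance : MeasurableSpace (ConjClasses SurfaceGroup) := ⊤

instance : DiscreteMeasurableSpace State := ⟨fun _ => trivial⟩

instance : Countable Gen :=
  Function.Injective.countable (f := fun g : Gen => match g with | .a => 0 | .b => 1 | .c => 2 | .d => 3)
    (β := ℕ) (by intro x y h; cases x <;> cases y <;> simp_all)

instance : Countable State :=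
  Function.Injective.countable (β := ℕ × Bool × Letter)
    (f := fun J => match J with
      | .A k => (0, true, k) | .A₁ .L k => (1, true, k) | .A₁ .R k => (1, false, k)
      | .A₂ .L k => (2, true, k) | .A₂ .R k => (2, false, k) | .B k => (3, true, k)
      | .C k => (4, true, k) | .C₁ k => (5, true, k) | .D k => (6, true, k)
      | .E .L k => (7, true, k) | .E .R k => (7, false, k))
    (by rintro (_ | ⟨_ | _, _⟩ | ⟨_ | _, _⟩ | _ | _ | _ | _ | ⟨_ | _, _⟩)
          (_ | ⟨_ | _, _⟩ | ⟨_ | _, _⟩ | _ | _ | _ | _ | ⟨_ | _, _⟩) h <;> simp_all)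

/-- The map `p n` depends only on finitely many coordinates, so it is measurable. -/
theorem measurable_p (n : ℕ) : Measurable (p n) := by
  let r : (ℤ → State) → (Fin n → State) := fun x i => x (i : ℕ)
  let q : (Fin n → State) → ConjClasses SurfaceGroup := fun y =>
    ConjClasses.mk (eval ((List.finRange n).map fun i => leftEdge (y i)))
  have hr : Measurable r := measurable_pi_lambda _ fun i => measurable_pi_apply _
  have hq : Measurable q := measurable_of_countable q
  have h : p n = q ∘ r := by
    funext x
    simp only [p, q, r, ← List.map_coe_finRange_eq_range, List.map_map]
    rfl
  rw [h]
  exact hq.comp hr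

/-- The uniform probability measure on the set of points of period `n`. -/
noncomputable def lam (n : ℕ) : Measure (ℤ → State) := uniformOn (periodic n)

/-- The uniform probability measure on the set of conjugacy classes of word length `n`. -/
noncomputable def mu (n : ℕ) : Measure (ConjClasses SurfaceGroup) := uniformOn (classes n)

instance (n : ℕ) : IsFiniteMeasure (lam n) := by unfold lam uniformOn; infer_instance

instance (n : ℕ) : IsFiniteMeasure (mu n) := by unfold mu uniformOn; infer_instance

/-- The total variation norm `|m₁ - m₂|(X)` of the difference of two finite measures. -/
noncomputable def tvNorm {X : Type*} [MeasurableSpace X] (m₁ m₂ : Measure X)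
    [IsFiniteMeasure m₁] [IsFiniteMeasure m₂] : ENNReal :=
  (m₁.toSignedMeasure - m₂.toSignedMeasure).totalVariation Set.univ

end Snake

namespace Snake

/-! ### Letters and directions -/

/-! The group acts on the hyperbolic plane, tiled by the regular octagons dual to Γ. Their sides lie
on lines, the walls, and an edge of Γ crosses exactly one wall. Everything is done in a Lorentz
lattice over ℤ[√2]: walls are vectors of norm 2 with odd height (`IsRoot`), vertices are the
functionals `pt g`, and the sign of `pt g v` tells the side of the wall `v` on which `g` lies.
Discreteness is arithmetic: the Galois conjugate of the form is definite, so the conjugate height of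
a root is bounded, and its height, having odd norm, stays away from 0.

A finite automaton on turn numbers accepts the shortest words that have been pushed as far left as
possible (`Tight`). Inequalities for heights, carried backwards along an accepted word, show that
its end lies beyond the first wall and not beyond the wall to the left of it. Hence a tight word is
determined by its length and its element (`Tight.eq_of_eval_eq`), and a path all of whose parts are
tight never recrosses a wall. The leftmost edges of every sequence of the Markov chain spell such a
path. Any other path with the same translation must cross all its walls, for otherwise infinitely
many translates of one wall would separate two fixed vertices; counting walls modulo the translation
gives minimality (`mapsTo_p`).

The map need not be injective up to shift, but it is for sequences that go straight on (turn 4)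
somewhere. At such a vertex the walls before and after are opposite, and angle estimates
(`not_chain`) leave no room for another tight path with the same translation to avoid the vertex. So
the words agree up to a shift (`TightSeq.exists_shift`), and a straight turn makes the word
determine the states (`eq_of_leftWord_eq`). If moreover `n` is the least period, the fibre consists
of exactly `n` shifts (`ncard_fiber`). Conversely, a class all of whose words of length `n` contain
a straight turn is reached (`exists_straight`): take a word of least cyclic turn sum and cut it at a
straight turn.

What remains is negligible. There are at least (13/2)^(n-2) periodic sequences, while those without
a straight turn, those of smaller period and the words without a straight turn number at most
constants times (32/5)^n, n·4^n and 6^n. Off these exceptions the map is exactly `n` to one, so the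
two uniform measures differ by a quantity of order n²(64/65)^n. -/

instance : Fintype Gen := ⟨{.a, .b, .c, .d}, by intro x; cases x <;> decide⟩

/-- The position of a letter in the counterclockwise order `a, d, C, D, c, b, A, B`. -/
def dir : Letter → Fin 8
  | (.a, true) => 0
  | (.d, true) => 1
  | (.c, false) => 2
  | (.d, false) => 3
  | (.c, true) => 4
  | (.b, true) => 5
  | (.a, false) => 6
  | (.b, false) => 7

/-- The number of the turn from the edge `k` to the edge `k'`; `0` is the way back. -/
def turnNum (k k' : Letter) : Fin 8 := dir k' - dir (inv k)

theorem dir_injective : Function.Injective dir := by decide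

theorem inv_inv (k : Letter) : inv (inv k) = k := by revert k; decide

theorem turnNum_turn : ∀ (k : Letter) (t : Fin 8), turnNum k (turn k t) = t := by decide

theorem turn_turnNum : ∀ k k' : Letter, turn k (turnNum k k') = k' := by decide

/-! ### The Lorentz lattice -/

/-- The lattice spanned by the normal vectors of the walls around a vertex. -/
abbrev Vec : Type := Fin 3 → Zsqrtd 2

/-- The normal vectors of the eight walls around the base vertex. -/
def wall : Fin 8 → Vec
  | 0 => ![⟨1, 0⟩, ⟨0, 0⟩, ⟨0, 0⟩]
  | 1 => ![⟨0, 0⟩, ⟨1, 0⟩, ⟨0, 0⟩]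
  | 2 => ![⟨0, 0⟩, ⟨0, 0⟩, ⟨1, 0⟩]
  | 3 => ![⟨1, 0⟩, ⟨-1, -1⟩, ⟨1, 1⟩]
  | 4 => ![⟨1, 1⟩, ⟨-2, -2⟩, ⟨2, 1⟩]
  | 5 => ![⟨2, 1⟩, ⟨-3, -2⟩, ⟨2, 1⟩]
  | 6 => ![⟨2, 1⟩, ⟨-2, -2⟩, ⟨1, 1⟩]
  | 7 => ![⟨1, 1⟩, ⟨-1, -1⟩, ⟨1, 0⟩]

/-- `coef j` is the coefficient in the reflection of `wall (i + j)` in `wall i`. -/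
def coef : Fin 8 → Zsqrtd 2
  | 0 => ⟨-2, 0⟩
  | 1 => ⟨0, 1⟩
  | 2 => ⟨4, 4⟩
  | 3 => ⟨8, 7⟩
  | 4 => ⟨10, 8⟩
  | 5 => ⟨8, 7⟩
  | 6 => ⟨4, 4⟩
  | 7 => ⟨0, 1⟩

/-- The height of a vector over the base vertex. -/
def height (v : Vec) : Zsqrtd 2 := v 0 + v 1 + v 2

/-- Twice the Lorentz product. -/
def form (v w : Vec) : Zsqrtd 2 :=
  2 * (v 0 * w 0 + v 1 * w 1 + v 2 * w 2) - ⟨0, 1⟩ * (v 0 * w 1 + v 1 * w 0 + v 1 * w 2 + v 2 * w 1)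
    - ⟨4, 4⟩ * (v 0 * w 2 + v 2 * w 0)

theorem height_add (v w : Vec) : height (v + w) = height v + height w := by
  simp [height]; ring

theorem height_smul (c : Zsqrtd 2) (v : Vec) : height (c • v) = c * height v := by
  simp [height]; ring

theorem form_add (u v w : Vec) : form u (v + w) = form u v + form u w := by
  simp [form]; ring

theorem form_smul (c : Zsqrtd 2) (u v : Vec) : form u (c • v) = c * form u v := by
  simp [form]; ring

theorem form_comm (u v : Vec) : form u v = form v u := by
  simp [form]; ring

theorem vec_eq (v : Vec) : v = v 0 • wall 0 + v 1 • wall 1 + v 2 • wall 2 := by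
  funext i
  fin_cases i <;>
    simp [wall, show (⟨1, 0⟩ : Zsqrtd 2) = 1 from rfl, show (⟨0, 0⟩ : Zsqrtd 2) = 0 from rfl]

/-- The matrix by which a letter acts. -/
def mat (k : Letter) : Matrix (Fin 3) (Fin 3) (Zsqrtd 2) := fun i j =>
  wall (dir k + dir (inv k) - Fin.castLE (by omega) j) i +
    coef (dir (inv k) - Fin.castLE (by omega) j) * wall (dir k) i

/-- A letter acts as the symmetry `j ↦ dir k + dir (inv k) - j` of the eight walls at the base
vertex, followed by the reflection in its own wall. The columns of `mat k` are the cases `j = 0, 1,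
2`, since these walls are the standard basis. -/
theorem mat_mulVec_wall : ∀ (k : Letter) (j : Fin 8), (mat k).mulVec (wall j) =
    wall (dir k + dir (inv k) - j) + coef (dir (inv k) - j) • wall (dir k) := by
  decide +kernel

theorem mat_mul_inv : ∀ k : Letter, mat k * mat (inv k) = 1 := by
  decide +kernel

/-- The matrix of a generator as a unit. -/
def unitMat (x : Gen) : (Matrix (Fin 3) (Fin 3) (Zsqrtd 2))ˣ :=
  ⟨mat (x, true), mat (x, false), mat_mul_inv (x, true), mat_mul_inv (x, false)⟩

theorem relator_mat : mat (.a, true) * mat (.b, true) * mat (.a, false) * mat (.b, false) *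
    mat (.c, true) * mat (.d, true) * mat (.c, false) * mat (.d, false) = 1 := by
  decide +kernel

/-- The Lorentz representation of the surface group. -/
def rep : SurfaceGroup →* (Matrix (Fin 3) (Fin 3) (Zsqrtd 2))ˣ :=
  PresentedGroup.toGroup (f := unitMat) (by
    rintro r rfl
    apply Units.ext
    simp only [relator, map_mul, map_inv, FreeGroup.lift_apply_of, Units.val_mul, Units.val_one]
    exact relator_mat)

/-- The action of the surface group on the lattice. -/
def act (g : SurfaceGroup) (v : Vec) : Vec := (rep g).1.mulVec v

theorem act_one (v : Vec) : act 1 v = v := by simp [act]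

theorem act_mul (g h : SurfaceGroup) (v : Vec) : act (g * h) v = act g (act h v) := by
  simp [act]

theorem act_inv_act (g : SurfaceGroup) (v : Vec) : act g⁻¹ (act g v) = v := by
  rw [← act_mul, inv_mul_cancel, act_one]

theorem act_act_inv (g : SurfaceGroup) (v : Vec) : act g (act g⁻¹ v) = v := by
  rw [← act_mul, mul_inv_cancel, act_one]

theorem act_add (g : SurfaceGroup) (v w : Vec) : act g (v + w) = act g v + act g w := by
  simp [act, Matrix.mulVec_add]

theorem act_smul (g : SurfaceGroup) (c : Zsqrtd 2) (v : Vec) : act g (c • v) = c • act g v := by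
  simp [act, Matrix.mulVec_smul]

/-! ### Words -/

theorem eval_nil : eval [] = 1 := rfl

theorem eval_append (v w : List Letter) : eval (v ++ w) = eval v * eval w := by
  simp only [eval, ← map_mul, FreeGroup.mul_mk]

theorem eval_cons (k : Letter) (w : List Letter) : eval (k :: w) = eval [k] * eval w :=
  eval_append [k] w

theorem eval_inv (k : Letter) : eval [inv k] = (eval [k])⁻¹ := by
  rw [eval, eval, ← map_inv, FreeGroup.inv_mk]
  simp [FreeGroup.invRev, inv]

theorem exists_eval (g : SurfaceGroup) : ∃ w, eval w = g := by
  obtain ⟨x, rfl⟩ := PresentedGroup.mk_surjective {relator} g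
  exact ⟨x.toWord, by rw [eval, FreeGroup.mk_toWord]⟩

theorem rep_letter (k : Letter) : (rep (eval [k])).1 = mat k := by
  obtain ⟨x, b⟩ := k
  have h : rep (eval [(x, true)]) = unitMat x := by
    change rep (PresentedGroup.of x) = _
    simp [rep]
  cases b
  · have := eval_inv (x, true)
    simp only [inv, Bool.not_true] at this
    rw [this, map_inv, h]
    rfl
  · rw [h]; rfl

theorem act_letter_wall (k : Letter) (j : Fin 8) : act (eval [k]) (wall j) =
    wall (dir k + dir (inv k) - j) + coef (dir (inv k) - j) • wall (dir k) := by
  rw [act, rep_letter, mat_mulVec_wall]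

theorem act_letter_inv_wall (k : Letter) (j : Fin 8) : act (eval [k])⁻¹ (wall j) =
    wall (dir k + dir (inv k) - j) + coef (dir k - j) • wall (dir (inv k)) := by
  rw [← eval_inv, act_letter_wall, inv_inv, add_comm (dir (inv k))]

theorem eval_rotate {k : Letter} {w : List Letter} (h : eval (k :: w) = 1) :
    eval (w ++ [k]) = 1 := by
  rw [eval_cons] at h
  rw [eval_append, mul_eq_one_iff_eq_inv.1 h, mul_inv_cancel]

theorem eval_reverse_inv (w : List Letter) : eval (w.reverse.map inv) = (eval w)⁻¹ := by
  induction w with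
  | nil => simp [eval_nil]
  | cons k w ih =>
    rw [List.reverse_cons, List.map_append, eval_append, ih, List.map_singleton, eval_inv,
      eval_cons k w, mul_inv_rev]

theorem eval_octagon (s : Letter) : eval ((List.range 8).map fun i => leftTurn^[i] s) = 1 := by
  have h0 : eval ((List.range 8).map fun i => leftTurn^[i] (.a, true)) = 1 := by
    change PresentedGroup.mk {relator} relator = 1
    exact PresentedGroup.one_of_mem rfl
  have h1 := eval_rotate h0
  have h2 := eval_rotate h1
  have h3 := eval_rotate h2
  have h4 := eval_rotate h3
  have h5 := eval_rotate h4
  have h6 := eval_rotate h5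
  have h7 := eval_rotate h6
  obtain ⟨_ | _ | _ | _, _ | _⟩ := s
  exacts [h2, h0, h3, h1, h6, h4, h7, h5]

/-- The two sides of an octagon represent the same element. -/
theorem eval_sides (s : Letter) : eval ((List.range 4).map (leftSide s)) =
    eval ((List.range 4).map (rightSide s)) := by
  have h : (List.range 8).map (fun i => leftTurn^[i] s) = (List.range 4).map (rightSide s) ++
      ((List.range 4).map (leftSide s)).reverse.map inv := by
    revert s; decide
  have h' := eval_octagon s
  rw [h, eval_append, eval_reverse_inv, mul_inv_eq_one] at h'
  exact h'.symm

/-! ### Invariance -/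

theorem height_wall : ∀ j, height (wall j) = 1 := by decide

theorem form_add_left (u v w : Vec) : form (u + v) w = form u w + form v w := by
  rw [form_comm, form_add, form_comm w, form_comm w]

theorem form_smul_left (c : Zsqrtd 2) (u v : Vec) : form (c • u) v = c * form u v := by
  rw [form_comm, form_smul, form_comm v]

theorem form_act_letter (k : Letter) (v w : Vec) :
    form (act (eval [k]) v) (act (eval [k]) w) = form v w := by
  have h (i j : Fin 8) : form (act (eval [k]) (wall i)) (act (eval [k]) (wall j)) =
      form (wall i) (wall j) := by
    rw [act, act, rep_letter]
    revert k i j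
    decide +kernel
  rw [vec_eq v, vec_eq w]
  simp only [act_add, act_smul, form_add, form_smul, form_add_left, form_smul_left, h]

theorem height_act_letter (k : Letter) (v : Vec) :
    height (act (eval [k]) v) = height v - form (wall (dir (inv k))) v := by
  have h (i : Fin 8) : height (act (eval [k]) (wall i)) =
      1 - form (wall (dir (inv k))) (wall i) := by
    rw [act, rep_letter]
    revert k i
    decide +kernel
  rw [vec_eq v]
  simp only [act_add, act_smul, form_add, form_smul, h, height_add, height_smul, height_wall]
  ring

/-- This evenness is what keeps the parity of heights, and with it the notion of a root, invariant
under the group. -/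
theorem even_re_form_wall (j : Fin 8) (v : Vec) : Even (form (wall j) v).re := by
  have h : ∀ i j : Fin 8, (form (wall i) (wall j)).re % 2 = 0 := by decide +kernel
  rw [vec_eq v, form_add, form_add, form_smul, form_smul, form_smul, Int.even_iff]
  simp only [Zsqrtd.re_add, Zsqrtd.re_mul]
  have h0 := h j 0
  have h1 := h j 1
  have h2 := h j 2
  simp only [← Int.even_iff] at h0 h1 h2 ⊢
  refine ((Even.add ?_ ?_).add (Even.add ?_ ?_)).add (Even.add ?_ ?_)
  all_goals first | exact Even.mul_left ‹_› _ | (rw [mul_assoc]; exact even_two_mul _)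

/-- The normal vectors of walls. -/
def IsRoot (v : Vec) : Prop := form v v = 2 ∧ Odd (height v).re

theorem isRoot_wall (j : Fin 8) : IsRoot (wall j) := by
  refine ⟨by revert j; decide, by rw [height_wall]; exact odd_one⟩

theorem isRoot_act_letter (k : Letter) {v : Vec} (h : IsRoot v) : IsRoot (act (eval [k]) v) := by
  refine ⟨by rw [form_act_letter, h.1], ?_⟩
  rw [height_act_letter, Zsqrtd.re_sub]
  exact h.2.sub_even (even_re_form_wall _ _)

theorem form_act (g : SurfaceGroup) (v w : Vec) : form (act g v) (act g w) = form v w := by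
  obtain ⟨l, rfl⟩ := exists_eval g
  induction l with
  | nil => simp [eval_nil, act_one]
  | cons k l ih => rw [eval_cons, act_mul, act_mul, form_act_letter, ih]

theorem IsRoot.act {v : Vec} (h : IsRoot v) (g : SurfaceGroup) : IsRoot (act g v) := by
  obtain ⟨l, rfl⟩ := exists_eval g
  induction l with
  | nil => simpa [eval_nil, act_one]
  | cons k l ih => rw [eval_cons, act_mul]; exact isRoot_act_letter k ih

theorem height_neg (v : Vec) : height (-v) = -height v := by
  simp [height]; ring

theorem form_neg (v w : Vec) : form v (-w) = -form v w := by
  simp [form]; ring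

theorem act_neg (g : SurfaceGroup) (v : Vec) : act g (-v) = -act g v := by
  simp [act, Matrix.mulVec_neg]

theorem IsRoot.neg {v : Vec} (h : IsRoot v) : IsRoot (-v) := by
  refine ⟨by rw [form_neg, form_comm, form_neg, neg_neg, h.1], ?_⟩
  rw [height_neg, Zsqrtd.re_neg]
  exact h.2.neg

/-! ### Real coordinates -/

/-- The value of an element of `ℤ√2` when a square root `r` of `2` is chosen. -/
noncomputable def val (r : ℝ) (z : Zsqrtd 2) : ℝ := z.re + z.im * r

theorem val_add (r : ℝ) (y z : Zsqrtd 2) : val r (y + z) = val r y + val r z := by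
  simp [val]; ring

theorem val_neg (r : ℝ) (z : Zsqrtd 2) : val r (-z) = -val r z := by
  simp [val]; ring

theorem val_sub (r : ℝ) (y z : Zsqrtd 2) : val r (y - z) = val r y - val r z := by
  simp [val]; ring

theorem val_mul {r : ℝ} (hr : r * r = 2) (y z : Zsqrtd 2) : val r (y * z) = val r y * val r z := by
  simp only [val, Zsqrtd.re_mul, Zsqrtd.im_mul]
  push_cast
  linear_combination (-(y.im : ℝ) * z.im) * hr

theorem val_one (r : ℝ) : val r 1 = 1 := by simp [val]

theorem val_two (r : ℝ) : val r 2 = 2 := by simp [val]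

/-- The first horizontal coordinate. -/
noncomputable def coordX (r : ℝ) (v : Vec) : ℝ := (1 + r) * val r (v 0) + (1 + r / 2) * val r (v 1)

/-- The second horizontal coordinate. -/
noncomputable def coordY (r : ℝ) (v : Vec) : ℝ := (1 + r / 2) * val r (v 1) + (1 + r) * val r (v 2)

/-- The vertical coordinate. -/
noncomputable def coordT (r : ℝ) (v : Vec) : ℝ := val r (height v)

/-- The form is diagonal in these coordinates, for either root `r` of 2. It has signature (2, 1) for
`r = √2` and is definite for `r = -√2`. -/
theorem val_form {r : ℝ} (hr : r * r = 2) (v w : Vec) : val r (form v w) =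
    2 * (coordX r v * coordX r w + coordY r v * coordY r w
      - (2 + 2 * r) * (coordT r v * coordT r w)) := by
  have h2 : val r ⟨0, 1⟩ = r := by simp [val]
  have h3 : val r ⟨4, 4⟩ = 4 + 4 * r := by simp [val]
  simp only [form, height, coordX, coordY, coordT, val_add, val_sub, val_mul hr, val_two, h2, h3]
  linear_combination (-(2 * val r (v 0) * val r (w 0) + val r (v 0) * val r (w 1)
    + val r (v 1) * val r (w 0) + val r (v 1) * val r (w 1) + val r (v 1) * val r (w 2)
    + val r (v 2) * val r (w 1) + 2 * val r (v 2) * val r (w 2))) * hr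

theorem sqrt_two_mul : √2 * √2 = 2 := Real.mul_self_sqrt (by norm_num)

theorem sqrt_two_gt : 1.4142 < √2 := Real.lt_sqrt_of_sq_lt (by norm_num)

theorem sqrt_two_lt : √2 < 1.4143 := by
  rw [Real.sqrt_lt' (by norm_num)]; norm_num

theorem eq_zero_of_val {z : Zsqrtd 2} (h : val √2 z = 0) : z = 0 := by
  have h1 : ((z.re * z.re : ℤ) : ℝ) = ((2 * z.im * z.im : ℤ) : ℝ) := by
    have : (z.re : ℝ) = -(z.im * √2) := by unfold val at h; linarith
    push_cast
    rw [this]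
    linear_combination (z.im : ℝ) * z.im * sqrt_two_mul
  have hns : Zsqrtd.norm z = 0 := by
    rw [Zsqrtd.norm_def]
    have : z.re * z.re = 2 * z.im * z.im := by exact_mod_cast h1
    omega
  refine (Zsqrtd.norm_eq_zero (fun n hn => ?_) z).1 hns
  have h3 : n < 2 := by nlinarith
  have h4 : -2 < n := by nlinarith
  interval_cases n <;> omega

theorem eq_zero_of_coord {v : Vec} (hX : coordX √2 v = 0) (hY : coordY √2 v = 0)
    (hT : coordT √2 v = 0) : v = 0 := by
  have h2 := sqrt_two_mul
  have h3 := sqrt_two_gt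
  simp only [coordX, coordY, coordT, height, val_add] at hX hY hT
  have h1 : val √2 (v 1) = 0 := by
    have : (√2 + 1) * (1 - √2) * val √2 (v 1) = 0 := by
      linear_combination (1 + √2) * hT - hX - hY - val √2 (v 1) * h2
    have h4 : (√2 + 1) * (1 - √2) ≠ 0 := by nlinarith
    exact (mul_eq_zero.1 this).resolve_left h4
  rw [h1] at hX hY
  have h5 : 1 + √2 ≠ 0 := by positivity
  have h0 : val √2 (v 0) = 0 := by simpa [h5] using hX
  have h2 : val √2 (v 2) = 0 := by simpa [h5] using hY
  funext i
  fin_cases i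
  exacts [eq_zero_of_val h0, eq_zero_of_val h1, eq_zero_of_val h2]

/-! ### Points of the orbit as functionals -/

/-- The height of a vector over the vertex `g`.  For the normal vector of a wall it is positive
before and negative beyond the wall. -/
noncomputable def pt (g : SurfaceGroup) (v : Vec) : ℝ := coordT √2 (act g⁻¹ v)

theorem pt_one (v : Vec) : pt 1 v = coordT √2 v := by rw [pt, inv_one, act_one]

theorem pt_mul (g h : SurfaceGroup) (v : Vec) : pt (g * h) v = pt h (act g⁻¹ v) := by
  rw [pt, mul_inv_rev, act_mul, pt]

theorem pt_mul_act (g h : SurfaceGroup) (v : Vec) : pt (g * h) (act g v) = pt h v := by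
  rw [pt_mul, act_inv_act]

theorem pt_add (g : SurfaceGroup) (v w : Vec) : pt g (v + w) = pt g v + pt g w := by
  simp only [pt, act_add, coordT, height_add, val_add]

theorem pt_neg (g : SurfaceGroup) (v : Vec) : pt g (-v) = -pt g v := by
  simp only [pt, act_neg, coordT, height_neg, val_neg]

theorem pt_smul (g : SurfaceGroup) (c : Zsqrtd 2) (v : Vec) : pt g (c • v) = val √2 c * pt g v := by
  simp only [pt, act_smul, coordT, height_smul, val_mul sqrt_two_mul]

theorem pt_act_wall (g : SurfaceGroup) (j : Fin 8) : pt g (act g (wall j)) = 1 := by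
  rw [pt, act_inv_act, coordT, height_wall, val_one]

theorem act_letter_inv_wall_self (k : Letter) :
    act (eval [k])⁻¹ (wall (dir k)) = -wall (dir (inv k)) := by
  rw [act_letter_inv_wall, sub_self, add_sub_cancel_left, show coef 0 = -2 from rfl]
  module

/-! ### Roots -/

theorem coord_root {r : ℝ} (hr : r * r = 2) {v : Vec} (h : IsRoot v) :
    coordX r v ^ 2 + coordY r v ^ 2 = 1 + (2 + 2 * r) * coordT r v ^ 2 := by
  have := val_form hr v v
  rw [h.1, val_two] at this
  linarith

/-- For `r = -√2` the coefficient `2 + 2r` is negative, so a root lies on an ellipsoid; 1.2073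
exceeds 1 / (2√2 - 2). -/
theorem conj_height_sq {v : Vec} (h : IsRoot v) : coordT (-√2) v ^ 2 < 1.2073 := by
  have h1 := coord_root (r := -√2) (by rw [neg_mul_neg, sqrt_two_mul]) h
  have h2 := sqrt_two_gt
  nlinarith [sq_nonneg (coordX (-√2) v), sq_nonneg (coordY (-√2) v), sq_nonneg (coordT (-√2) v)]

/-- The height times its conjugate is an odd integer, hence at least 1 in absolute value, and the
conjugate is below 1.0988. This gap replaces any appeal to discreteness of the group. -/
theorem abs_height_root {v : Vec} (h : IsRoot v) : 0.91 < |coordT √2 v| := by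
  have h1 := conj_height_sq h
  have h2 : 1 ≤ |coordT √2 v * coordT (-√2) v| := by
    have h3 : coordT √2 v * coordT (-√2) v = ((height v).norm : ℤ) := by
      simp only [coordT, val, Zsqrtd.norm_def]
      push_cast
      linear_combination (-((height v).im : ℝ) ^ 2) * sqrt_two_mul
    rw [h3, ← Int.cast_abs]
    have h4 : (height v).norm ≠ 0 := by
      intro h0
      have h5 : Odd ((height v).norm) := by
        rw [Zsqrtd.norm_def]
        refine (h.2.mul h.2).sub_even ?_
        rw [mul_assoc]
        exact even_two_mul _
      rw [h0] at h5
      exact absurd h5 (by decide)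
    exact_mod_cast Int.one_le_abs h4
  rw [abs_mul] at h2
  by_contra h3
  push Not at h3
  have h4 : |coordT (-√2) v| < 1.0988 := by
    refine abs_lt_of_sq_lt_sq ?_ (by norm_num)
    linarith [show (1.2073 : ℝ) < 1.0988 ^ 2 by norm_num]
  nlinarith [abs_nonneg (coordT √2 v), abs_nonneg (coordT (-√2) v)]

theorem height_pos_root {v : Vec} (h : IsRoot v) (h0 : 0 < coordT √2 v) : 0.91 < coordT √2 v := by
  have := abs_height_root h
  rwa [abs_of_pos h0] at this

theorem pt_root_ne_zero {v : Vec} (h : IsRoot v) (g : SurfaceGroup) : pt g v ≠ 0 := by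
  intro h0
  have := abs_height_root (h.act g⁻¹)
  rw [← pt, h0, abs_zero] at this
  norm_num at this

theorem coordT_act_letter_inv (k : Letter) (v : Vec) : coordT √2 (act (eval [k])⁻¹ v) =
    coordT √2 v - val √2 (form (wall (dir k)) v) := by
  rw [← eval_inv, coordT, height_act_letter, inv_inv, val_sub, coordT]

theorem coordT_wall (r : ℝ) (j : Fin 8) : coordT r (wall j) = 1 := by
  rw [coordT, height_wall, val_one]

/-- The bounds on the height and its conjugate place its rational part strictly between -1 and 2;
being odd, this part is 1, and then the coefficient of √2 vanishes. -/
theorem height_eq_one {w : Vec} (hw : IsRoot w) (h1 : 0.91 < coordT √2 w)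
    (h2 : coordT √2 w < 1.2) : coordT √2 w = 1 := by
  have e4 := sqrt_two_gt
  have e5 := sqrt_two_lt
  have h3 := conj_height_sq hw
  have h4 : |coordT (-√2) w| < 1.0988 := by
    refine abs_lt_of_sq_lt_sq ?_ (by norm_num)
    linarith [show (1.2073 : ℝ) < 1.0988 ^ 2 by norm_num]
  rw [abs_lt] at h4
  simp only [coordT, val] at h1 h2 h4 ⊢
  have h5 : ((height w).re : ℝ) < 2 := by linarith
  have h6 : (-1 : ℝ) < ((height w).re : ℝ) := by linarith
  have h7 : (height w).re < 2 := by exact_mod_cast h5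
  have h8 : -1 < (height w).re := by exact_mod_cast h6
  have h9 : (height w).re = 1 := by
    obtain ⟨m, hm⟩ := hw.2
    omega
  rw [h9] at h1 h2 ⊢
  push_cast at h1 h2 ⊢
  have h10 : ((height w).im : ℝ) < 1 := by
    by_contra hc
    push Not at hc
    nlinarith
  have h11 : (-1 : ℝ) < ((height w).im : ℝ) := by
    by_contra hc
    push Not at hc
    nlinarith
  have h12 : (height w).im < 1 := by exact_mod_cast h10
  have h13 : -1 < (height w).im := by exact_mod_cast h11
  have h14 : (height w).im = 0 := by omega
  rw [h14]; simp

theorem lt_of_height_bound {x y : ℝ} (hy : 0.91 < y)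
    (hxy : x ^ 2 / 4 + y ^ 2 / 4 + (1 / 2 + (2 + 2 * √2)) * (x * y) ≤ 1 + (2 + 2 * √2)) :
    x < 1.2 := by
  by_contra hc
  push Not at hc
  have h1 : 1.2 * 0.91 ≤ x * y := mul_le_mul hc hy.le (by norm_num) (by linarith)
  have h2 : 1.2 ^ 2 ≤ x ^ 2 := by gcongr
  have h3 : 0.91 ^ 2 ≤ y ^ 2 := by gcongr
  have h4 := mul_le_mul_of_nonneg_left h1 (show 0 ≤ 1 / 2 + (2 + 2 * √2) by positivity)
  have := sqrt_two_gt
  linarith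

/-- If `T` and `S` are the distances in height on the two sides, Cauchy–Schwarz bounds both by 1.2
and arithmetic makes both equal to 1. Equality then holds in Cauchy–Schwarz, so the horizontal parts
coincide as well. -/
theorem eq_wall_of_separates_letter {v : Vec} (h : IsRoot v) (k : Letter) (h1 : 0 < pt 1 v)
    (h2 : pt (eval [k]) v < 0) : v = wall (dir k) := by
  rw [pt_one] at h1
  rw [pt] at h2
  have hT := height_pos_root h h1
  have hT' := height_pos_root (h.act (eval [k])⁻¹).neg
    (by rw [coordT, height_neg, val_neg]; exact neg_pos.2 h2)
  rw [coordT, height_neg, val_neg, ← coordT, coordT_act_letter_inv] at hT'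
  have e1 := coord_root sqrt_two_mul h
  have e2 := coord_root sqrt_two_mul (isRoot_wall (dir k))
  have e3 := val_form sqrt_two_mul (wall (dir k)) v
  have e4 := sqrt_two_gt
  have e5 := sqrt_two_lt
  have e6 := conj_height_sq h
  rw [coordT_wall] at e2 e3
  set W := wall (dir k)
  set F := val √2 (form W v) with hF
  set T := coordT √2 v with hTd
  obtain ⟨S, hS⟩ : ∃ S, S = F - T := ⟨_, rfl⟩
  have hS' : 0.91 < S := by linarith
  have cs : (coordX √2 W * coordX √2 v + coordY √2 W * coordY √2 v) ^ 2 ≤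
      (coordX √2 W ^ 2 + coordY √2 W ^ 2) * (coordX √2 v ^ 2 + coordY √2 v ^ 2) := by
    nlinarith [sq_nonneg (coordX √2 W * coordY √2 v - coordY √2 W * coordX √2 v)]
  rw [e1, e2] at cs
  have e7 : coordX √2 W * coordX √2 v + coordY √2 W * coordY √2 v =
      (T + S) / 2 + (2 + 2 * √2) * T := by
    rw [hS]; linarith
  rw [e7] at cs
  -- The difference of the two sides of `cs` is divisible by `1 + (2 + 2√2)` after √2 · √2 = 2 is
  -- taken into account; only a quadratic inequality in `T` and `S` is left.
  have key : T ^ 2 / 4 + S ^ 2 / 4 + (1 / 2 + (2 + 2 * √2)) * (T * S) ≤ 1 + (2 + 2 * √2) := by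
    linarith
  have hTlt : T < 1.2 := lt_of_height_bound hS' key
  have hSlt : S < 1.2 := lt_of_height_bound hT (by linarith)
  have hT1 : T = 1 := height_eq_one h hT hTlt
  have hS1 : S = 1 := by
    have := height_eq_one (h.act (eval [k])⁻¹).neg
    rw [coordT, height_neg, val_neg, ← coordT, coordT_act_letter_inv] at this
    have := this (by linarith) (by linarith)
    linarith
  have hX : (coordX √2 v - coordX √2 W) ^ 2 + (coordY √2 v - coordY √2 W) ^ 2 = 0 := by
    rw [hT1] at e1 e7
    rw [hS1] at e7
    linarith
  obtain ⟨hX0, hY0⟩ := (add_eq_zero_iff_of_nonneg (sq_nonneg _) (sq_nonneg _)).1 hX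
  replace hX0 := pow_eq_zero_iff two_ne_zero |>.1 hX0
  replace hY0 := pow_eq_zero_iff two_ne_zero |>.1 hY0
  have hsub : v - W = 0 := by
    apply eq_zero_of_coord
    · rw [← hX0]; simp only [coordX, Pi.sub_apply, val_sub]; ring
    · rw [← hY0]; simp only [coordY, Pi.sub_apply, val_sub]; ring
    · have h1 : T - coordT √2 W = 0 := by rw [hT1, coordT_wall, sub_self]
      rw [← h1, hTd]; simp only [coordT, height, Pi.sub_apply, val_sub, val_add]; ring
  exact sub_eq_zero.1 hsub

/-- The only wall that is crossed by an edge is that of the edge. -/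
theorem eq_act_wall_of_separates {v : Vec} (h : IsRoot v) (g : SurfaceGroup) (k : Letter)
    (h1 : 0 < pt g v) (h2 : pt (g * eval [k]) v < 0) : v = act g (wall (dir k)) := by
  rw [pt_mul] at h2
  have := eq_wall_of_separates_letter (h.act g⁻¹) k (by rwa [pt_one]) h2
  rw [← this, act_act_inv]

/-! ### Causal vectors and crossing walls -/

/-- A timelike or null vector pointing upwards stays so under isometries. In one step the height
drops by a Lorentz product that Cauchy–Schwarz bounds by the height itself. -/
theorem causal_forward {v : Vec} (h : val √2 (form v v) ≤ 0) (h0 : 0 ≤ coordT √2 v)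
    (g : SurfaceGroup) : 0 ≤ pt g v := by
  obtain ⟨l, rfl⟩ := exists_eval g
  induction l generalizing v with
  | nil => rwa [eval_nil, pt_one]
  | cons k l ih =>
    rw [eval_cons, pt_mul]
    refine ih (by rwa [form_act]) ?_
    rw [coordT_act_letter_inv]
    have e2 := coord_root sqrt_two_mul (isRoot_wall (dir k))
    have e3 := val_form sqrt_two_mul (wall (dir k)) v
    have e1 := val_form sqrt_two_mul v v
    have e4 := sqrt_two_gt
    rw [coordT_wall] at e2 e3
    set W := wall (dir k)
    have cs : (coordX √2 W * coordX √2 v + coordY √2 W * coordY √2 v) ^ 2 ≤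
        (coordX √2 W ^ 2 + coordY √2 W ^ 2) * (coordX √2 v ^ 2 + coordY √2 v ^ 2) := by
      nlinarith [sq_nonneg (coordX √2 W * coordY √2 v - coordY √2 W * coordX √2 v)]
    set T := coordT √2 v
    set D := coordX √2 W * coordX √2 v + coordY √2 W * coordY √2 v
    have h5 : coordX √2 v ^ 2 + coordY √2 v ^ 2 ≤ (2 + 2 * √2) * T ^ 2 := by linarith
    have h6 : D ^ 2 ≤ ((1 / 2 + (2 + 2 * √2)) * T) ^ 2 := by
      calc D ^ 2 ≤ _ := cs
        _ ≤ (1 + (2 + 2 * √2) * 1 ^ 2) * ((2 + 2 * √2) * T ^ 2) := by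
          rw [e2]; gcongr
        _ ≤ _ := by nlinarith [sq_nonneg T]
    have h7 : D ≤ (1 / 2 + (2 + 2 * √2)) * T := abs_le_of_sq_le_sq' h6 (by positivity) |>.2
    rw [e3]
    linarith

theorem causal_sign {v : Vec} (h : val √2 (form v v) ≤ 0) :
    (∀ g, 0 ≤ pt g v) ∨ ∀ g, pt g v ≤ 0 := by
  rcases le_total 0 (coordT √2 v) with h0 | h0
  · exact .inl (causal_forward h h0)
  · refine .inr fun g => ?_
    have := causal_forward (v := -v) (by rwa [form_neg, form_comm, form_neg, neg_neg])
      (by rw [coordT, height_neg, val_neg]; exact neg_nonneg.2 h0) g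
    rw [pt_neg] at this
    linarith

/-- Two walls with points before both and points beyond both are not disjoint with their positive
sides covering the plane. -/
theorem form_gt_of_quadrants {v w : Vec} (hv : IsRoot v) (hw : IsRoot w) {g h : SurfaceGroup}
    (h1 : 0 < pt g v) (h2 : 0 < pt g w) (h3 : pt h v < 0) (h4 : pt h w < 0) :
    -2 < val √2 (form v w) := by
  by_contra hc
  push Not at hc
  have : val √2 (form (v + w) (v + w)) ≤ 0 := by
    rw [form_add, form_add_left, form_add_left, form_comm w v, hv.1, hw.1]
    simp only [val_add, val_two]
    linarith
  rcases causal_sign this with h5 | h5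
  · have := h5 h; rw [pt_add] at this; linarith
  · have := h5 g; rw [pt_add] at this; linarith

/-- The horizontal parts of the two normals make an angle of less than 60°: heights above 0.91 make
the vertical part of the form dominate both norms. -/
theorem near_of_form_gt {v w : Vec} (hv : IsRoot v) (hw : IsRoot w) (h1 : 0 < coordT √2 v)
    (h2 : 0 < coordT √2 w) (h3 : -2 < val √2 (form v w)) :
    √(coordX √2 v ^ 2 + coordY √2 v ^ 2) * √(coordX √2 w ^ 2 + coordY √2 w ^ 2) <
      2 * (coordX √2 v * coordX √2 w + coordY √2 v * coordY √2 w) := by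
  have e1 := height_pos_root hv h1
  have e2 := height_pos_root hw h2
  have e3 := coord_root sqrt_two_mul hv
  have e4 := coord_root sqrt_two_mul hw
  have e5 := val_form sqrt_two_mul v w
  have e6 := sqrt_two_gt
  rw [← Real.sqrt_mul (by positivity), Real.sqrt_lt' (by nlinarith), e3, e4]
  set S := coordT √2 v
  set T := coordT √2 w
  set D := coordX √2 v * coordX √2 w + coordY √2 v * coordY √2 w
  set β := 2 + 2 * √2 with hβ
  have hb : 4.828 < β := by rw [hβ]; linarith
  have h5 : β * (S * T) - 1 < D := by linarith
  have hST : 0.828 < S * T := by nlinarith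
  have hS : 3.99 ≤ β * S ^ 2 := by nlinarith
  have hT : 3.99 ≤ β * T ^ 2 := by nlinarith
  have hq : 3.99 ≤ β * (S * T) := by nlinarith
  calc (1 + β * S ^ 2) * (1 + β * T ^ 2)
      ≤ (1.26 * (β * S ^ 2)) * (1.26 * (β * T ^ 2)) := by gcongr <;> linarith
    _ = (1.26 * (β * (S * T))) ^ 2 := by ring
    _ < (2 * D) ^ 2 := pow_lt_pow_left₀ (by linarith) (by linarith) two_ne_zero

theorem coord_opposite (j : Fin 8) : coordX √2 (wall (j + 4)) = -coordX √2 (wall j) ∧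
    coordY √2 (wall (j + 4)) = -coordY √2 (wall j) := by
  have := sqrt_two_mul
  fin_cases j <;> constructor <;> simp [coordX, coordY, wall, val] <;> nlinarith

/-- There is no chain of crossing walls in front of a vertex between two opposite walls of that
vertex. -/
theorem not_chain (g : SurfaceGroup) (j : Fin 8) {v w : Vec} (hv : IsRoot v) (hw : IsRoot w)
    (hgv : 0 < pt g v) (hgw : 0 < pt g w) {h₁ h₂ h₃ : SurfaceGroup}
    (h1 : pt h₁ (act g (wall j)) < 0) (h1' : pt h₁ v < 0) (h2 : pt h₂ v < 0) (h2' : pt h₂ w < 0)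
    (h3 : pt h₃ w < 0) (h3' : pt h₃ (act g (wall (j + 4))) < 0) : False := by
  have hone (i : Fin 8) : 0 < pt g (act g (wall i)) := by rw [pt_act_wall]; norm_num
  have f1 := form_gt_of_quadrants ((isRoot_wall j).act g) hv (hone j) hgv h1 h1'
  have f2 := form_gt_of_quadrants hv hw hgv hgw h2 h2'
  have f3 := form_gt_of_quadrants hw ((isRoot_wall (j + 4)).act g) hgw (hone _) h3 h3'
  rw [← form_act g⁻¹, act_inv_act] at f1 f3
  rw [← form_act g⁻¹] at f2
  have hT (i : Fin 8) : 0 < coordT √2 (wall i) := by rw [coordT_wall]; norm_num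
  have n1 := near_of_form_gt (isRoot_wall j) (hv.act g⁻¹) (hT _) hgv f1
  have n2 := near_of_form_gt (hv.act g⁻¹) (hw.act g⁻¹) hgv hgw f2
  have n3 := near_of_form_gt (hw.act g⁻¹) (isRoot_wall _) hgw (hT _) f3
  obtain ⟨o1, o2⟩ := coord_opposite j
  rw [o1, o2] at n3
  have pos {v : Vec} (h : IsRoot v) : 0 < √(coordX √2 v ^ 2 + coordY √2 v ^ 2) := by
    rw [coord_root sqrt_two_mul h]; positivity
  have p0 := pos (isRoot_wall j)
  have p1 := pos (hv.act g⁻¹)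
  have p2 := pos (hw.act g⁻¹)
  have s0 := Real.sq_sqrt (show 0 ≤ coordX √2 (wall j) ^ 2 + coordY √2 (wall j) ^ 2 by positivity)
  have s1 := Real.sq_sqrt (show 0 ≤ coordX √2 (act g⁻¹ v) ^ 2 + coordY √2 (act g⁻¹ v) ^ 2 by
    positivity)
  have s2 := Real.sq_sqrt (show 0 ≤ coordX √2 (act g⁻¹ w) ^ 2 + coordY √2 (act g⁻¹ w) ^ 2 by
    positivity)
  rw [neg_sq, neg_sq] at n3
  set a := √(coordX √2 (wall j) ^ 2 + coordY √2 (wall j) ^ 2)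
  set b := √(coordX √2 (act g⁻¹ v) ^ 2 + coordY √2 (act g⁻¹ v) ^ 2)
  set c := √(coordX √2 (act g⁻¹ w) ^ 2 + coordY √2 (act g⁻¹ w) ^ 2)
  set x0 := coordX √2 (wall j)
  set y0 := coordY √2 (wall j)
  set x1 := coordX √2 (act g⁻¹ v)
  set y1 := coordY √2 (act g⁻¹ v)
  set x2 := coordX √2 (act g⁻¹ w)
  set y2 := coordY √2 (act g⁻¹ w)
  have unit : ∀ x y d : ℝ, 0 < d → d ^ 2 = x ^ 2 + y ^ 2 → (x / d) ^ 2 + (y / d) ^ 2 = 1 := by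
    intro x y d hd h
    rw [div_pow, div_pow, ← add_div, ← h, div_self (by positivity)]
  have dot : ∀ x y x' y' d d' : ℝ, 0 < d → 0 < d' → d * d' < 2 * (x * x' + y * y') →
      1 / 2 < x / d * (x' / d') + y / d * (y' / d') := by
    intro x y x' y' d d' hd hd' h
    rw [div_mul_div_comm, div_mul_div_comm, ← add_div, lt_div_iff₀ (by positivity)]
    linarith
  have u0 := unit x0 y0 a p0 s0
  have u1 := unit x1 y1 b p1 s1
  have u2 := unit x2 y2 c p2 s2
  have d1 := dot _ _ _ _ _ _ p0 p1 n1
  have d2 := dot _ _ _ _ _ _ p1 p2 n2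
  have d3 := dot _ _ _ _ _ _ p2 p0 n3
  rw [neg_div, neg_div] at d3
  generalize x0 / a = X0 at *
  generalize y0 / a = Y0 at *
  generalize x1 / b = X1 at *
  generalize y1 / b = Y1 at *
  generalize x2 / c = X2 at *
  generalize y2 / c = Y2 at *
  -- Three angles below 60° cannot add up to 180°: the difference of the two middle unit vectors is
  -- shorter than 1, yet has product above 1 with a unit vector.
  have q1 : 1 < (X1 - X2) * X0 + (Y1 - Y2) * Y0 := by linarith
  have q2 : (X1 - X2) ^ 2 + (Y1 - Y2) ^ 2 < 1 := by nlinarith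
  nlinarith [sq_nonneg (X1 - X2 - X0), sq_nonneg (Y1 - Y2 - Y0)]

/-! ### The automaton of leftmost shortest words -/

/-- The states of the automaton: `right j` after `j` consecutive rightmost turns (up to a flip of
octagons), `left j` after `j` consecutive leftmost turns, and `free` otherwise. -/
inductive Mode
  | free
  | right1
  | right2
  | right3
  | left1
  | left2
  deriving DecidableEq

instance : Fintype Mode :=
  ⟨{.free, .right1, .right2, .right3, .left1, .left2}, by intro x; cases x <;> decide⟩

/-- The transitions of the automaton, on turn numbers. -/
def Mode.step : Mode → Fin 8 → Option Mode
  | _, 0 => none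
  | .right1, 1 => some .right2
  | .right2, 1 => some .right3
  | .right3, 1 => none
  | _, 1 => some .right1
  | .right3, 2 => some .right1
  | .left1, 7 => some .left2
  | .left2, 7 => none
  | _, 7 => some .left1
  | _, _ => some .free

/-- The automaton, after the edge `k` in state `q`, accepts the word. -/
def Runs : Mode → Letter → List Letter → Prop
  | _, _, [] => True
  | q, k, k' :: l => ∃ q', q.step (turnNum k k') = some q' ∧ Runs q' k' l

/-- Leftmost shortest words. -/
def Tight : List Letter → Prop
  | [] => True
  | k :: l => Runs .free k l

/-- The inequalities that hold for the heights, over every continuation, of the eight walls around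
the end of an edge, in counterclockwise order from the way back. -/
def Mode.Ineq (q : Mode) (a : Fin 8 → ℝ) : Prop :=
  0 ≤ a 0 ∧ match q with
    | .free => 0 ≤ a 7 + √2 * a 0
    | .right1 => 0 ≤ a 7 + √2 * a 0 ∧ 0 ≤ √2 * a 0 + a 1
    | .right2 => 0 ≤ a 7 + √2 * a 0 ∧ 0 ≤ a 0 + √2 * a 1
    | .right3 => 0 ≤ a 7 + √2 * a 0 ∧ 0 ≤ a 1
    | .left1 => 0 ≤ a 0 + √2 * a 7
    | .left2 => 0 ≤ a 7

/-! ### Height inequalities along accepted words -/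

theorem fin_eight_cases : ∀ t : Fin 8,
    t = 0 ∨ t = 1 ∨ t = 2 ∨ t = 3 ∨ t = 4 ∨ t = 5 ∨ t = 6 ∨ t = 7 := by decide

/-- `a` are the heights at the end of the next edge, `A` those at its start. The wall of the edge
changes sign, its two neighbours are reflected, and the others are disjoint from it. For `t = 2` the
two intermediate lines through the crossing point of walls 0 and 1 are disjoint from it too. The
inequalities of the right modes are positivity on successive lines through that point. -/
theorem Mode.Ineq.back {q q' : Mode} {t : Fin 8} (hq : q.step t = some q') {a A : Fin 8 → ℝ}
    (h0 : A t = -a 0) (h1 : A (t - 1) = a 1 + √2 * a 0) (h7 : A (t + 1) = a 7 + √2 * a 0)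
    (far : ∀ j, j ≠ t → j ≠ t - 1 → j ≠ t + 1 → a 0 ≤ A j)
    (f1 : t = 2 → a 0 ≤ √2 * A 0 + A 1) (f2 : t = 2 → a 0 ≤ A 0 + √2 * A 1)
    (h : q'.Ineq a) : q.Ineq A := by
  have hs0 : 0 ≤ √2 := Real.sqrt_nonneg 2
  have hm : ∀ x, √2 * (√2 * x) = 2 * x := fun x => by rw [← mul_assoc, sqrt_two_mul]
  have hp : ∀ x, 0 ≤ x → 0 ≤ √2 * x := fun x hx => mul_nonneg hs0 hx
  obtain ⟨ha, h⟩ := h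
  have hsa := hp _ ha
  have hlt : √2 * a 0 ≤ 2 * a 0 := mul_le_mul_of_nonneg_right (by linarith [sqrt_two_lt]) ha
  have hgt : a 0 ≤ √2 * a 0 := le_mul_of_one_le_left ha (by linarith [sqrt_two_gt])
  have m0 := congrArg (√2 * ·) h0
  have m1 := congrArg (√2 * ·) h1
  have m7 := congrArg (√2 * ·) h7
  -- Linear arithmetic treats `√2 * x` as an unknown of its own, so each relation is supplied a
  -- second time, multiplied by √2.
  have mfar : ∀ j, j ≠ t → j ≠ t - 1 → j ≠ t + 1 → √2 * a 0 ≤ √2 * A j :=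
    fun j x y z => mul_le_mul_of_nonneg_left (far j x y z) hs0
  simp only [mul_add, mul_neg, hm] at m0 m1 m7
  have hall : (q'.Ineq a ∧ (q' = .free → 0 ≤ √2 * a 7 + 2 * a 0) ∧
      (q' = .right1 → 0 ≤ √2 * a 7 + 2 * a 0 ∧ 0 ≤ 2 * a 0 + √2 * a 1) ∧
      (q' = .right2 → 0 ≤ √2 * a 7 + 2 * a 0 ∧ 0 ≤ √2 * a 0 + 2 * a 1) ∧
      (q' = .right3 → 0 ≤ √2 * a 7 + 2 * a 0 ∧ 0 ≤ √2 * a 1) ∧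
      (q' = .left1 → 0 ≤ √2 * a 0 + 2 * a 7) ∧ (q' = .left2 → 0 ≤ √2 * a 7)) := by
    refine ⟨⟨ha, h⟩, ?_, ?_, ?_, ?_, ?_, ?_⟩ <;> rintro rfl <;> simp only at h
    · simpa only [mul_add, hm] using hp _ h
    · simpa only [mul_add, hm] using And.intro (hp _ h.1) (hp _ h.2)
    · simpa only [mul_add, hm] using And.intro (hp _ h.1) (hp _ h.2)
    · simpa only [mul_add, hm] using And.intro (hp _ h.1) (hp _ h.2)
    · simpa only [mul_add, hm] using hp _ h
    · exact hp _ h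
  clear h hp hm
  have d0 := far 0
  have d1 := far 1
  have d2 := far 2
  have d3 := far 3
  have d4 := far 4
  have d5 := far 5
  have d6 := far 6
  have d7 := far 7
  have e0 := mfar 0
  have e1 := mfar 1
  have e2 := mfar 2
  have e3 := mfar 3
  have e4 := mfar 4
  have e5 := mfar 5
  have e6 := mfar 6
  have e7 := mfar 7
  clear far mfar
  obtain rfl | rfl | rfl | rfl | rfl | rfl | rfl | rfl :
      t = 0 ∨ t = 1 ∨ t = 2 ∨ t = 3 ∨ t = 4 ∨ t = 5 ∨ t = 6 ∨ t = 7 := fin_eight_cases t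
  all_goals
    simp only [Fin.reduceSub, Fin.reduceAdd, Fin.isValue, Fin.reduceEq, ne_eq, not_true_eq_false,
      not_false_eq_true, forall_const, false_imp_iff]
      at d0 d1 d2 d3 d4 d5 d6 d7 e0 e1 e2 e3 e4 e5 e6 e7 h0 h1 h7 m0 m1 m7 f1 f2
  all_goals
    cases q <;> simp only [Mode.step, Option.some.injEq, reduceCtorEq] at hq <;> subst hq <;>
      simp only [Mode.Ineq, reduceCtorEq, false_imp_iff, true_imp_iff, true_and, and_true] at hall ⊢
  all_goals
    refine ⟨?_, ?_⟩ <;> first | linarith | (refine ⟨?_, ?_⟩ <;> linarith)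

theorem pt_add_nonneg {v w : Vec} (hv : IsRoot v) (hw : IsRoot w) (h : val √2 (form v w) ≤ -2)
    (h0 : 0 ≤ coordT √2 v) (h1 : 0 ≤ coordT √2 w) (g : SurfaceGroup) : 0 ≤ pt g v + pt g w := by
  rw [← pt_add]
  refine causal_forward ?_ ?_ g
  · rw [form_add, form_add_left, form_add_left, form_comm w v, hv.1, hw.1]
    simp only [val_add, val_two]
    linarith
  · rw [← pt_one, pt_add, pt_one, pt_one]
    exact add_nonneg h0 h1

theorem form_wall_add : ∀ i j : Fin 8, form (wall i) (wall (i + j)) = -coef j := by decide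

theorem two_le_coef {j : Fin 8} (h0 : j ≠ 0) (h1 : j ≠ 1) (h7 : j ≠ 7) : 2 ≤ val √2 (coef j) := by
  have := sqrt_two_gt
  obtain rfl | rfl | rfl | rfl | rfl | rfl | rfl | rfl := fin_eight_cases j <;>
    simp [coef, val] at * <;> linarith

theorem form_wall_le {i j : Fin 8} (h0 : j ≠ i) (h1 : j ≠ i - 1) (h7 : j ≠ i + 1) :
    val √2 (form (wall i) (wall j)) ≤ -2 := by
  have h : j = i + (j - i) := (add_sub_cancel i j).symm
  rw [h, form_wall_add, val_neg, neg_le_neg_iff]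
  apply two_le_coef
  · rwa [ne_eq, sub_eq_zero]
  · rwa [ne_eq, sub_eq_iff_eq_add']
  · intro h'
    rw [sub_eq_iff_eq_add'] at h'
    exact h1 (by rw [h', show (7 : Fin 8) = -1 from rfl, sub_eq_add_neg])

/-- The heights of the walls around the end of the edge `k`, over the point `g` relative to it,
satisfy the inequalities of `q`. -/
def Region (q : Mode) (k : Letter) (g : SurfaceGroup) : Prop :=
  q.Ineq fun j => pt g (wall (dir (inv k) + j))

theorem Region.back {q q' : Mode} {k k' : Letter} (hq : q.step (turnNum k k') = some q')
    {g : SurfaceGroup} (h : Region q' k' g) : Region q k (eval [k'] * g) := by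
  set i := dir (inv k) with hi
  set t := turnNum k k' with ht
  have hk' : dir k' = i + t := by rw [ht, turnNum, add_sub_cancel]
  have hA (j : Fin 8) : pt (eval [k'] * g) (wall (i + j)) =
      pt g (wall (dir (inv k') + (t - j))) +
        val √2 (coef (t - j)) * pt g (wall (dir (inv k') + 0)) := by
    rw [pt_mul, act_letter_inv_wall, pt_add, pt_smul, hk', add_zero]
    congr 3 <;> abel_nf
  have hback : pt (eval [k'] * g) (wall (dir k')) = -pt g (wall (dir (inv k') + 0)) := by
    rw [pt_mul, act_letter_inv_wall_self, pt_neg, add_zero]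
  have hc1 : val √2 (coef 1) = √2 := by simp [coef, val]
  have hc7 : val √2 (coef 7) = √2 := by simp [coef, val]
  have hv : val √2 ⟨0, 1⟩ = √2 := by simp [val]
  refine Mode.Ineq.back hq (a := fun j => pt g (wall (dir (inv k') + j))) ?_ ?_ ?_ ?_ ?_ ?_ h
  · rw [← hk', hback]
  · rw [hA, show t - (t - 1) = 1 from sub_sub_cancel t 1, hc1]
  · rw [hA, show t - (t + 1) = 7 by rw [sub_add_eq_sub_sub, sub_self]; rfl, hc7]
  · intro j h0 h1 h7
    have := pt_add_nonneg (isRoot_wall (i + t)) (isRoot_wall (i + j))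
      (form_wall_le (by simpa using h0) (by rw [add_sub_assoc]; simpa using h1)
        (by rw [add_assoc]; simpa using h7)) (by rw [coordT_wall]; norm_num)
      (by rw [coordT_wall]; norm_num) (eval [k'] * g)
    rw [← hk', hback] at this
    linarith
  · intro h2
    -- These combinations are again roots: the lines through the corner between walls `i` and `i +
    -- 1` that do not bound the octagon of the vertex.
    have hr : ∀ i : Fin 8, IsRoot ((⟨0, 1⟩ : Zsqrtd 2) • wall i + wall (i + 1)) ∧
        form (wall (i + 2)) ((⟨0, 1⟩ : Zsqrtd 2) • wall i + wall (i + 1)) = ⟨-8, -5⟩ := by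
      unfold IsRoot; decide
    have := pt_add_nonneg (isRoot_wall (i + 2)) (hr i).1
      (by rw [(hr i).2]; simp [val]; linarith [sqrt_two_gt]) (by rw [coordT_wall]; norm_num)
      (by rw [← pt_one, pt_add, pt_smul, pt_one, pt_one, coordT_wall, coordT_wall, hv]; positivity)
      (eval [k'] * g)
    rw [← h2, ← hk', hback, pt_add, pt_smul, hv] at this
    simp only [add_zero] at this ⊢
    linarith
  · intro h2
    have hr : ∀ i : Fin 8, IsRoot (wall i + (⟨0, 1⟩ : Zsqrtd 2) • wall (i + 1)) ∧
        form (wall (i + 2)) (wall i + (⟨0, 1⟩ : Zsqrtd 2) • wall (i + 1)) = ⟨-6, -4⟩ := by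
      unfold IsRoot; decide
    have := pt_add_nonneg (isRoot_wall (i + 2)) (hr i).1
      (by rw [(hr i).2]; simp [val]; linarith [sqrt_two_gt]) (by rw [coordT_wall]; norm_num)
      (by rw [← pt_one, pt_add, pt_smul, pt_one, pt_one, coordT_wall, coordT_wall, hv]; positivity)
      (eval [k'] * g)
    rw [← h2, ← hk', hback, pt_add, pt_smul, hv] at this
    simp only [add_zero] at this ⊢
    linarith

theorem region_one (q : Mode) (k : Letter) : Region q k 1 := by
  have := Real.sqrt_nonneg 2
  simp only [Region, Mode.Ineq, pt_one, coordT_wall]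
  cases q <;> simp only <;> (try refine ⟨?_, ?_, ?_⟩) <;> (try refine ⟨?_, ?_⟩) <;> positivity

theorem Runs.region {q : Mode} {k : Letter} {l : List Letter} (h : Runs q k l) :
    Region q k (eval l) := by
  induction l generalizing q k with
  | nil => exact region_one q k
  | cons k' l ih =>
    obtain ⟨q', hq, h'⟩ := h
    rw [eval_cons]
    exact (ih h').back hq

/-- All proper ends of a leftmost shortest word lie beyond its first wall. -/
theorem Tight.beyond {k : Letter} {l : List Letter} (h : Tight (k :: l)) :
    pt (eval (k :: l)) (wall (dir k)) < 0 := by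
  refine lt_of_le_of_ne ?_ (pt_root_ne_zero (isRoot_wall _) _)
  rw [eval_cons, pt_mul, act_letter_inv_wall_self, pt_neg]
  have := (Runs.region h).1
  simp only [add_zero] at this
  linarith

/-- No end of a leftmost shortest word lies beyond the wall to the left of the first one. -/
theorem Tight.not_beyond_left {k : Letter} {l : List Letter} (h : Tight (k :: l)) :
    0 < pt (eval (k :: l)) (wall (dir k + 1)) := by
  refine lt_of_le_of_ne ?_ (pt_root_ne_zero (isRoot_wall _) _).symm
  rw [eval_cons, pt_mul, act_letter_inv_wall, pt_add, pt_smul]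
  have := (Runs.region h).2
  simp only [add_zero] at this
  rw [show dir k + dir (inv k) - (dir k + 1) = dir (inv k) + 7 by
    rw [show (7 : Fin 8) = -1 from rfl]; abel,
    show dir k - (dir k + 1) = 7 by rw [sub_add_eq_sub_sub, sub_self]; rfl]
  simpa [coef, val] using this

/-! ### Uniqueness of tight words -/

/-- The first state is at most as restrictive as the second one. -/
def Mode.weaker (q q' : Mode) : Bool :=
  q == q' || q == .free || (q == .right1 && (q' == .right2 || q' == .right3)) ||
    (q == .right2 && q' == .right3) || (q == .left1 && q' == .left2)

theorem Mode.weaker_step : ∀ (q q' r' : Mode) (t : Fin 8), q.weaker q' = true →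
    q'.step t = some r' → ∃ r, q.step t = some r ∧ r.weaker r' = true := by
  decide +kernel

theorem Runs.of_weaker {q q' : Mode} (hq : q.weaker q' = true) {k : Letter} {l : List Letter}
    (h : Runs q' k l) : Runs q k l := by
  induction l generalizing q q' k with
  | nil => trivial
  | cons k' l ih =>
    obtain ⟨r', hr, h'⟩ := h
    obtain ⟨r, hr1, hr2⟩ := Mode.weaker_step _ _ _ _ hq hr
    exact ⟨r, hr1, ih hr2 h'⟩

theorem Runs.tight {q : Mode} {k : Letter} {l : List Letter} (h : Runs q k l) : Tight (k :: l) :=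
  h.of_weaker (by cases q <;> rfl)

theorem Tight.tail {k : Letter} {l : List Letter} (h : Tight (k :: l)) : Tight l := by
  cases l with
  | nil => trivial
  | cons k' l =>
    obtain ⟨q', _, h'⟩ := h
    exact h'.tight

/-- Leftmost shortest words of the same length are determined by the element they represent. -/
theorem Tight.eq_of_eval_eq {w w' : List Letter} (h : Tight w) (h' : Tight w')
    (hl : w.length = w'.length) (he : eval w = eval w') : w = w' := by
  induction w generalizing w' with
  | nil => exact (List.eq_nil_of_length_eq_zero hl.symm).symm
  | cons k l ih =>
    cases w' with
    | nil => simp at hl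
    | cons k' l' =>
      have b := h.beyond
      have b' := h'.beyond
      have c := h.not_beyond_left
      have c' := h'.not_beyond_left
      rw [he] at b c
      have hone (i : Fin 8) : 0 < pt 1 (wall i) := by rw [pt_one, coordT_wall]; norm_num
      -- The base vertex is before both first walls and the common end is beyond both, so the walls
      -- coincide or cross; crossing ones are neighbours, and the left one of the two is excluded.
      have hf := form_gt_of_quadrants (isRoot_wall _) (isRoot_wall _) (hone _) (hone _) b b'
      have hk : dir k' = dir k := by
        by_contra h0
        have : dir k' = dir k - 1 ∨ dir k' = dir k + 1 := by
          by_contra hc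
          push Not at hc
          exact absurd (form_wall_le h0 hc.1 hc.2) (not_le.2 hf)
        rcases this with h1 | h1
        · rw [h1, sub_add_cancel] at c'
          linarith
        · rw [← h1] at c
          linarith
      obtain rfl := dir_injective hk
      rw [ih h.tail h'.tail (by simpa using hl)]
      rw [eval_cons, eval_cons k'] at he
      exact mul_left_cancel he

/-! ### Shortest words -/

/-- A word of least length among those that represent the same element. -/
def Shortest (w : List Letter) : Prop := ∀ w', eval w' = eval w → w.length ≤ w'.length

/-- The four letters of the path on the left of an octagon. -/
def leftPath (s : Letter) : List Letter := (List.range 4).map (leftSide s)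

/-- The four letters of the path on the right of an octagon. -/
def rightPath (s : Letter) : List Letter := (List.range 4).map (rightSide s)

/-- The word has no part that goes along the right side of an octagon. -/
def NoRightPath (w : List Letter) : Prop := ∀ s xs ys, w ≠ xs ++ rightPath s ++ ys

theorem eval_flip (s : Letter) (xs ys : List Letter) :
    eval (xs ++ leftPath s ++ ys) = eval (xs ++ rightPath s ++ ys) := by
  simp only [eval_append, leftPath, rightPath, eval_sides]

theorem length_flip (s : Letter) (xs ys : List Letter) :
    (xs ++ leftPath s ++ ys).length = (xs ++ rightPath s ++ ys).length := by
  simp [leftPath, rightPath]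

theorem Shortest.length_le {xs ys zs : List Letter} (h : Shortest (xs ++ ys))
    (hz : eval zs = eval xs) : xs.length ≤ zs.length := by
  have := h (zs ++ ys) (by rw [eval_append, eval_append, hz])
  simp only [List.length_append] at this
  omega

/-- What the state of the automaton says about the word `xs ++ [k]` that has been read. -/
def Mode.Sem (q : Mode) (xs : List Letter) (k : Letter) : Prop :=
  match q with
  | .free => True
  | .right1 => ∃ v m, v.length + 1 = xs.length ∧ eval (xs ++ [k]) = eval (v ++ [m, rightTurn m]) ∧
      k = rightTurn m
  | .right2 => ∃ v m, v.length + 2 = xs.length ∧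
      eval (xs ++ [k]) = eval (v ++ [m, rightTurn m, rightTurn (rightTurn m)]) ∧
      k = rightTurn (rightTurn m)
  | .right3 => ∃ v m, v.length = xs.length ∧ eval (xs ++ [k]) = eval (v ++ [m]) ∧
      inv m = ccw (inv k)
  | .left1 => ∃ v m, xs = v ++ [m] ∧ k = leftTurn m
  | .left2 => ∃ v m, xs = v ++ [m, leftTurn m] ∧ k = leftTurn (leftTurn m)

theorem eval_cancel (v : List Letter) (k : Letter) : eval (v ++ [k, inv k]) = eval v := by
  rw [eval_append, eval_cons, eval_inv, mul_inv_cancel, mul_one]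

theorem leftPath_cw (m : Letter) : leftPath (cw m) =
    [m, rightTurn m, rightTurn (rightTurn m), rightTurn (rightTurn (rightTurn m))] := by
  revert m; decide

theorem turn_seven (k : Letter) : turn k 7 = leftTurn k := by revert k; decide

/-- Each refused turn contradicts a hypothesis: turning back shortens the word; so does a rightmost
turn in `right3`, because after the octagon is flipped it retraces an edge; a third leftmost turn
completes a right path. In `right3` the turn 2 is a rightmost turn of the flipped word, whence
`right1`. -/
theorem Mode.Sem.step {q : Mode} {xs ys : List Letter} {k k' : Letter}
    (hs : Shortest (xs ++ [k] ++ [k'] ++ ys)) (hr : NoRightPath (xs ++ [k] ++ [k'] ++ ys))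
    (h : q.Sem xs k) : ∃ q', q.step (turnNum k k') = some q' ∧ q'.Sem (xs ++ [k]) k' := by
  have hk : k' = turn k (turnNum k k') := (turn_turnNum k k').symm
  have short {zs : List Letter} (hz : eval zs = eval (xs ++ [k] ++ [k'])) :
      xs.length + 2 ≤ zs.length := by
    simpa using hs.length_le hz
  generalize turnNum k k' = t at hk
  have h0 : t ≠ 0 := by
    rintro rfl
    have h1 : k' = inv k := hk
    have := short (zs := xs) (by rw [h1, List.append_assoc]; exact (eval_cancel _ _).symm)
    omega
  have r1 (hk1 : k' = rightTurn k) : Mode.Sem .right1 (xs ++ [k]) k' :=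
    ⟨xs, k, by simp, by simp [hk1], hk1⟩
  have l1 (hk1 : k' = leftTurn k) : Mode.Sem .left1 (xs ++ [k]) k' := ⟨xs, k, rfl, hk1⟩
  have e1 : turn k 1 = rightTurn k := rfl
  have e7 := turn_seven k
  obtain rfl | rfl | rfl | rfl | rfl | rfl | rfl | rfl := fin_eight_cases t
  · exact absurd rfl h0
  · cases q
    case right1 =>
      obtain ⟨v, m, hv, he, hm⟩ := h
      refine ⟨.right2, rfl, v, m, by simp [hv], ?_, by rw [hk, ← hm]; rfl⟩
      rw [eval_append, he, ← eval_append, hk, hm]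
      simp [turn, rightTurn]
    case right2 =>
      obtain ⟨v, m, hv, he, hm⟩ := h
      refine ⟨.right3, rfl, v ++ (rightPath (cw m)).take 3, rightSide (cw m) 3,
        by simp [rightPath, ← hv], ?_, ?_⟩
      · have h3 : rightPath (cw m) = (rightPath (cw m)).take 3 ++ [rightSide (cw m) 3] := rfl
        rw [List.append_assoc v, ← h3, ← List.append_nil (v ++ _), ← eval_flip, List.append_nil,
          leftPath_cw, eval_append, he, ← eval_append, hk, hm]
        simp [turn, rightTurn]
      · rw [hk, hm]
        clear * -
        revert m; decide
    case right3 =>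
      obtain ⟨v, m, hv, he, hm⟩ := h
      have h1 : k' = inv m := hk.trans hm.symm
      have := short (zs := v) (by
        rw [eval_append, he, ← eval_append, h1, List.append_assoc]; exact (eval_cancel _ _).symm)
      omega
    all_goals exact ⟨.right1, rfl, r1 hk⟩
  · cases q
    case right3 =>
      obtain ⟨v, m, hv, he, hm⟩ := h
      have h1 : k' = rightTurn m := by rw [hk, rightTurn, hm]; rfl
      refine ⟨.right1, rfl, v, m, by simp [hv], ?_, h1⟩
      rw [eval_append, he, ← eval_append, h1]
      simp
    all_goals exact ⟨.free, rfl, trivial⟩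
  · cases q <;> exact ⟨.free, rfl, trivial⟩
  · cases q <;> exact ⟨.free, rfl, trivial⟩
  · cases q <;> exact ⟨.free, rfl, trivial⟩
  · cases q <;> exact ⟨.free, rfl, trivial⟩
  · cases q
    case left1 =>
      obtain ⟨v, m, hv, hm⟩ := h
      refine ⟨.left2, rfl, v, m, by simp [hv, hm], ?_⟩
      rw [← hm]
      exact hk.trans e7
    case left2 =>
      obtain ⟨v, m, hv, hm⟩ := h
      refine absurd ?_ (hr m v ys)
      have h1 : k' = leftTurn (leftTurn (leftTurn m)) := by rw [← hm]; exact hk.trans e7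
      rw [hv, h1, hm]
      simp [rightPath, List.range_succ, rightSide]
    all_goals exact ⟨.left1, rfl, l1 (hk.trans e7)⟩

theorem Shortest.runs {q : Mode} {xs l : List Letter} {k : Letter}
    (hs : Shortest (xs ++ [k] ++ l)) (hr : NoRightPath (xs ++ [k] ++ l)) (h : q.Sem xs k) :
    Runs q k l := by
  induction l generalizing q xs k with
  | nil => trivial
  | cons k' l ih =>
    rw [show xs ++ [k] ++ k' :: l = xs ++ [k] ++ [k'] ++ l by simp] at hs hr
    obtain ⟨q', hq, h'⟩ := h.step hs hr
    exact ⟨q', hq, ih hs hr h'⟩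

theorem Shortest.tight {w : List Letter} (hs : Shortest w) (hr : NoRightPath w) : Tight w := by
  cases w with
  | nil => trivial
  | cons k l => exact Shortest.runs (xs := []) hs hr trivial

/-- The sum of the numbers of the turns in a word. -/
def turnSum : List Letter → ℕ
  | k :: k' :: l => (turnNum k k').val + turnSum (k' :: l)
  | _ => 0

theorem turnNum_leftPath_head : ∀ s k : Letter,
    (turnNum k (leftSide s 0)).val ≤ (turnNum k (rightSide s 0)).val + 1 := by decide

theorem turnNum_leftPath_last : ∀ s k : Letter,
    (turnNum (leftSide s 3) k).val ≤ (turnNum (rightSide s 3) k).val + 1 := by decide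

theorem leftPath_eq (s : Letter) :
    leftPath s = [leftSide s 0, leftSide s 1, leftSide s 2, leftSide s 3] := rfl

theorem rightPath_eq (s : Letter) :
    rightPath s = [rightSide s 0, rightSide s 1, rightSide s 2, rightSide s 3] := rfl

theorem turnSum_flip_nil (s : Letter) (ys : List Letter) :
    turnSum (leftPath s ++ ys) + 17 ≤ turnSum (rightPath s ++ ys) := by
  have h1 : ∀ s : Letter, (turnNum (leftSide s 0) (leftSide s 1)).val = 1 ∧
    (turnNum (leftSide s 1) (leftSide s 2)).val = 1 ∧
    (turnNum (leftSide s 2) (leftSide s 3)).val = 1 ∧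
    (turnNum (rightSide s 0) (rightSide s 1)).val = 7 ∧
    (turnNum (rightSide s 1) (rightSide s 2)).val = 7 ∧
    (turnNum (rightSide s 2) (rightSide s 3)).val = 7 := by decide
  obtain ⟨a, b, c, d, e, f⟩ := h1 s
  have h2 : turnSum (leftSide s 3 :: ys) ≤ turnSum (rightSide s 3 :: ys) + 1 := by
    cases ys with
    | nil => simp [turnSum]
    | cons k l =>
      have := turnNum_leftPath_last s k
      simp only [turnSum]
      omega
  simp only [leftPath_eq, rightPath_eq, List.cons_append, List.nil_append, turnSum]
  omega

/-- The three inner turns fall from 7 to 1, while the turns at the two ends grow by at most 1 each.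
-/
theorem turnSum_flip (s : Letter) (xs ys : List Letter) :
    turnSum (xs ++ leftPath s ++ ys) + 16 ≤ turnSum (xs ++ rightPath s ++ ys) := by
  induction xs with
  | nil => have := turnSum_flip_nil s ys; simp only [List.nil_append]; omega
  | cons k xs ih =>
    cases xs with
    | nil =>
      have h1 := turnSum_flip_nil s ys
      have h2 := turnNum_leftPath_head s k
      simp only [leftPath_eq, rightPath_eq, List.cons_append, List.nil_append, turnSum] at h1 h2 ⊢
      omega
    | cons k' xs =>
      simp only [List.cons_append, turnSum] at ih ⊢
      omega

theorem exists_shortest (g : SurfaceGroup) : ∃ w, eval w = g ∧ Shortest w := by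
  obtain ⟨w, hw, hmin⟩ := (measure List.length).wf.has_min {w : List Letter | eval w = g}
    (exists_eval g)
  exact ⟨w, hw, fun w' hw' => not_lt.1 (hmin w' (hw'.trans hw))⟩

/-- Among the shortest words for `g`, one of least turn sum has no right path, since flipping an
octagon would lower the sum. -/
theorem exists_tight (g : SurfaceGroup) : ∃ w, eval w = g ∧ Tight w := by
  obtain ⟨w, ⟨hw, hs⟩, hmin⟩ := (measure turnSum).wf.has_min {w | eval w = g ∧ Shortest w}
    (exists_shortest g)
  refine ⟨w, hw, hs.tight fun s xs ys h => ?_⟩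
  have h1 := eval_flip s xs ys
  have h2 := length_flip s xs ys
  rw [← h] at h1 h2
  refine hmin (xs ++ leftPath s ++ ys) ⟨h1.trans hw, fun w' hw' => ?_⟩ ?_
  · rw [h2]; exact hs w' (hw'.trans h1)
  · have h3 := turnSum_flip s xs ys
    rw [← h] at h3
    change turnSum _ < turnSum _
    omega

/-- Two vertices that are not separated by a wall are equal. -/
theorem eq_of_not_separated {g h : SurfaceGroup} (hgh : ∀ v, IsRoot v → 0 < pt g v → 0 < pt h v) :
    g = h := by
  obtain ⟨w, hw, ht⟩ := exists_tight (g⁻¹ * h)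
  cases w with
  | nil => rw [eval_nil] at hw; exact (inv_mul_eq_one.1 hw.symm)
  | cons k l =>
    have h1 := ht.beyond
    rw [hw] at h1
    have h2 := hgh (act g (wall (dir k))) ((isRoot_wall _).act g) (by rw [pt_act_wall]; norm_num)
    rw [← mul_inv_cancel_left g h, pt_mul_act] at h2
    linarith

/-! ### Bi-infinite paths -/

/-- The part of length `m` of a bi-infinite word that starts at `i`. -/
def seg (u : ℤ → Letter) (i : ℤ) (m : ℕ) : List Letter := (List.range m).map fun j : ℕ => u (i + j)

theorem length_seg (u : ℤ → Letter) (i : ℤ) (m : ℕ) : (seg u i m).length = m := by simp [seg]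

theorem seg_succ (u : ℤ → Letter) (i : ℤ) (m : ℕ) : seg u i (m + 1) = seg u i m ++ [u (i + m)] := by
  simp [seg, List.range_succ]

theorem seg_succ' (u : ℤ → Letter) (i : ℤ) (m : ℕ) : seg u i (m + 1) = u i :: seg u (i + 1) m := by
  simp only [seg, List.range_succ_eq_map, List.map_cons, List.map_map, Nat.cast_zero, add_zero]
  congr 2
  funext j
  simp only [Function.comp_apply, Nat.cast_succ]
  ring_nf

/-- The vertices of a path that spells the bi-infinite word `u`. -/
def IsPath (u : ℤ → Letter) (P : ℤ → SurfaceGroup) : Prop := ∀ i, P (i + 1) = P i * eval [u i]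

theorem IsPath.add {u : ℤ → Letter} {P : ℤ → SurfaceGroup} (h : IsPath u P) (i : ℤ) (m : ℕ) :
    P (i + m) = P i * eval (seg u i m) := by
  induction m with
  | zero => simp [seg, eval_nil]
  | succ m ih => rw [seg_succ, eval_append, ← mul_assoc, ← ih, ← h, Nat.cast_succ, add_assoc]

theorem IsPath.eq_of_eq {u : ℤ → Letter} {P Q : ℤ → SurfaceGroup} (hP : IsPath u P)
    (hQ : IsPath u Q) (h : P 0 = Q 0) (i : ℤ) : P i = Q i := by
  induction i using Int.induction_on with
  | zero => exact h
  | succ i ih => rw [hP, hQ, ih]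
  | pred i ih =>
    have h1 := hP (-i - 1)
    have h2 := hQ (-i - 1)
    rw [sub_add_cancel] at h1 h2
    rw [h1, h2] at ih
    exact mul_right_cancel ih

theorem exists_isPath (u : ℤ → Letter) : ∃ P, IsPath u P ∧ P 0 = 1 := by
  refine ⟨fun i => if 0 ≤ i then eval (seg u 0 i.toNat) else (eval (seg u i (-i).toNat))⁻¹,
    fun i => ?_, by simp [seg, eval_nil]⟩
  rcases lt_trichotomy i (-1) with h | h | h
  · have e : (-i).toNat = (-(i + 1)).toNat + 1 := by omega
    simp only [show ¬ 0 ≤ i by omega, show ¬ 0 ≤ i + 1 by omega, if_false]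
    rw [e, seg_succ', eval_cons, mul_inv_rev, inv_mul_cancel_right]
  · subst h
    simp [seg, eval_nil]
  · have e : (i + 1).toNat = i.toNat + 1 := by omega
    simp only [show 0 ≤ i by omega, show 0 ≤ i + 1 by omega, if_true]
    rw [e, seg_succ, eval_append, Int.toNat_of_nonneg (by omega), zero_add]

theorem IsPath.shift {u : ℤ → Letter} {P : ℤ → SurfaceGroup} (h : IsPath u P) {n : ℕ}
    (hu : ∀ i, u (i + n) = u i) (h0 : P 0 = 1) (i : ℤ) : P (i + n) = eval (seg u 0 n) * P i := by
  refine IsPath.eq_of_eq (u := u) (P := fun i => P (i + n)) (Q := fun i => eval (seg u 0 n) * P i)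
    (fun i => ?_) (fun i => ?_) ?_ i
  · change P (i + 1 + n) = _
    rw [add_right_comm, h, hu]
  · change _ * P (i + 1) = _
    rw [h, mul_assoc]
  · rw [h.add, h0, one_mul, mul_one]

theorem shift_zpow {P : ℤ → SurfaceGroup} {g : SurfaceGroup} {n : ℤ} (h : ∀ i, P (i + n) = g * P i)
    (c i : ℤ) : P (i + n * c) = g ^ c * P i := by
  induction c using Int.induction_on with
  | zero => simp
  | succ c ih => rw [mul_add, mul_one, ← add_assoc, h, ih, ← mul_assoc, mul_self_zpow, add_comm]
  | pred c ih =>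
    have := h (i + n * (-c - 1))
    rw [show i + n * (-c - 1 : ℤ) + n = i + n * -c by ring, ih] at this
    have e : P (i + n * (-c - 1)) = g⁻¹ * (g ^ (-c : ℤ) * P i) := by
      rw [this, inv_mul_cancel_left]
    rw [e, ← mul_assoc, ← zpow_neg_one, ← zpow_add, neg_add_eq_sub]

/-- The wall crossed by the edge number `i` of a path. -/
def wallAt (u : ℤ → Letter) (P : ℤ → SurfaceGroup) (i : ℤ) : Vec := act (P i) (wall (dir (u i)))

theorem isRoot_wallAt (u : ℤ → Letter) (P : ℤ → SurfaceGroup) (i : ℤ) : IsRoot (wallAt u P i) :=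
  (isRoot_wall _).act _

theorem IsPath.eq_wallAt {u : ℤ → Letter} {P : ℤ → SurfaceGroup} (h : IsPath u P) {v : Vec}
    (hv : IsRoot v) {i : ℤ} (h1 : 0 < pt (P i) v) (h2 : pt (P (i + 1)) v < 0) :
    v = wallAt u P i := by
  rw [h] at h2
  exact eq_act_wall_of_separates hv _ _ h1 h2

theorem wallAt_shift {u : ℤ → Letter} {P : ℤ → SurfaceGroup} {g : SurfaceGroup} {n : ℤ}
    (hu : ∀ i, u (i + n) = u i) (h : ∀ i, P (i + n) = g * P i) (c i : ℤ) :
    wallAt u P (i + n * c) = act (g ^ c) (wallAt u P i) := by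
  have : u (i + n * c) = u i := by
    rw [mul_comm]
    exact (Function.Periodic.int_mul (f := u) hu c) i
  rw [wallAt, wallAt, this, shift_zpow h, act_mul]

/-- All parts of the bi-infinite word are leftmost shortest words. -/
def TightSeq (u : ℤ → Letter) : Prop := ∀ i m, Tight (seg u i m)

section

variable {u : ℤ → Letter} {P : ℤ → SurfaceGroup}

theorem TightSeq.beyond (hu : TightSeq u) (hP : IsPath u P) {i m : ℤ} (h : i < m) :
    pt (P m) (wallAt u P i) < 0 := by
  obtain ⟨k, rfl⟩ : ∃ k : ℕ, m = i + (k + 1 : ℕ) := ⟨(m - i - 1).toNat, by omega⟩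
  rw [hP.add, wallAt, pt_mul_act]
  have := hu i (k + 1)
  rw [seg_succ'] at this ⊢
  exact this.beyond

/-- Going backwards, a first change of side would make edge `m - 1` cross the same wall in the
opposite direction; then the vertex after edge `i` would lie on both sides of it. -/
theorem TightSeq.before (hu : TightSeq u) (hP : IsPath u P) {i m : ℤ} (h : m ≤ i) :
    0 < pt (P m) (wallAt u P i) := by
  induction m, h using Int.leInductionDown with
  | base => rw [wallAt, pt_act_wall]; norm_num
  | pred m hm ih =>
    by_contra hc
    have h1 := lt_of_le_of_ne (not_lt.1 hc) (pt_root_ne_zero (isRoot_wallAt u P i) _)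
    have h2 := hP.eq_wallAt (v := -wallAt u P i) (isRoot_wallAt u P i).neg (i := m - 1)
      (by rw [pt_neg]; linarith) (by rw [pt_neg, sub_add_cancel]; linarith)
    have h3 := hu.beyond hP (i := m - 1) (m := i + 1) (by omega)
    have h4 := hu.beyond hP (i := i) (m := i + 1) (by omega)
    rw [← h2, pt_neg] at h3
    linarith

theorem TightSeq.pos_iff (hu : TightSeq u) (hP : IsPath u P) {i m : ℤ} :
    0 < pt (P m) (wallAt u P i) ↔ m ≤ i := by
  refine ⟨fun h => ?_, hu.before hP⟩
  by_contra hc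
  exact absurd h (not_lt.2 (hu.beyond hP (not_le.1 hc)).le)

theorem TightSeq.neg_iff (hu : TightSeq u) (hP : IsPath u P) {i m : ℤ} :
    pt (P m) (wallAt u P i) < 0 ↔ i < m := by
  refine ⟨fun h => ?_, hu.beyond hP⟩
  by_contra hc
  exact absurd h (not_lt.2 (hu.before hP (not_lt.1 hc)).le)

theorem TightSeq.wallAt_injective (hu : TightSeq u) (hP : IsPath u P) :
    Function.Injective (wallAt u P) := by
  intro i j h
  refine le_antisymm ?_ ?_
  · rw [← hu.pos_iff hP, ← h, hu.pos_iff hP]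
  · rw [← hu.pos_iff hP, h, hu.pos_iff hP]

end

theorem finite_separating (g h : SurfaceGroup) :
    {v | IsRoot v ∧ 0 < pt g v ∧ pt h v < 0}.Finite := by
  obtain ⟨w, hw⟩ := exists_eval (g⁻¹ * h)
  obtain rfl : h = g * eval w := by rw [hw, mul_inv_cancel_left]
  clear hw
  induction w generalizing g with
  | nil =>
    refine Set.finite_empty.subset ?_
    rintro v ⟨_, h1, h2⟩
    rw [eval_nil, mul_one] at h2
    linarith
  | cons k w ih =>
    refine ((Set.finite_singleton (act g (wall (dir k)))).union (ih (g * eval [k]))).subset ?_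
    rintro v ⟨h0, h1, h2⟩
    rcases lt_or_gt_of_ne (pt_root_ne_zero h0 (g * eval [k])) with h3 | h3
    · exact .inl (eq_act_wall_of_separates h0 g k h1 h3)
    · exact .inr ⟨h0, h3, by rwa [mul_assoc, ← eval_cons]⟩

theorem not_separating_family {f : ℕ → Vec} (hf : Function.Injective f) (hr : ∀ N, IsRoot (f N))
    (g h : SurfaceGroup) (h1 : ∀ N, 0 < pt g (f N)) (h2 : ∀ N, pt h (f N) < 0) : False :=
  Set.infinite_range_of_injective hf ((finite_separating g h).subset (by
    rintro _ ⟨N, rfl⟩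
    exact ⟨hr N, h1 N, h2 N⟩))

/-! ### Two paths with the same translation -/

section

variable {u v : ℤ → Letter} {P Q : ℤ → SurfaceGroup} {g : SurfaceGroup} {n m : ℕ}

/-- A path with the same translation as a tight one crosses all its walls. -/
theorem TightSeq.exists_wallAt_eq (hu : TightSeq u) (hP : IsPath u P) (hn : n ≠ 0)
    (hun : ∀ i, u (i + n) = u i) (hPn : ∀ i, P (i + n) = g * P i) (hQ : IsPath v Q)
    (hQm : ∀ i, Q (i + m) = g * Q i) (i : ℤ) : ∃ j, wallAt u P i = wallAt v Q j := by
  by_contra hc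
  push Not at hc
  set H := wallAt u P i with hH
  have hr : IsRoot H := isRoot_wallAt u P i
  have down : ∀ j, pt (Q (j + 1)) H < 0 → pt (Q j) H < 0 := fun j h => by
    rcases lt_or_gt_of_ne (pt_root_ne_zero hr (Q j)) with h1 | h1
    · exact h1
    · exact absurd (hQ.eq_wallAt hr h1 h) (hc j)
  -- Moving the wall by a power of `g` amounts to moving along `Q` by periods. So if `Q` stays on
  -- one side of `H`, infinitely many translates separate a fixed vertex of `P` from one of `Q`.
  have move (j c : ℤ) : pt (Q j) (wallAt u P (i + n * c)) = pt (Q (j + m * -c)) H := by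
    rw [wallAt_shift hun hPn, shift_zpow hQm, pt_mul, zpow_neg, _root_.inv_inv]
  have inj (s : ℤ) (hs : s ≠ 0) :
      Function.Injective fun N : ℕ => wallAt u P (i + n * (s * N)) := by
    intro a b hab
    have := hu.wallAt_injective hP hab
    simpa [hn, hs] using this
  by_cases h : ∃ j, pt (Q j) H < 0
  · obtain ⟨j, hj⟩ := h
    have hall : ∀ j' ≤ j, pt (Q j') H < 0 := fun j' hj' => by
      induction j', hj' using Int.leInductionDown with
      | base => exact hj
      | pred k _ ih => exact down _ (by rwa [sub_add_cancel])
    refine not_separating_family (inj 1 one_ne_zero) (fun N => isRoot_wallAt u P _) (P i) (Q j)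
      (fun N => ?_) (fun N => ?_)
    · refine hu.before hP ?_
      have : (0 : ℤ) ≤ n * (1 * N) := by positivity
      linarith
    · rw [move]
      refine hall _ ?_
      have : (0 : ℤ) ≤ m * (1 * N) := by positivity
      linarith
  · push Not at h
    refine not_separating_family (inj (-1) (by norm_num)) (fun N => isRoot_wallAt u P _) (Q 0)
      (P (i + 1)) (fun N => ?_) (fun N => ?_)
    · rw [move]
      exact lt_of_le_of_ne (h _) (pt_root_ne_zero hr _).symm
    · refine hu.beyond hP ?_
      have : (0 : ℤ) ≤ n * N := by positivity
      linarith

theorem TightSeq.period_le (hu : TightSeq u) (hP : IsPath u P)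
    (hun : ∀ i, u (i + n) = u i) (hPn : ∀ i, P (i + n) = g * P i) (hQ : IsPath v Q)
    (hvm : ∀ i, v (i + m) = v i) (hQm : ∀ i, Q (i + m) = g * Q i) : n ≤ m := by
  rcases eq_or_ne n 0 with rfl | hn
  · exact Nat.zero_le _
  by_contra hlt
  push Not at hlt
  choose j hj using hu.exists_wallAt_eq hP hn hun hPn hQ hQm
  rcases eq_or_ne m 0 with rfl | hm
  · have h1 : g = 1 := by
      have := hQm 0
      rw [Nat.cast_zero, add_zero] at this
      exact right_eq_mul.1 this
    have h2 := hPn 0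
    rw [h1, one_mul, zero_add] at h2
    have h3 := hu.beyond hP (i := 0) (m := n) (by omega)
    rw [h2] at h3
    exact absurd (hu.before hP le_rfl) (not_lt.2 h3.le)
  · obtain ⟨a, ha, b, hb, hab, he⟩ := Finset.exists_ne_map_eq_of_card_lt_of_maps_to
      (s := Finset.range n) (t := Finset.range m) (by simpa using hlt)
      (f := fun a => (j a % m).toNat) (fun a _ => by
        have h1 := Int.emod_nonneg (j a) (show (m : ℤ) ≠ 0 by exact_mod_cast hm)
        have h2 := Int.emod_lt_of_pos (j a) (show (0 : ℤ) < m by omega)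
        simp only [Finset.coe_range, Set.mem_Iio]
        omega)
    have h1 := Int.emod_nonneg (j a) (show (m : ℤ) ≠ 0 by exact_mod_cast hm)
    have h2 := Int.emod_nonneg (j b) (show (m : ℤ) ≠ 0 by exact_mod_cast hm)
    obtain ⟨c, hc⟩ : ∃ c, j b = j a + m * c := by
      have h3 : j a % m = j b % m := by
        have : (j a % m).toNat = (j b % m).toNat := he
        omega
      obtain ⟨c, hc⟩ := Int.ModEq.dvd (n := m) (a := j a) (b := j b) h3
      exact ⟨c, by linarith⟩
    have h4 : wallAt u P b = wallAt u P (a + n * c) := by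
      rw [hj b, hc, wallAt_shift hvm hQm, wallAt_shift hun hPn, hj a]
    have h5 := hu.wallAt_injective hP h4
    simp only [Finset.mem_range] at ha hb
    have h6 : (b : ℤ) - a = n * c := by linarith
    have h7 : (n : ℤ) ∣ (b : ℤ) - a := ⟨c, h6⟩
    have h8 := Int.eq_zero_of_abs_lt_dvd h7 (by rw [abs_lt]; omega)
    omega

/-- A path passes through each vertex at which a leftmost path with the same translation goes
straight on. -/
theorem TightSeq.exists_vertex_eq (hu : TightSeq u) (hP : IsPath u P) (hn : n ≠ 0)
    (hun : ∀ i, u (i + n) = u i) (hPn : ∀ i, P (i + n) = g * P i) (hv : TightSeq v)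
    (hQ : IsPath v Q) (hvn : ∀ i, v (i + n) = v i) (hQn : ∀ i, Q (i + n) = g * Q i)
    {o : ℤ} (ho : turnNum (u (o - 1)) (u o) = 4) : ∃ j, P o = Q j := by
  choose c hc using hu.exists_wallAt_eq hP hn hun hPn hQ hQn
  choose d hd using hv.exists_wallAt_eq hQ hn hvn hQn hP hPn
  set i0 := dir (inv (u (o - 1))) with hi0
  have k4 : act (P o) (wall (i0 + 4)) = wallAt u P o := by
    rw [wallAt, ← ho, turnNum, add_sub_cancel]
  have k0 : act (P o) (wall i0) = -wallAt u P (o - 1) := by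
    have := hP (o - 1)
    rw [sub_add_cancel] at this
    rw [this, wallAt, act_mul, ← act_neg]
    congr 1
    have := act_letter_inv_wall_self (inv (u (o - 1)))
    rwa [inv_inv, eval_inv, _root_.inv_inv] at this
  have posP (i m : ℤ) : 0 < pt (P m) (wallAt u P i) ↔ m ≤ i := hu.pos_iff hP
  have negP (i m : ℤ) : pt (P m) (wallAt u P i) < 0 ↔ i < m := hu.neg_iff hP
  have posQ (i m : ℤ) : 0 < pt (Q m) (wallAt u P i) ↔ m ≤ c i := by rw [hc, hv.pos_iff hQ]
  have negQ (i m : ℤ) : pt (Q m) (wallAt u P i) < 0 ↔ c i < m := by rw [hc, hv.neg_iff hQ]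
  have root (i : ℤ) : IsRoot (wallAt u P i) := isRoot_wallAt u P i
  have chain {x y : Vec} (hx : IsRoot x) (hy : IsRoot y) (h1 : 0 < pt (P o) x)
      (h2 : 0 < pt (P o) y) {h₁ h₂ h₃ : SurfaceGroup} (e1 : 0 < pt h₁ (wallAt u P (o - 1)))
      (e1' : pt h₁ x < 0) (e2 : pt h₂ x < 0) (e2' : pt h₂ y < 0) (e3 : pt h₃ y < 0)
      (e3' : pt h₃ (wallAt u P o) < 0) : False :=
    not_chain (P o) i0 hx hy h1 h2 (by rw [k0, pt_neg]; linarith) e1' e2 e2' e3 (by rwa [k4])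
  -- Otherwise `Q` would have a vertex beyond both opposite walls of the vertex `P o`, which are
  -- disjoint.
  have hab : c (o - 1) < c o := by
    by_contra hba
    have hne : c o ≠ c (o - 1) := fun h => by
      have := hu.wallAt_injective hP ((hc o).trans (h ▸ (hc (o - 1)).symm))
      omega
    have h1 := form_gt_of_quadrants ((isRoot_wall i0).act (P o)) ((isRoot_wall (i0 + 4)).act (P o))
      (g := P o) (h := Q (c o + 1)) (by rw [pt_act_wall]; norm_num) (by rw [pt_act_wall]; norm_num)
      (by rw [k0, pt_neg, neg_lt_zero, posQ]; omega) (by rw [k4, negQ]; omega)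
    rw [form_act] at h1
    refine absurd (form_wall_le (i := i0) (j := i0 + 4) ?_ ?_ ?_) (not_le.2 h1) <;>
    · clear_value i0
      clear * -
      revert i0
      decide
  -- The other path may cross walls in another order, but not across `o`: exchanged walls would link
  -- the two opposite walls at `P o` in a chain of crossings. The cases are whether `m` is `o` and
  -- `m'` is `o - 1`.
  have order (m' m : ℤ) (h' : m' < o) (h : o ≤ m) : c m' < c m := by
    rcases eq_or_lt_of_le h with rfl | h
    · rcases eq_or_lt_of_le (Int.le_sub_one_of_lt h') with rfl | h'
      · exact hab
      · by_contra hcon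
        have hne : c o ≠ c m' := fun h => by
          have := hu.wallAt_injective hP ((hc o).trans (h ▸ (hc m').symm))
          omega
        exact chain (root m').neg (root m').neg (by rw [pt_neg, neg_pos, negP]; omega)
          (by rw [pt_neg, neg_pos, negP]; omega) (h₁ := P m') (h₂ := P m') (h₃ := Q (c o + 1))
          (by rw [posP]; omega) (by rw [pt_neg, neg_lt_zero, posP])
          (by rw [pt_neg, neg_lt_zero, posP])
          (by rw [pt_neg, neg_lt_zero, posP])
          (by rw [pt_neg, neg_lt_zero, posQ]; omega) (by rw [negQ]; omega)
    · rcases eq_or_lt_of_le (Int.le_sub_one_of_lt h') with rfl | h'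
      · by_contra hcon
        have hne : c m ≠ c (o - 1) := fun h => by
          have := hu.wallAt_injective hP ((hc m).trans (h ▸ (hc (o - 1)).symm))
          omega
        exact chain (root m) (root m) (by rw [posP]; omega)
          (by rw [posP]; omega) (h₁ := Q (c m + 1)) (h₂ := P (m + 1)) (h₃ := P (m + 1))
          (by rw [posQ]; omega) (by rw [negQ]; omega) (by rw [negP]; omega) (by rw [negP]; omega)
          (by rw [negP]; omega) (by rw [negP]; omega)
      · by_contra hcon
        have hne : c m ≠ c m' := fun h => by
          have := hu.wallAt_injective hP ((hc m).trans (h ▸ (hc m').symm))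
          omega
        exact chain (root m').neg (root m) (by rw [pt_neg, neg_pos, negP]; omega)
          (by rw [posP]; omega) (h₁ := P m') (h₂ := Q (c m + 1)) (h₃ := P (m + 1))
          (by rw [posP]; omega) (by rw [pt_neg, neg_lt_zero, posP])
          (by rw [pt_neg, neg_lt_zero, posQ]; omega) (by rw [negQ]; omega)
          (by rw [negP]; omega) (by rw [negP]; omega)
  -- The vertex sought is the one from which `Q` first crosses a wall that `P` crosses from `o` on;
  -- no wall separates it from `P o`.
  obtain ⟨j, ⟨m0, hm0, rfl⟩, hmin⟩ := Int.exists_least_of_bdd (P := fun j => ∃ m, o ≤ m ∧ c m = j)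
    ⟨c (o - 1), by rintro _ ⟨m, hm, rfl⟩; exact (order _ _ (by omega) hm).le⟩ ⟨c o, o, le_rfl, rfl⟩
  refine ⟨c m0, eq_of_not_separated fun x hx h1 => ?_⟩
  by_contra h2
  replace h2 := lt_of_le_of_ne (not_lt.1 h2) (pt_root_ne_zero hx _)
  by_cases hp : ∃ m, x = wallAt u P m
  · obtain ⟨m, rfl⟩ := hp
    rw [posP] at h1
    rw [negQ] at h2
    exact absurd (hmin _ ⟨m, h1, rfl⟩) (not_le.2 h2)
  by_cases hp' : ∃ m, -x = wallAt u P m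
  · obtain ⟨m, hm⟩ := hp'
    have h3 : pt (P o) (wallAt u P m) < 0 := by rw [← hm, pt_neg]; linarith
    have h4 : 0 < pt (Q (c m0)) (wallAt u P m) := by rw [← hm, pt_neg]; linarith
    rw [negP] at h3
    rw [posQ] at h4
    exact absurd h4 (not_le.2 (order _ _ h3 hm0))
  push Not at hp hp'
  have same (i j : ℤ) (h : pt (Q i) x < 0) : pt (Q j) x < 0 := by
    rcases le_total i j with hij | hij
    · induction j, hij using Int.leInduction with
      | base => exact h
      | succ k _ ih =>
        by_contra h3
        replace h3 := lt_of_le_of_ne (not_lt.1 h3) (pt_root_ne_zero hx _).symm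
        exact hp' _ ((hQ.eq_wallAt hx.neg (by rw [pt_neg]; linarith)
          (by rw [pt_neg]; linarith)).trans (hd k))
    · induction j, hij using Int.leInductionDown with
      | base => exact h
      | pred k _ ih =>
        by_contra h3
        replace h3 := lt_of_le_of_ne (not_lt.1 h3) (pt_root_ne_zero hx _).symm
        exact hp _ ((hQ.eq_wallAt hx h3 (by rwa [sub_add_cancel])).trans (hd _))
  -- A wall that neither path crosses has all of `Q` beyond it and would by itself link the two
  -- opposite walls.
  exact chain hx hx h1 h1 (h₁ := Q (c (o - 1))) (h₂ := Q 0) (h₃ := Q (c o + 1))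
    (by rw [posQ]) (same _ _ h2) (same _ _ h2) (same _ _ h2) (same _ _ h2) (by rw [negQ]; omega)

theorem periodic_eq_of_seg_eq {i j : ℤ} (hn : n ≠ 0) (hun : ∀ i, u (i + n) = u i)
    (hvn : ∀ i, v (i + n) = v i) (h : seg u i n = seg v j n) (k : ℤ) : u (i + k) = v (j + k) := by
  have hpos : (0 : ℤ) < n := by omega
  have red (w : ℤ → Letter) (hw : ∀ i, w (i + n) = w i) (i : ℤ) :
      w (i + k) = w (i + (k % n).toNat) := by
    rw [Int.toNat_of_nonneg (Int.emod_nonneg _ hpos.ne')]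
    have := (Function.Periodic.int_mul (f := w) hw (k / n)) (i + k % n)
    rw [← this]
    rw [add_assoc, Int.cast_id, Int.emod_add_ediv_mul]
  rw [red u hun, red v hvn]
  have hlt : (k % n).toNat < n := by
    have := Int.emod_lt_of_pos k hpos
    omega
  have := congrArg (fun l : List Letter => l[(k % n).toNat]?) h
  simpa [seg, hlt] using this

/-- Leftmost periodic words of conjugate elements agree up to a shift, if they go straight on
somewhere. -/
theorem TightSeq.exists_shift (hu : TightSeq u) (hn : n ≠ 0) (hun : ∀ i, u (i + n) = u i)
    (hv : TightSeq v) (hvn : ∀ i, v (i + n) = v i)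
    (hconj : ConjClasses.mk (eval (seg u 0 n)) = ConjClasses.mk (eval (seg v 0 n)))
    (ho : ∃ o, turnNum (u (o - 1)) (u o) = 4) : ∃ s, ∀ i, v (i + s) = u i := by
  obtain ⟨o, ho⟩ := ho
  obtain ⟨P, hP, hP0⟩ := exists_isPath u
  obtain ⟨Q, hQ, hQ0⟩ := exists_isPath v
  rw [ConjClasses.mk_eq_mk_iff_isConj, isConj_iff] at hconj
  obtain ⟨x, hx⟩ := hconj
  have hPn := hP.shift hun hP0
  have hQn := hQ.shift hvn hQ0
  have hQ' : IsPath v fun i => x⁻¹ * Q i := fun i => by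
    change x⁻¹ * Q (i + 1) = _
    rw [hQ, mul_assoc]
  have hQn' (i : ℤ) : x⁻¹ * Q (i + n) = eval (seg u 0 n) * (x⁻¹ * Q i) := by
    rw [hQn, ← hx]
    group
  obtain ⟨j, hj⟩ := hu.exists_vertex_eq hP hn hun hPn hv hQ' hvn hQn' ho
  have hseg : seg u o n = seg v j n := by
    refine (hu o n).eq_of_eval_eq (hv j n) (by rw [length_seg, length_seg]) ?_
    have h1 := hP.add o n
    have h2 := hQ'.add j n
    rw [hQn', ← hj, ← hPn] at h2
    exact mul_left_cancel (h1.symm.trans h2)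
  refine ⟨j - o, fun i => ?_⟩
  have := periodic_eq_of_seg_eq hn hun hvn hseg (i - o)
  rw [add_sub_cancel] at this
  rw [this]
  congr 1
  ring

end

/-! ### States as kinds with a left edge -/

instance : Fintype Side := ⟨{.L, .R}, by intro x; cases x <;> decide⟩

/-- The kinds of Markov states. -/
inductive Kind
  | A
  | A₁ (h : Side)
  | A₂ (h : Side)
  | B
  | C
  | C₁
  | D
  | E (h : Side)
  deriving DecidableEq

instance : Fintype Kind :=
  ⟨{.A, .A₁ .L, .A₁ .R, .A₂ .L, .A₂ .R, .B, .C, .C₁, .D, .E .L, .E .R},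
    by rintro (_ | ⟨_ | _⟩ | ⟨_ | _⟩ | _ | _ | _ | _ | ⟨_ | _⟩) <;> decide⟩

/-- The kind of a state. -/
def State.kind : State → Kind
  | .A _ => .A
  | .A₁ h _ => .A₁ h
  | .A₂ h _ => .A₂ h
  | .B _ => .B
  | .C _ => .C
  | .C₁ _ => .C₁
  | .D _ => .D
  | .E h _ => .E h

/-- The edge of which `k` is the rightmost continuation. -/
def unturn (k : Letter) : Letter := inv (cw k)

/-- The state of a given kind with a given left edge. -/
def Kind.state : Kind → Letter → State
  | .A, k => .A k
  | .A₁ h, k => .A₁ h k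
  | .A₂ h, k => .A₂ h k
  | .B, k => .B (cw k)
  | .C, k => .C (cw (unturn k))
  | .C₁, k => .C₁ (cw (unturn (unturn k)))
  | .D, k => .D (cw (unturn (unturn (unturn k))))
  | .E .L, k => .E .L (cw (unturn (unturn (unturn (cw k)))))
  | .E .R, k => .E .R (cw (unturn (unturn (unturn k))))

theorem kind_state (K : Kind) (k : Letter) : (K.state k).kind = K := by
  rcases K with _ | ⟨_ | _⟩ | ⟨_ | _⟩ | _ | _ | _ | _ | ⟨_ | _⟩ <;> rfl

theorem leftEdge_state (K : Kind) (k : Letter) : leftEdge (K.state k) = k := by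
  rcases K with _ | ⟨_ | _⟩ | ⟨_ | _⟩ | _ | _ | _ | _ | ⟨_ | _⟩ <;> revert k <;> decide

theorem state_kind_leftEdge (J : State) : J.kind.state (leftEdge J) = J := by
  rcases J with k | ⟨_ | _, k⟩ | ⟨_ | _, k⟩ | k | k | k | k | ⟨_ | _, k⟩ <;> revert k <;> decide

/-- A sequence of states is its word of left edges together with its sequence of kinds; all
transition questions thus become finite checks on kinds and turn numbers. -/
theorem state_ext {J K : State} (h : J.kind = K.kind) (h' : leftEdge J = leftEdge K) : J = K := by
  rw [← state_kind_leftEdge J, h, h', state_kind_leftEdge]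

/-- The transitions between kinds, on the turn numbers of the left edges. -/
def Kind.next : Kind → Fin 8 → Kind → Bool
  | .A, t, .A | .A₁ _, t, .A | .A₂ _, t, .A => decide (2 ≤ t ∧ t ≤ 6)
  | .A, t, .A₁ .R | .A₁ .L, t, .A₁ .R | .A₂ .L, t, .A₁ .R => decide (t = 1)
  | .A, t, .A₁ .L | .A₁ .R, t, .A₁ .L | .A₂ .R, t, .A₁ .L => decide (t = 7)
  | .A₁ .R, t, .A₂ .R => decide (t = 1)
  | .A₁ .L, t, .A₂ .L => decide (t = 7)
  | .A, t, .B | .A₁ _, t, .B => decide (2 ≤ t)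
  | .A₂ .R, t, .B => decide (3 ≤ t)
  | .A₂ .L, t, .B => decide (2 ≤ t ∧ t ≤ 6)
  | .B, t, .C | .C, t, .C₁ | .C₁, t, .D | .C₁, t, .E .R | .E .L, t, .C => decide (t = 1)
  | .C₁, t, .E .L | .E .R, t, .C => decide (t = 2)
  | .D, t, .A => decide (3 ≤ t ∧ t ≤ 6)
  | .D, t, .A₁ .R => decide (t = 2)
  | .D, t, .A₁ .L => decide (t = 7)
  | .D, t, .B => decide (3 ≤ t)
  | _, _, _ => false

theorem Follows.next {J K : State} (h : Follows J K) :
    J.kind.next (turnNum (leftEdge J) (leftEdge K)) K.kind = true := by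
  cases h
  case A_A k i h1 h2 => interval_cases i <;> revert k <;> decide
  case A_B k i h1 h2 => interval_cases i <;> revert k <;> decide
  case A₁_A h k i h1 h2 => interval_cases i <;> revert k <;> revert h <;> decide
  case A₁_B h k i h1 h2 => interval_cases i <;> revert k <;> revert h <;> decide
  case A₂_A h k i h1 h2 => interval_cases i <;> revert k <;> revert h <;> decide
  case A₂R_B k i h1 h2 => interval_cases i <;> revert k <;> decide
  case A₂L_B k i h1 h2 => interval_cases i <;> revert k <;> decide
  case D_A s i h1 h2 => interval_cases i <;> revert s <;> decide
  case D_B s i h1 h2 => interval_cases i <;> revert s <;> decide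
  case C₁_E h s => revert s; revert h; decide
  all_goals
    rename_i k
    revert k
    decide

theorem turn_eq_cw (k : Letter) (i : ℕ) : turn k i = cw (turn k (i + 1)) := by
  have : ∀ k, cw (ccw k) = k := by decide
  rw [turn, turn, Function.iterate_succ_apply', this]

theorem turn_rightSide (k : Letter) (i : ℕ) :
    turn (rightSide (cw (unturn (unturn (unturn k)))) 3) i = turn k (i + 1) := by
  have : inv (rightSide (cw (unturn (unturn (unturn k)))) 3) = ccw (inv k) := by
    revert k; decide
  rw [turn, turn, Function.iterate_succ_apply, this]

theorem follows_of_next {K K' : Kind} {t : Fin 8} (h : K.next t K' = true) (k : Letter) :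
    Follows (K.state k) (K'.state (turn k t)) := by
  have ex {a : ℕ} {i : Fin 8} (h : a + 1 ≤ (i : ℕ)) : ∃ j : ℕ, (i : ℕ) = j + 1 ∧ a ≤ j ∧ j ≤ 6 :=
    ⟨i - 1, by omega⟩
  rcases K with _ | ⟨_ | _⟩ | ⟨_ | _⟩ | _ | _ | _ | _ | ⟨_ | _⟩ <;>
    rcases K' with _ | ⟨_ | _⟩ | ⟨_ | _⟩ | _ | _ | _ | _ | ⟨_ | _⟩ <;>
    simp only [Kind.next, decide_eq_true_eq, Bool.false_eq_true] at h <;>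
    simp only [Kind.state]
  · exact .A_A k t h.1 h.2
  · subst h; exact .A_A₁L k
  · subst h; exact .A_A₁R k
  · obtain ⟨j, hj, h1, h2⟩ := ex h
    rw [hj, ← turn_eq_cw]
    exact .A_B k j h1 h2
  · exact .A₁_A _ k t h.1 h.2
  · subst h; exact .A₁L_A₁R k
  · subst h; exact .A₁L_A₂L k
  · obtain ⟨j, hj, h1, h2⟩ := ex h
    rw [hj, ← turn_eq_cw]
    exact .A₁_B _ k j h1 h2
  · exact .A₁_A _ k t h.1 h.2
  · subst h; exact .A₁R_A₁L k
  · subst h; exact .A₁R_A₂R k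
  · obtain ⟨j, hj, h1, h2⟩ := ex h
    rw [hj, ← turn_eq_cw]
    exact .A₁_B _ k j h1 h2
  · exact .A₂_A _ k t h.1 h.2
  · subst h; exact .A₂L_A₁R k
  · obtain ⟨j, hj, h1, h2⟩ := ex h.1
    rw [hj, ← turn_eq_cw]
    exact .A₂L_B k j h1 (by have : (t : ℕ) ≤ 6 := h.2; omega)
  · exact .A₂_A _ k t h.1 h.2
  · subst h; exact .A₂R_A₁L k
  · obtain ⟨j, hj, h1, h2⟩ := ex h
    rw [hj, ← turn_eq_cw]
    exact .A₂R_B k j h1 h2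
  · subst h
    rw [show cw (unturn (turn k (1 : Fin 8))) = cw k by revert k; decide]
    exact .B_C _
  · subst h
    rw [show cw (unturn (unturn (turn k (1 : Fin 8)))) = cw (unturn k) by revert k; decide]
    exact .C_C₁ _
  · subst h
    rw [show cw (unturn (unturn (unturn (turn k (1 : Fin 8))))) = cw (unturn (unturn k)) by
      revert k; decide]
    exact .C₁_D _
  · subst h
    rw [show cw (unturn (unturn (unturn (cw (turn k (2 : Fin 8)))))) = cw (unturn (unturn k)) by
      revert k; decide]
    exact .C₁_E _ _
  · subst h
    rw [show cw (unturn (unturn (unturn (turn k (1 : Fin 8))))) = cw (unturn (unturn k)) by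
      revert k; decide]
    exact .C₁_E _ _
  · obtain ⟨j, hj, h1, h2⟩ := ex h.1
    rw [hj, ← turn_rightSide]
    exact .D_A _ j h1 (by have : (t : ℕ) ≤ 6 := h.2; omega)
  · subst h
    have := Follows.D_A₁L (cw (unturn (unturn (unturn k))))
    rwa [turn_rightSide] at this
  · subst h
    have := Follows.D_A₁R (cw (unturn (unturn (unturn k))))
    rwa [turn_rightSide] at this
  · obtain ⟨j, hj, h1, h2⟩ := ex h
    obtain ⟨j, rfl⟩ := Nat.exists_eq_add_of_le' (show 1 ≤ j by omega)
    rw [hj, ← turn_eq_cw, ← turn_rightSide]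
    exact .D_B _ j (by omega) (by omega)
  · subst h
    rw [show cw (unturn (turn k (1 : Fin 8))) =
      leftSide (cw (unturn (unturn (unturn (cw k))))) 3 by revert k; decide]
    exact .EL_C _
  · subst h
    rw [show cw (unturn (turn k (2 : Fin 8))) =
      cw (rightSide (cw (unturn (unturn (unturn k)))) 3) by revert k; decide]
    exact .ER_C _

theorem follows_iff {J K : State} :
    Follows J K ↔ J.kind.next (turnNum (leftEdge J) (leftEdge K)) K.kind = true := by
  refine ⟨Follows.next, fun h => ?_⟩
  have := follows_of_next h (leftEdge J)
  rwa [turn_turnNum, state_kind_leftEdge, state_kind_leftEdge] at this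

/-! ### The words of the Markov chain -/

/-- The states of the automaton in which it may read the word of a Markov chain sequence that has
started before a state of the given kind. -/
def Kind.modes : Kind → Mode → Bool
  | _, .free => true
  | .A₁ .L, .left1 | .A₂ .L, .left1 | .A₂ .L, .left2 | .B, .left1 | .B, .left2 => true
  | .A₁ .R, .right1 | .A₂ .R, .right1 | .A₂ .R, .right2 | .C, .right1 | .C₁, .right1
  | .C₁, .right2 | .D, .right1 | .D, .right2 | .D, .right3 | .E .R, .right1 | .E .R, .right2
  | .E .R, .right3 => true
  | _, _ => false

/-- The chain simulates the automaton, so every word of left edges is accepted from every starting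
place. -/
theorem Kind.modes_step : ∀ (K : Kind) (t : Fin 8) (K' : Kind) (q : Mode), K.next t K' = true →
    K.modes q = true → ∃ q', q.step t = some q' ∧ K'.modes q' = true := by
  decide +kernel

/-- The bi-infinite word of the leftmost edges. -/
def leftWord (x : ℤ → State) (i : ℤ) : Letter := leftEdge (x i)

theorem tightSeq_leftWord {x : ℤ → State} (hx : ∀ i, Follows (x i) (x (i + 1))) :
    TightSeq (leftWord x) := by
  have h (m : ℕ) : ∀ (i : ℤ) (q : Mode), (x i).kind.modes q = true →
      Runs q (leftWord x i) (seg (leftWord x) (i + 1) m) := by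
    induction m with
    | zero => intro i q _; trivial
    | succ m ih =>
      intro i q hq
      obtain ⟨q', h1, h2⟩ := Kind.modes_step _ _ _ _ (hx i).next hq
      rw [seg_succ']
      exact ⟨q', h1, ih _ _ h2⟩
  intro i m
  cases m with
  | zero => trivial
  | succ m =>
    rw [seg_succ']
    exact h m i .free (by cases (x i).kind <;> rfl)

theorem p_eq (n : ℕ) (x : ℤ → State) : p n x = ConjClasses.mk (eval (seg (leftWord x) 0 n)) := by
  simp only [p, seg, leftWord, zero_add]

theorem leftWord_periodic {n : ℕ} {x : ℤ → State} (hx : x ∈ periodic n) (i : ℤ) :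
    leftWord x (i + n) = leftWord x i := by
  rw [leftWord, hx.2, leftWord]

theorem exists_periodic_word (w : List Letter) :
    ∃ v : ℤ → Letter, (∀ i, v (i + w.length) = v i) ∧ seg v 0 w.length = w := by
  refine ⟨fun i => w.getD (i % w.length).toNat (.a, true), fun i => by simp, ?_⟩
  refine List.ext_getElem (length_seg _ _ _) fun j h1 h2 => ?_
  have : ((j : ℤ) % w.length) = j := Int.emod_eq_of_lt (by omega) (by omega)
  simp [seg, this, h2]

theorem mapsTo_p (n : ℕ) : Set.MapsTo (p n) (periodic n) (classes n) := by
  intro x hx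
  rw [p_eq]
  set u := leftWord x
  have hun := leftWord_periodic hx
  have hmem : n ∈ {k | ∃ w : List Letter, w.length = k ∧
      ConjClasses.mk (eval w) = ConjClasses.mk (eval (seg u 0 n))} :=
    ⟨_, length_seg u 0 n, rfl⟩
  refine le_antisymm (Nat.sInf_le hmem) (le_csInf ⟨n, hmem⟩ ?_)
  rintro m ⟨w, rfl, hw⟩
  obtain ⟨v, hv, hvw⟩ := exists_periodic_word w
  obtain ⟨P, hP, hP0⟩ := exists_isPath u
  obtain ⟨Q, hQ, hQ0⟩ := exists_isPath v
  rw [ConjClasses.mk_eq_mk_iff_isConj, isConj_iff] at hw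
  obtain ⟨c, hc⟩ := hw
  have hQm := hQ.shift hv hQ0
  refine (tightSeq_leftWord hx.1).period_le hP hun (hP.shift hun hP0)
    (Q := fun i => c * Q i) (fun i => ?_) hv (fun i => ?_)
  · change c * Q (i + 1) = _
    rw [hQ, mul_assoc]
  · rw [hQm, hvw, ← hc]
    group

/-! ### A word that goes straight on somewhere determines the kinds -/

/-- The turn of a bi-infinite word after a given edge. -/
def turnAt (u : ℤ → Letter) (i : ℤ) : Fin 8 := turnNum (u i) (u (i + 1))

theorem next_kind {x : ℤ → State} (hx : ∀ i, Follows (x i) (x (i + 1))) (i : ℤ) :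
    (x i).kind.next (turnAt (leftWord x) i) (x (i + 1)).kind = true := (hx i).next

/-- The pairs of kinds that are reached after two sequences over the same word have separated. -/
def Kind.split : Kind → Kind → Bool
  | .A, .B | .B, .A | .A₁ .L, .B | .B, .A₁ .L | .A₂ .L, .B | .B, .A₂ .L
  | .D, .E .R | .E .R, .D | .A₁ .R, .C | .C, .A₁ .R | .A₂ .R, .C₁ | .C₁, .A₂ .R
  | .A, .E .L | .E .L, .A => true
  | _, _ => false

/-- Sequences over one word that have separated never meet again and never go straight on. By
periodicity, a word with a straight turn excludes such a pair. -/
theorem Kind.split_next : ∀ (K K' : Kind) (t : Fin 8) (L L' : Kind), K.next t L = true →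
    K'.next t L' = true → K.split K' = true → t ≠ 4 ∧ L.split L' = true := by
  decide +kernel

theorem Kind.eq_or_split : ∀ (K : Kind) (t : Fin 8) (L L' : Kind), K.next t L = true →
    K.next t L' = true → L = L' ∨ L.split L' = true := by
  decide +kernel

theorem Kind.eq_or_split_of_four : ∀ (K K' L L' : Kind), K.next 4 L = true →
    K'.next 4 L' = true → L = L' ∨ L.split L' = true := by
  decide +kernel

theorem eq_of_periodic {α : Type*} {f g : ℤ → α} {n : ℕ} (hn : n ≠ 0) (hf : ∀ i, f (i + n) = f i)
    (hg : ∀ i, g (i + n) = g i) {o : ℤ} (h : ∀ i, o ≤ i → f i = g i) : f = g := by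
  funext i
  have hpos : (1 : ℤ) ≤ n := by omega
  have h1 := (Function.Periodic.int_mul (f := f) hf |o - i|) i
  have h2 := (Function.Periodic.int_mul (f := g) hg |o - i|) i
  rw [← h1, ← h2]
  refine h _ ?_
  rw [Int.cast_id]
  nlinarith [le_abs_self (o - i), abs_nonneg (o - i)]

/-- A periodic sequence of states goes straight on somewhere. -/
def Straight (x : ℤ → State) : Prop := ∃ o, turnAt (leftWord x) o = 4

theorem eq_of_leftWord_eq {n : ℕ} (hn : n ≠ 0) {x y : ℤ → State} (hx : x ∈ periodic n)
    (hy : y ∈ periodic n) (h : leftWord x = leftWord y) (hs : Straight x) : x = y := by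
  obtain ⟨o, ho⟩ := hs
  have nx := next_kind hx.1
  have ny := next_kind hy.1
  rw [← h] at ny
  have hsplit (i : ℤ) : ¬ (x i).kind.split (y i).kind = true := by
    intro hi
    have hall (m : ℕ) : (x (i + m)).kind.split (y (i + m)).kind = true := by
      induction m with
      | zero => simpa using hi
      | succ m ih =>
        push_cast
        rw [← add_assoc]
        exact (Kind.split_next _ _ _ _ _ (nx _) (ny _) ih).2
    have hper : Function.Periodic (turnAt (leftWord x)) n := fun i => by
      simp only [turnAt]
      rw [leftWord_periodic hx, add_right_comm, leftWord_periodic hx]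
    have h1 := hper.int_mul |i - o| o
    rw [ho, Int.cast_id] at h1
    -- The straight turn recurs periodically, in particular after the place `i` of the separation.
    have h2 : i ≤ o + |i - o| * n := by
      have hpos : (1 : ℤ) ≤ n := by omega
      nlinarith [le_abs_self (i - o), abs_nonneg (i - o)]
    obtain ⟨m, hm⟩ := Int.le.dest h2
    rw [← hm] at h1
    exact (Kind.split_next _ _ _ _ _ (nx _) (ny _) (hall m)).1 h1
  have hk (i : ℤ) (hi : o + 1 ≤ i) : (x i).kind = (y i).kind := by
    induction i, hi using Int.leInduction with
    | base =>
      have h1 := nx o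
      have h2 := ny o
      rw [ho] at h1 h2
      exact (Kind.eq_or_split_of_four _ _ _ _ h1 h2).resolve_right (hsplit _)
    | succ i _ ih =>
      have h1 := nx i
      rw [ih] at h1
      exact (Kind.eq_or_split _ _ _ _ h1 (ny i)).resolve_right (hsplit _)
  exact eq_of_periodic hn hx.2 hy.2 fun i hi => state_ext (hk i hi) (congrFun h i)

/-! ### Kinds for a leftmost word -/

/-- After two rightmost turns before the place `i`, a sequence of octagons begun there closes. -/
inductive Closes (t : ℤ → Fin 8) : ℤ → Prop
  | last (i : ℤ) : t i = 1 → Closes t i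
  | chain (i : ℤ) : t i = 2 → t (i + 1) = 1 → t (i + 2) = 1 → Closes t (i + 3) → Closes t i

theorem closes_iff {t : ℤ → Fin 8} {i : ℤ} :
    Closes t i ↔ t i = 1 ∨ t i = 2 ∧ t (i + 1) = 1 ∧ t (i + 2) = 1 ∧ Closes t (i + 3) := by
  constructor
  · rintro (⟨_, h⟩ | ⟨_, h1, h2, h3, h4⟩)
    · exact .inl h
    · exact .inr ⟨h1, h2, h3, h4⟩
  · rintro (h | ⟨h1, h2, h3, h4⟩)
    · exact .last _ h
    · exact .chain _ h1 h2 h3 h4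

theorem Closes.congr {t : ℤ → Fin 8} {n i : ℤ} (ht : ∀ i, t (i + n) = t i) (h : Closes t i) :
    Closes t (i + n) := by
  induction h with
  | last i h => exact .last _ ((ht i).trans h)
  | chain i h1 h2 h3 _ ih =>
    refine .chain _ ((ht i).trans h1) ?_ ?_ ?_
    · rw [add_right_comm, ht, h2]
    · rw [add_right_comm, ht, h3]
    · rwa [add_right_comm]

theorem closes_add {t : ℤ → Fin 8} {n i : ℤ} (ht : ∀ i, t (i + n) = t i) :
    Closes t (i + n) ↔ Closes t i := by
  refine ⟨fun h => ?_, fun h => h.congr ht⟩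
  have := h.congr (n := -n) fun j => by rw [← ht, neg_add_cancel_right]
  rwa [add_neg_cancel_right] at this

/-- The kind in a given state of the automaton; the truth values say whether two rightmost turns
and then one to the right of straight ahead have just been made, and which octagons close. -/
def Mode.kind : Mode → (e c g f h : Bool) → Kind
  | .right1, _, _, g, _, _ => if g then .C else .A₁ .R
  | .right2, _, c, _, _, _ => if c then .C₁ else .A₂ .R
  | .right3, _, _, _, _, h => if h then .E .R else .D
  | .left1, _, _, _, f, _ => if f then .B else .A₁ .L
  | .left2, _, _, _, f, _ => if f then .B else .A₂ .L
  | .free, e, _, _, f, _ => if f then (if e then .E .L else .B) else .A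

/-- Whether to open an octagon depends on the future turns. With the truth values of this look-ahead
supplied, the choice of kinds by the mode is compatible with the transitions. -/
theorem Mode.kind_next : ∀ (q : Mode) (t : Fin 8) (q' : Mode) (e c' g' f' h' : Bool),
    q.step t = some q' →
    (q.kind e (t == 1 || (t == 2 && f')) (t == 1 && c') (t == 1 && g') (t == 2 && g')).next t
      (q'.kind (q == .right2 && t == 2) c' g' f' h') = true := by
  decide +kernel

-- The automaton gives the modes; the kinds are read from them by looking ahead. `c`, `g` and `f`
-- say that the octagon closes when two, one and no rightmost turns have been made. `Closes` is
-- inductive, so a chain of octagons must really end, and it is invariant under the period.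
open Classical in
theorem exists_of_modes {u : ℤ → Letter} {n : ℕ} (hu : ∀ i, u (i + n) = u i) {q : ℤ → Mode}
    (hq : ∀ i, q (i + n) = q i) (hstep : ∀ i, (q i).step (turnAt u i) = some (q (i + 1))) :
    ∃ x ∈ periodic n, leftWord x = u := by
  set t := turnAt u with ht
  have htn (i : ℤ) : t (i + n) = t i := by
    simp only [ht, turnAt]
    rw [hu, add_right_comm, hu]
  let c (i : ℤ) : Bool := decide (Closes t i)
  let g (i : ℤ) : Bool := t i == 1 && c (i + 1)
  let f (i : ℤ) : Bool := t i == 1 && g (i + 1)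
  let K (i : ℤ) : Kind := (q i).kind (q (i - 1) == .right2 && t (i - 1) == 2) (c i) (g i) (f i)
    (t i == 2 && g (i + 1))
  have hc (i : ℤ) : c i = (t i == 1 || (t i == 2 && f (i + 1))) := by
    rw [Bool.eq_iff_iff]
    simp only [c, f, g, decide_eq_true_eq, Bool.or_eq_true, Bool.and_eq_true, beq_iff_eq]
    rw [closes_iff, add_assoc, add_assoc]
    norm_num
  have hcn (i : ℤ) : c (i + n) = c i := by
    simp only [c, closes_add htn]
  have hgn (i : ℤ) : g (i + n) = g i := by
    simp only [g, htn, add_right_comm i (n : ℤ) 1, hcn]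
  have hfn (i : ℤ) : f (i + n) = f i := by
    simp only [f, htn, add_right_comm i (n : ℤ) 1, hgn]
  refine ⟨fun i => (K i).state (u i), ⟨fun i => ?_, fun i => ?_⟩, funext fun i => leftEdge_state _ _⟩
  · rw [follows_iff, kind_state, kind_state, leftEdge_state, leftEdge_state]
    change (K i).next (t i) _ = true
    have := Mode.kind_next (q i) (t i) (q (i + 1)) (q (i - 1) == .right2 && t (i - 1) == 2)
      (c (i + 1)) (g (i + 1)) (f (i + 1)) (t (i + 1) == 2 && g (i + 1 + 1)) (hstep i)
    simp only [K, add_sub_cancel_right]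
    rw [← hc] at this
    exact this
  · simp only [K, hu, hq, hcn, hgn, hfn, htn, add_sub_right_comm, add_right_comm i (n : ℤ) 1]

theorem Runs.exists_modes {u : ℤ → Letter} {i : ℤ} {m : ℕ} {q : Mode}
    (h : Runs q (u i) (seg u (i + 1) m)) : ∃ f : ℕ → Mode, f 0 = q ∧
      ∀ j < m, (f j).step (turnAt u (i + j)) = some (f (j + 1)) := by
  induction m generalizing i q with
  | zero => exact ⟨fun _ => q, rfl, by simp⟩
  | succ m ih =>
    rw [seg_succ'] at h
    obtain ⟨q', h1, h2⟩ := h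
    obtain ⟨f, hf0, hf⟩ := ih h2
    refine ⟨fun | 0 => q | j + 1 => f j, rfl, fun j hj => ?_⟩
    cases j with
    | zero => simpa [hf0, turnAt] using h1
    | succ j =>
      have := hf j (by omega)
      rwa [add_assoc, add_comm 1] at this

theorem exists_of_tight {w : List Letter} (hw : Tight w) (h0 : w ≠ [])
    (h4 : turnNum (w.getLast h0) (w.head h0) = 4) :
    ∃ x ∈ periodic w.length, p w.length x = ConjClasses.mk (eval w) ∧ Straight x := by
  obtain ⟨u, hu, huw⟩ := exists_periodic_word w
  obtain ⟨m, hm⟩ : ∃ m, w.length = m + 1 :=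
    Nat.exists_eq_succ_of_ne_zero (by simpa [List.length_eq_zero_iff] using h0)
  rw [hm] at hu huw ⊢
  have hlast : turnAt u m = 4 := by
    rw [← h4, turnAt]
    congr 1
    · simp only [← huw, seg_succ, List.getLast_append_singleton, zero_add]
    · simp only [← huw, seg_succ', List.head_cons]
      have := hu 0
      push_cast at this
      rwa [zero_add] at this
  rw [← huw, seg_succ'] at hw
  obtain ⟨f, hf0, hf⟩ := Runs.exists_modes hw
  have hpos : (0 : ℤ) < (m + 1 : ℕ) := by omega
  obtain ⟨x, hx, hxu⟩ := exists_of_modes hu (q := fun i => f (i % (m + 1 : ℕ)).toNat)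
    (fun i => by simp) (fun i => by
      have hper : Function.Periodic (turnAt u) ((m + 1 : ℕ) : ℤ) := fun i => by
        simp only [turnAt]
        rw [hu, add_right_comm, hu]
      have h1 : turnAt u i = turnAt u (i % (m + 1 : ℕ)) := by
        have := hper.int_mul (i / (m + 1 : ℕ)) (i % (m + 1 : ℕ))
        rwa [Int.cast_id, Int.emod_add_ediv_mul] at this
      have h2 := Int.emod_nonneg i hpos.ne'
      have h3 := Int.emod_lt_of_pos i hpos
      obtain ⟨j, hj⟩ := Int.eq_ofNat_of_zero_le h2
      rw [h1, Int.add_emod, hj]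
      rw [hj] at h3
      by_cases hjm : j = m
      · subst hjm
        -- At the seam the word goes straight on; this turn leads from every mode to `free`, where
        -- the run began, so the modes are periodic.
        rw [hlast]
        rcases j with _ | j
        · simp [hf0, Mode.step]
        · have : (((j + 1 : ℕ) : ℤ) + 1 % ((j + 1 + 1 : ℕ) : ℤ)) % ((j + 1 + 1 : ℕ) : ℤ) = 0 := by
            rw [Int.emod_eq_of_lt (a := 1) (by omega) (by omega)]
            exact_mod_cast Nat.mod_self _
          rw [this]
          simp only [Int.toNat_zero, hf0]
          cases f _ <;> rfl
      · have hjl : j < m := by omega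
        have h5 : ((j : ℤ) + 1 % ((m + 1 : ℕ) : ℤ)) % ((m + 1 : ℕ) : ℤ) = (j + 1 : ℕ) := by
          rw [Int.emod_eq_of_lt (a := 1) (by omega) (by omega),
            Int.emod_eq_of_lt (by omega) (by omega)]
          push_cast; rfl
        rw [h5]
        simpa using hf j hjl)
  refine ⟨x, hx, ?_, m, ?_⟩
  · rw [p_eq, hxu, huw]
  · rw [hxu, hlast]

/-! ### Most conjugacy classes are reached -/

theorem turnSum_append (xs : List Letter) (k : Letter) (ys : List Letter) :
    turnSum (xs ++ k :: ys) = turnSum (xs ++ [k]) + turnSum (k :: ys) := by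
  induction xs with
  | nil => simp [turnSum]
  | cons a xs ih =>
    cases xs with
    | nil => simp [turnSum]
    | cons b xs =>
      simp only [List.cons_append, turnSum] at ih ⊢
      omega

/-- The sum of the numbers of the turns in a cyclic word. -/
def cyclicSum (w : List Letter) : ℕ := turnSum (w ++ w.take 1)

theorem cyclicSum_cons (k : Letter) (l : List Letter) : cyclicSum (k :: l) = cyclicSum (l ++ [k]) := by
  cases l with
  | nil => rfl
  | cons a l =>
    have h1 : cyclicSum (k :: a :: l) = (turnNum k a).val + turnSum (a :: l ++ [k]) := by
      simp [cyclicSum, turnSum]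
    have h2 : cyclicSum (a :: l ++ [k]) = turnSum (a :: l ++ k :: [a]) := by
      simp [cyclicSum]
    rw [h1, h2, turnSum_append (a :: l) k [a]]
    simp only [turnSum]
    omega

theorem cyclicSum_append (xs ys : List Letter) : cyclicSum (xs ++ ys) = cyclicSum (ys ++ xs) := by
  induction xs generalizing ys with
  | nil => simp
  | cons a xs ih =>
    rw [List.cons_append, cyclicSum_cons, List.append_assoc, ih, List.append_assoc]
    rfl

theorem mk_eval_append (xs ys : List Letter) :
    ConjClasses.mk (eval (xs ++ ys)) = ConjClasses.mk (eval (ys ++ xs)) := by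
  rw [ConjClasses.mk_eq_mk_iff_isConj, isConj_iff]
  refine ⟨eval ys, ?_⟩
  rw [eval_append, eval_append]
  group

/-- Length at least 5 ensures that the letter before the octagon is not part of it, so that the turn
at the seam is affected at one end only. -/
theorem cyclicSum_flip (s : Letter) (xs ys : List Letter)
    (h : 5 ≤ (xs ++ rightPath s ++ ys).length) :
    cyclicSum (xs ++ leftPath s ++ ys) < cyclicSum (xs ++ rightPath s ++ ys) := by
  cases xs with
  | cons z zs =>
    have := turnSum_flip s (z :: zs) (ys ++ [z])
    simp only [cyclicSum, List.cons_append, List.take_succ_cons, List.take_zero,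
      List.append_assoc] at this ⊢
    omega
  | nil =>
    rcases List.eq_nil_or_concat ys with rfl | ⟨l, y, rfl⟩
    · simp [rightPath_eq] at h
    · have h1 := turnSum_flip_nil s (l ++ [y])
      have h2 := turnNum_leftPath_head s y
      have h3 := turnSum_append (leftPath s ++ l) y [leftSide s 0]
      have h4 := turnSum_append (rightPath s ++ l) y [rightSide s 0]
      have h5 : (leftPath s ++ (l ++ [y])).take 1 = [leftSide s 0] := rfl
      have h6 : (rightPath s ++ (l ++ [y])).take 1 = [rightSide s 0] := rfl
      simp only [cyclicSum, List.nil_append, List.concat_eq_append, h5, h6]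
      simp only [turnSum, List.append_assoc, List.cons_append, List.nil_append] at *
      omega

theorem shortest_of_mem_classes {w : List Letter}
    (h : ConjClasses.mk (eval w) ∈ classes w.length) : Shortest w := fun w' hw' => by
  have h' : wordLength (ConjClasses.mk (eval w)) = w.length := h
  rw [← h']
  exact Nat.sInf_le ⟨w', rfl, by rw [hw']⟩

theorem exists_word {n : ℕ} {C : ConjClasses SurfaceGroup} (h : C ∈ classes n) :
    ∃ w : List Letter, w.length = n ∧ ConjClasses.mk (eval w) = C := by
  have h' : wordLength C = n := h
  have : {k | ∃ w : List Letter, w.length = k ∧ ConjClasses.mk (eval w) = C}.Nonempty := by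
    obtain ⟨g, rfl⟩ := ConjClasses.exists_rep C
    obtain ⟨w, hw⟩ := exists_eval g
    exact ⟨_, w, rfl, by rw [hw]⟩
  obtain ⟨w, h1, h2⟩ := Nat.sInf_mem this
  exact ⟨w, h1.trans h', h2⟩

theorem Shortest.isChain {w : List Letter} (h : Shortest w) :
    w.IsChain fun k k' => turnNum k k' ≠ 0 := by
  rw [List.isChain_iff_forall_rel_of_append_cons_cons]
  rintro k k' xs ys rfl h0
  have hk : k' = inv k := by rw [← turn_turnNum (k := k) (k' := k'), h0]; rfl
  have := h (xs ++ ys) (by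
    have h1 := eval_cancel xs k
    rw [eval_append, eval_append] at *
    rw [show k :: k' :: ys = [k, inv k] ++ ys by rw [hk]; rfl, eval_append, ← mul_assoc, h1])
  simp at this

/-- The words that neither turn back nor go straight on anywhere. -/
def crooked (n : ℕ) : Set (List Letter) :=
  {w | w.length = n ∧ w.IsChain fun k k' => turnNum k k' ≠ 0 ∧ turnNum k k' ≠ 4}

/-- Unless some word of the class is crooked, a word of least cyclic turn sum has a straight turn.
Rotated to start there, it still has no right path by minimality, so it is tight. -/
theorem exists_straight {n : ℕ} (hn : 5 ≤ n) {C : ConjClasses SurfaceGroup} (hC : C ∈ classes n) :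
    (∃ x ∈ periodic n, p n x = C ∧ Straight x) ∨
      ∃ w ∈ crooked n, ConjClasses.mk (eval w) = C := by
  by_cases hw : ∀ w : List Letter, w.length = n → ConjClasses.mk (eval w) = C →
    ¬ w.IsChain fun k k' => turnNum k k' ≠ 4
  swap
  · push Not at hw
    obtain ⟨w, rfl, rfl, hw⟩ := hw
    refine .inr ⟨w, ⟨rfl, ?_⟩, rfl⟩
    have := (shortest_of_mem_classes hC).isChain
    rw [List.isChain_iff_forall_rel_of_append_cons_cons] at *
    exact fun a b xs ys h => ⟨this h, hw h⟩
  left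
  obtain ⟨w, ⟨rfl, rfl⟩, hmin⟩ := (measure cyclicSum).wf.has_min
    {w : List Letter | w.length = n ∧ ConjClasses.mk (eval w) = C} (exists_word hC)
  have hch := hw w rfl rfl
  rw [List.isChain_iff_forall_rel_of_append_cons_cons] at hch
  push Not at hch
  obtain ⟨k, k', xs, ys, he, h4⟩ := hch
  have he' : w = (xs ++ [k]) ++ (k' :: ys) := by rw [he]; simp
  set w₂ := (k' :: ys) ++ (xs ++ [k]) with hw₂
  have hl : w₂.length = w.length := by rw [he', hw₂]; simp; omega
  have hcl : ConjClasses.mk (eval w₂) = ConjClasses.mk (eval w) := by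
    rw [he', hw₂, mk_eval_append]
  have hcs : cyclicSum w₂ = cyclicSum w := by rw [he', hw₂, cyclicSum_append]
  have hne : w₂ ≠ [] := by simp [hw₂]
  rw [← hl, ← hcl] at hC ⊢
  refine exists_of_tight (Shortest.tight (shortest_of_mem_classes hC) ?_) hne ?_
  · intro s as bs h
    refine hmin (as ++ leftPath s ++ bs) ⟨?_, ?_⟩ ?_
    · rw [length_flip, ← h, hl]
    · rw [eval_flip, ← h, hcl]
    · change cyclicSum _ < cyclicSum _
      rw [← hcs, h]
      exact cyclicSum_flip _ _ _ (by rw [← h, hl]; exact hn)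
  · rw [← h4]
    congr 1
    simp [hw₂]

/-! ### Counting paths by weights -/

section Paths

variable {α : Type*} [DecidableEq α]

/-- The paths of a given length from a given vertex, without this vertex. -/
def paths (succ : α → Finset α) : ℕ → α → Finset (List α)
  | 0, _ => {[]}
  | m + 1, a => (succ a).biUnion fun b => (paths succ m b).image (List.cons b)

theorem mem_paths {succ : α → Finset α} {m : ℕ} {a : α} {l : List α} :
    l ∈ paths succ m a ↔ l.length = m ∧ (a :: l).IsChain (fun a b => b ∈ succ a) := by
  induction m generalizing a l with
  | zero => simp +contextual [paths, List.length_eq_zero_iff]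
  | succ m ih =>
    cases l with
    | nil => simp [paths]
    | cons b l => simp [paths, ih, List.isChain_cons_cons]; tauto

theorem card_paths_succ (succ : α → Finset α) (m : ℕ) (a : α) :
    (paths succ (m + 1) a).card = ∑ b ∈ succ a, (paths succ m b).card := by
  rw [paths, Finset.card_biUnion]
  · exact Finset.sum_congr rfl fun b _ => Finset.card_image_of_injective _ (List.cons_injective)
  · intro b _ c _ hbc
    refine Finset.disjoint_left.2 fun l hl hl' => ?_
    simp only [Finset.mem_image] at hl hl'
    obtain ⟨x, _, rfl⟩ := hl
    obtain ⟨y, _, h⟩ := hl'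
    exact hbc (List.cons.inj h).1.symm

/-- Perron–Frobenius comparison: a positive weight that the transfer matrix multiplies by at most `d
/ c` bounds the growth rate of paths. `le_card_paths` is the reverse estimate. -/
theorem card_paths_le {succ : α → Finset α} {v : α → ℕ} {c d : ℕ} (hv : ∀ a, 1 ≤ v a)
    (h : ∀ a, c * ∑ b ∈ succ a, v b ≤ d * v a) (m : ℕ) (a : α) :
    c ^ m * (paths succ m a).card ≤ d ^ m * v a := by
  induction m generalizing a with
  | zero => simpa [paths] using hv a
  | succ m ih =>
    rw [card_paths_succ]
    calc c ^ (m + 1) * ∑ b ∈ succ a, (paths succ m b).card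
        = c * ∑ b ∈ succ a, c ^ m * (paths succ m b).card := by rw [← Finset.mul_sum]; ring
      _ ≤ c * ∑ b ∈ succ a, d ^ m * v b := Nat.mul_le_mul_left _ (Finset.sum_le_sum fun b _ => ih b)
      _ = d ^ m * (c * ∑ b ∈ succ a, v b) := by rw [← Finset.mul_sum]; ring
      _ ≤ d ^ m * (d * v a) := Nat.mul_le_mul_left _ (h a)
      _ = d ^ (m + 1) * v a := by ring

theorem le_card_paths {succ : α → Finset α} {v : α → ℕ} {c d M : ℕ} (hv : ∀ a, v a ≤ M)
    (h : ∀ a, d * v a ≤ c * ∑ b ∈ succ a, v b) (m : ℕ) (a : α) :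
    d ^ m * v a ≤ M * (c ^ m * (paths succ m a).card) := by
  induction m generalizing a with
  | zero => simpa [paths] using hv a
  | succ m ih =>
    rw [card_paths_succ]
    calc d ^ (m + 1) * v a = d ^ m * (d * v a) := by ring
      _ ≤ d ^ m * (c * ∑ b ∈ succ a, v b) := Nat.mul_le_mul_left _ (h a)
      _ = c * ∑ b ∈ succ a, d ^ m * v b := by rw [← Finset.mul_sum]; ring
      _ ≤ c * ∑ b ∈ succ a, M * (c ^ m * (paths succ m b).card) :=
        Nat.mul_le_mul_left _ (Finset.sum_le_sum fun b _ => ih b)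
      _ = M * (c ^ (m + 1) * ∑ b ∈ succ a, (paths succ m b).card) := by
        rw [← Finset.mul_sum, ← Finset.mul_sum]; ring

end Paths

/-! ### Counting states -/

/-- States as kinds with a turn number. -/
def stateEquiv (k : Letter) : State ≃ Fin 8 × Kind where
  toFun J := (turnNum k (leftEdge J), J.kind)
  invFun x := x.2.state (turn k x.1)
  left_inv J := by simp only [turn_turnNum, state_kind_leftEdge]
  right_inv x := by simp only [leftEdge_state, kind_state, turnNum_turn]

instance : Fintype State := Fintype.ofEquiv _ (stateEquiv (.a, true)).symm

theorem card_state : Fintype.card State = 88 := by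
  rw [Fintype.card_congr (stateEquiv (.a, true))]
  rfl

instance (J K : State) : Decidable (Follows J K) := decidable_of_iff' _ follows_iff

/-- The successors of a state depend, up to the turn number, only on its kind; the weight
inequalities become checks on eleven kinds. -/
theorem sum_follows (J : State) (f : Fin 8 → Kind → Prop) [∀ t K, Decidable (f t K)]
    (v : Kind → ℕ) :
    ∑ K with Follows J K ∧ f (turnNum (leftEdge J) (leftEdge K)) K.kind, v K.kind =
      ∑ x : Fin 8 × Kind with J.kind.next x.1 x.2 = true ∧ f x.1 x.2, v x.2 := by
  rw [Finset.sum_filter, Finset.sum_filter, Fintype.sum_equiv (stateEquiv (leftEdge J))]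
  intro K
  simp only [stateEquiv, Equiv.coe_fn_mk, follows_iff]
  congr

/-- A set of periodic sequences that follow the given transitions. -/
theorem ncard_le_sum_paths {n : ℕ} (hn : n ≠ 0) {succ : State → Finset State}
    {X : Set (ℤ → State)} (hX : ∀ x ∈ X, ∀ i, x (i + 1) ∈ succ (x i))
    (hXn : ∀ x ∈ X, ∀ i, x (i + n) = x i) :
    X.Finite ∧ X.ncard ≤ ∑ J, (paths succ n J).card := by
  rw [← Finset.card_sigma, ← Set.ncard_coe_finset]
  let f (x : ℤ → State) : Σ _ : State, List State :=
    ⟨x 0, (List.range n).map fun j : ℕ => x (j + 1)⟩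
  have hmaps : ∀ x ∈ X, f x ∈ ((Finset.univ.sigma fun J => paths succ n J : Finset _) : Set _) := by
    intro x hx
    simp only [Finset.coe_sigma, f, Set.mem_sigma_iff, Finset.coe_univ, Set.mem_univ, true_and,
      Finset.mem_coe, mem_paths]
    refine ⟨by simp, ?_⟩
    rw [List.isChain_iff_getElem]
    intro i hi
    cases i with
    | zero => simpa using hX x hx 0
    | succ i => simpa using hX x hx (i + 1)
  have hinj : Set.InjOn f X := by
    intro x hx y hy h
    have h2 := eq_of_heq (Sigma.mk.inj h).2
    rw [List.map_inj_left] at h2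
    funext i
    have hpos : (0 : ℤ) < n := by omega
    have red (z : ℤ → State) (hz : ∀ i, z (i + n) = z i) :
        z i = z (((i - 1) % n).toNat + 1) := by
      rw [Int.toNat_of_nonneg (Int.emod_nonneg _ hpos.ne')]
      have := (Function.Periodic.int_mul (f := z) hz ((i - 1) / n)) ((i - 1) % n + 1)
      rw [← this, Int.cast_id, add_right_comm, Int.emod_add_ediv_mul, sub_add_cancel]
    rw [red x (hXn x hx), red y (hXn y hy)]
    refine h2 _ ?_
    have := Int.emod_lt_of_pos (i - 1) hpos
    rw [List.mem_range]
    omega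
  exact ⟨Set.Finite.of_injOn hmaps hinj (Finset.finite_toSet _),
    Set.ncard_le_ncard_of_injOn f hmaps hinj (Finset.finite_toSet _)⟩

/-- No state has more than 13 successors. The base 16 is rough, but a square: half the period then
gives 4^n. -/
theorem periodic_finite_and_ncard_le {n : ℕ} (hn : n ≠ 0) :
    (periodic n).Finite ∧ (periodic n).ncard ≤ 88 * 16 ^ n := by
  obtain ⟨h1, h2⟩ := ncard_le_sum_paths hn (X := periodic n)
    (succ := fun J => {K | Follows J K ∧ True}) (fun x hx i => by simpa using hx.1 i)
    fun x hx => hx.2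
  refine ⟨h1, h2.trans ?_⟩
  rw [← card_state, ← smul_eq_mul, ← Finset.card_univ]
  refine Finset.sum_le_card_nsmul _ _ _ fun J _ => ?_
  have := card_paths_le (succ := fun J => {K | Follows J K ∧ True}) (v := fun _ => 1) (c := 1)
    (d := 16) (fun _ => le_rfl) (fun J => by
      rw [sum_follows J (fun _ _ => True) (fun _ => 1)]
      generalize J.kind = K
      revert K
      decide +kernel) n J
  simpa using this

/-- Weights for the sequences that go straight on nowhere. -/
def Kind.weight : Kind → ℕ
  | .A | .A₁ _ => 16
  | .A₂ _ | .D => 14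
  | .B | .C | .E _ => 1
  | .C₁ => 3

theorem ncard_not_straight_le {n : ℕ} (hn : n ≠ 0) :
    5 ^ n * {x ∈ periodic n | ¬ Straight x}.ncard ≤ 1408 * 32 ^ n := by
  obtain ⟨-, h2⟩ := ncard_le_sum_paths hn (X := {x ∈ periodic n | ¬ Straight x})
    (succ := fun J => {K | Follows J K ∧ turnNum (leftEdge J) (leftEdge K) ≠ 4})
    (fun x hx i => by
      simp only [Finset.mem_filter, Finset.mem_univ, true_and]
      exact ⟨hx.1.1 i, fun h => hx.2 ⟨i, h⟩⟩)
    fun x hx => hx.1.2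
  refine (Nat.mul_le_mul_left _ h2).trans ?_
  -- 1408 = 88 · 16: the number of states times the largest weight.
  rw [Finset.mul_sum, show 1408 * 32 ^ n = 88 * (32 ^ n * 16) by ring, ← card_state, ← smul_eq_mul,
    ← Finset.card_univ]
  refine Finset.sum_le_card_nsmul _ _ _ fun J _ => ?_
  refine (card_paths_le (v := fun J => J.kind.weight) (c := 5) (d := 32) ?_ (fun J => ?_) n J).trans ?_
  · intro J
    generalize J.kind = K
    revert K
    decide
  · rw [sum_follows J (fun t _ => t ≠ 4)]
    generalize J.kind = K
    revert K
    decide +kernel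
  · gcongr
    generalize J.kind = K
    revert K
    decide

/-- Weights for the sequences in single edges. -/
def Kind.weight' : Kind → ℕ
  | .A => 4
  | .A₁ _ => 3
  | _ => 0

theorem exists_return : ∀ k k' : Letter, ∃ t t' : Fin 8, (2 ≤ t ∧ t ≤ 6) ∧ (2 ≤ t' ∧ t' ≤ 6) ∧
    turn (turn k t) t' = k' := by
  decide +kernel

theorem exists_periodic_states {J : State} {l : List State}
    (h : (J :: l).IsChain Follows) (h' : Follows ((J :: l).getLast (List.cons_ne_nil _ _)) J) :
    ∃ x ∈ periodic (l.length + 1), ∀ i (hi : i < l.length), x (i + 1 : ℕ) = l[i] := by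
  set n := l.length + 1 with hn
  have hpos : (0 : ℤ) < n := by omega
  refine ⟨fun i => (J :: l).getD (i % n).toNat J, ⟨fun i => ?_, fun i => by simp⟩, fun i hi => ?_⟩
  · have h2 := Int.emod_nonneg i hpos.ne'
    have h3 := Int.emod_lt_of_pos i hpos
    obtain ⟨j, hj⟩ := Int.eq_ofNat_of_zero_le h2
    dsimp only
    rw [Int.add_emod, hj]
    rw [hj] at h3
    rw [List.isChain_iff_getElem] at h
    by_cases hjl : j = l.length
    · have h5 : ((j : ℤ) + 1 % (n : ℤ)) % (n : ℤ) = 0 := by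
        rw [Int.add_emod_emod, hjl, hn]
        exact_mod_cast Nat.mod_self _
      rw [h5]
      rw [List.getLast_eq_getElem] at h'
      simpa [hjl] using h'
    · have h5 : ((j : ℤ) + 1 % (n : ℤ)) % (n : ℤ) = (j + 1 : ℕ) := by
        rw [Int.add_emod_emod, Int.emod_eq_of_lt (by omega) (by omega)]
        push_cast; rfl
      rw [h5, Int.toNat_natCast, Int.toNat_natCast, List.getD_eq_getElem _ _ (by simp; omega),
        List.getD_eq_getElem _ _ (by simp; omega)]
      exact h j (by simp; omega)
  · have : ((i + 1 : ℕ) : ℤ) % n = (i + 1 : ℕ) := Int.emod_eq_of_lt (by omega) (by omega)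
    dsimp only
    rw [this]
    simp [hi]

/-- Only single-edge states of kinds A and A' are used. The weights 4 and 3 give growth 13/2, since
5 · 4 + 2 · 3 = 26. Two further A states close the sequence up, whence the period `m + 2`. -/
theorem le_ncard_periodic (m : ℕ) : 13 ^ m ≤ 2 ^ m * (periodic (m + 2)).ncard := by
  let J₀ : State := .A (.a, true)
  let succ (J : State) : Finset State := {K | Follows J K ∧ (K.kind = .A ∨ ∃ h, K.kind = .A₁ h)}
  have h1 := le_card_paths (succ := succ) (v := fun J => J.kind.weight') (c := 2) (d := 13) (M := 4)
    (fun J => by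
      generalize J.kind = K
      revert K
      decide)
    (fun J => by
      rw [sum_follows J (fun _ K => K = .A ∨ ∃ h, K = .A₁ h)]
      generalize J.kind = K
      revert K
      decide +kernel) m J₀
  have h2 : (paths succ m J₀).card ≤ (periodic (m + 2)).ncard := by
    rw [← Set.ncard_coe_finset]
    have key : ∀ l ∈ paths succ m J₀, ∃ x ∈ periodic (m + 2),
        (List.range m).map (fun i => x (i + 1 : ℕ)) = l := by
      intro l hl
      obtain ⟨rfl, hch⟩ := mem_paths.1 hl
      have hkind : ∀ J ∈ J₀ :: l, J.kind = .A ∨ ∃ h, J.kind = .A₁ h := by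
        intro J hJ
        obtain ⟨i, hi, rfl⟩ := List.getElem_of_mem hJ
        cases i with
        | zero => exact .inl rfl
        | succ i =>
          have := List.isChain_iff_getElem.1 hch i hi
          exact (Finset.mem_filter.1 this).2.2
      have hlast := hkind _ (List.getLast_mem (List.cons_ne_nil J₀ l))
      set M := (J₀ :: l).getLast (List.cons_ne_nil J₀ l) with hM
      obtain ⟨t, t', ht, ht', hk⟩ := exists_return (leftEdge M) (.a, true)
      have hf : Follows M (.A (turn (leftEdge M) t)) := by
        have : M.kind.next t .A = true := by
          rcases hlast with h | ⟨h, h'⟩ <;> rw [‹M.kind = _›] <;> simpa [Kind.next] using ht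
        have := follows_of_next this (leftEdge M)
        rwa [state_kind_leftEdge] at this
      have hf' : Follows (.A (turn (leftEdge M) t)) J₀ := by
        have := Follows.A_A (turn (leftEdge M) t) t' ht'.1 ht'.2
        rwa [hk] at this
      obtain ⟨x, hx, hxl⟩ := exists_periodic_states (J := J₀)
        (l := l ++ [.A (turn (leftEdge M) t)]) (by
          rw [← List.cons_append, List.isChain_append]
          refine ⟨hch.imp fun _ _ h => (Finset.mem_filter.1 h).2.1, by simp, ?_⟩
          intro a ha b hb
          rw [List.getLast?_eq_some_getLast (List.cons_ne_nil J₀ l), ← hM] at ha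
          simp only [Option.mem_def, Option.some.injEq, List.head?_cons] at ha hb
          rw [← ha, ← hb]
          exact hf) (by simpa using hf')
      refine ⟨x, by simpa using hx, ?_⟩
      refine List.ext_getElem (by simp) fun i hi hi' => ?_
      have := hxl i (by simp; omega)
      simpa [List.getElem_append, hi'] using this
    refine (Set.ncard_le_ncard (t := (fun x : ℤ → State =>
      (List.range m).map fun i => x (i + 1 : ℕ)) '' periodic (m + 2)) (fun l hl => ?_)
      ((periodic_finite_and_ncard_le (by omega)).1.image _)).trans
      (Set.ncard_image_le (periodic_finite_and_ncard_le (by omega)).1)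
    obtain ⟨x, hx, hxl⟩ := key l hl
    exact ⟨x, hx, hxl⟩
  have h3 : J₀.kind.weight' = 4 := rfl
  simp only [h3] at h1
  have := Nat.mul_le_mul_left (2 ^ m) h2
  omega

/-- A least period smaller than the given one. -/
def Imprimitive (n : ℕ) (x : ℤ → State) : Prop := ∃ s : ℕ, 0 < s ∧ s < n ∧ ∀ i, x (i + s) = x i

theorem ncard_imprimitive_le (n : ℕ) :
    {x ∈ periodic n | Imprimitive n x}.ncard ≤ 88 * n * 4 ^ n := by
  have hsub : {x ∈ periodic n | Imprimitive n x} ⊆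
      ⋃ s ∈ Finset.Icc 1 (n / 2), periodic s := by
    rintro x ⟨hx, s, hs, hsn, h⟩
    simp only [Set.mem_iUnion, Finset.mem_Icc]
    -- If `s` is a period then so is `n - s`, and one of the two is at most `n / 2`.
    by_cases hs2 : s ≤ n / 2
    · exact ⟨s, ⟨hs, hs2⟩, hx.1, h⟩
    · refine ⟨n - s, by omega, hx.1, fun i => ?_⟩
      rw [← h, Nat.cast_sub hsn.le, add_assoc, sub_add_cancel, hx.2]
  refine (Set.ncard_le_ncard hsub (Set.Finite.biUnion (Finset.finite_toSet _) fun s hs =>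
    (periodic_finite_and_ncard_le (by have := (Finset.mem_Icc.1 hs).1; omega)).1)).trans ?_
  refine (Finset.set_ncard_biUnion_le _ _).trans ?_
  refine (Finset.sum_le_card_nsmul _ _ (88 * 4 ^ n) fun s hs => ?_).trans ?_
  · have hs := Finset.mem_Icc.1 hs
    refine (periodic_finite_and_ncard_le (by omega)).2.trans ?_
    rw [show 16 = 4 ^ 2 by rfl, ← pow_mul]
    gcongr
    · norm_num
    · omega
  · rw [Nat.card_Icc, smul_eq_mul, show 88 * n * 4 ^ n = n * (88 * 4 ^ n) by ring]
    gcongr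
    omega

theorem crooked_finite_and_ncard_le (n : ℕ) : (crooked n).Finite ∧ (crooked n).ncard ≤ 8 * 6 ^ n := by
  let succ (k : Letter) : Finset Letter := {k' | turnNum k k' ≠ 0 ∧ turnNum k k' ≠ 4}
  cases n with
  | zero =>
    have : crooked 0 ⊆ {[]} := fun w hw => List.eq_nil_of_length_eq_zero hw.1
    refine ⟨(Set.finite_singleton _).subset this, ?_⟩
    exact (Set.ncard_le_ncard this (Set.finite_singleton _)).trans (by simp)
  | succ m =>
    have hsub : crooked (m + 1) ⊆ ((Finset.univ.biUnion fun k =>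
        (paths succ m k).image (List.cons k) : Finset (List Letter)) : Set (List Letter)) := by
      rintro w ⟨hl, hw⟩
      cases w with
      | nil => simp at hl
      | cons k w =>
        simp only [Finset.coe_biUnion, Finset.coe_univ, Set.mem_univ, Set.iUnion_true,
          Finset.coe_image, Set.mem_iUnion]
        refine ⟨k, w, mem_paths.2 ⟨by simpa using hl, hw.imp fun a b h => ?_⟩, rfl⟩
        simpa [succ] using h
    refine ⟨(Finset.finite_toSet _).subset hsub,
      (Set.ncard_le_ncard hsub (Finset.finite_toSet _)).trans ?_⟩
    rw [Set.ncard_coe_finset]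
    refine Finset.card_biUnion_le.trans ?_
    have h8 : (Finset.univ : Finset Letter).card = 8 := rfl
    rw [← h8, ← smul_eq_mul]
    refine Finset.sum_le_card_nsmul _ _ _ fun k _ => Finset.card_image_le.trans ?_
    have := card_paths_le (succ := succ) (v := fun _ => 1) (c := 1) (d := 6) (fun _ => le_rfl)
      (by decide +kernel) m k
    simp only [one_pow, one_mul, mul_one] at this
    exact this.trans (Nat.pow_le_pow_right (by norm_num) (by omega))

/-! ### The fibres -/

theorem mk_eval_seg {u : ℤ → Letter} {n : ℕ} (hu : ∀ i, u (i + n) = u i) (s : ℤ) :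
    ConjClasses.mk (eval (seg u s n)) = ConjClasses.mk (eval (seg u 0 n)) := by
  have h (i : ℤ) : ConjClasses.mk (eval (seg u (i + 1) n)) = ConjClasses.mk (eval (seg u i n)) := by
    cases n with
    | zero => rfl
    | succ m =>
      have h1 : u (i + 1 + m) = u i := by
        rw [← hu i]
        push_cast
        rw [add_assoc, add_comm (1 : ℤ)]
      rw [seg_succ, seg_succ', h1, mk_eval_append, List.singleton_append]
  induction s using Int.induction_on with
  | zero => rfl
  | succ i ih => rw [h, ih]
  | pred i ih => rw [← ih, ← h, sub_add_cancel]

/-- The sequence shifted to the left. -/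
def shift (s : ℤ) (x : ℤ → State) (i : ℤ) : State := x (i + s)

theorem leftWord_shift (s : ℤ) (x : ℤ → State) (i : ℤ) :
    leftWord (shift s x) i = leftWord x (i + s) := rfl

theorem shift_mem_periodic {n : ℕ} {x : ℤ → State} (hx : x ∈ periodic n) (s : ℤ) :
    shift s x ∈ periodic n := by
  refine ⟨fun i => ?_, fun i => ?_⟩
  · simp only [shift]
    rw [add_right_comm]
    exact hx.1 _
  · simp only [shift]
    rw [add_right_comm, hx.2]

theorem p_shift {n : ℕ} {x : ℤ → State} (hx : x ∈ periodic n) (s : ℤ) :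
    p n (shift s x) = p n x := by
  rw [p_eq, p_eq, ← mk_eval_seg (leftWord_periodic hx) s]
  simp only [seg, leftWord_shift, zero_add, add_comm s]

theorem Straight.shift {x : ℤ → State} (hx : Straight x) (s : ℤ) : Straight (shift s x) := by
  obtain ⟨o, ho⟩ := hx
  refine ⟨o - s, ?_⟩
  rw [turnAt, leftWord_shift, leftWord_shift, sub_add_cancel, add_right_comm, sub_add_cancel, ← ho]
  rfl

theorem Imprimitive.of_shift {n : ℕ} {x : ℤ → State} {s : ℤ} (h : Imprimitive n (shift s x)) :
    Imprimitive n x := by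
  obtain ⟨m, h0, hn, h⟩ := h
  refine ⟨m, h0, hn, fun i => ?_⟩
  have := h (i - s)
  simp only [Snake.shift] at this
  rwa [add_right_comm, sub_add_cancel] at this

/-- The sequences of period `n`, and of no smaller one, that go straight on somewhere. -/
def good (n : ℕ) : Set (ℤ → State) := {x ∈ periodic n | Straight x ∧ ¬ Imprimitive n x}

theorem shift_mem_good {n : ℕ} {x : ℤ → State} (hx : x ∈ good n) (s : ℤ) : shift s x ∈ good n :=
  ⟨shift_mem_periodic hx.1 s, hx.2.1.shift s, fun h => hx.2.2 h.of_shift⟩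

/-- The word of `y` is a shift of that of `x`, and the straight turn forces the states to agree as
well. -/
theorem fiber_eq {n : ℕ} (hn : n ≠ 0) {x : ℤ → State} (hx : x ∈ good n) :
    {y ∈ periodic n | p n y = p n x} = (fun s : ℕ => shift s x) '' Finset.range n := by
  ext y
  constructor
  · rintro ⟨hy, h⟩
    rw [p_eq, p_eq] at h
    obtain ⟨o, ho⟩ := hx.2.1
    obtain ⟨s, hs⟩ := (tightSeq_leftWord hx.1.1).exists_shift hn (leftWord_periodic hx.1)
      (tightSeq_leftWord hy.1) (leftWord_periodic hy) h.symm
      ⟨o + 1, by rw [← ho, turnAt, add_sub_cancel_right]⟩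
    have hxy : x = shift s y := eq_of_leftWord_eq hn hx.1 (shift_mem_periodic hy s)
      (funext fun i => (hs i).symm) hx.2.1
    have hpos : (0 : ℤ) < n := by omega
    refine ⟨(-s % n).toNat, ?_, funext fun i => ?_⟩
    · have := Int.emod_lt_of_pos (-s) hpos
      rw [Finset.mem_coe, Finset.mem_range]
      omega
    · rw [hxy]
      simp only [shift]
      rw [Int.toNat_of_nonneg (Int.emod_nonneg _ hpos.ne')]
      have := (Function.Periodic.int_mul (f := y) hy.2 (-s / n)) (i + -s % n + s)
      rw [← this, Int.cast_id]
      congr 1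
      have := Int.emod_add_ediv_mul (-s) n
      linarith
  · rintro ⟨s, _, rfl⟩
    exact ⟨shift_mem_periodic hx.1 s, p_shift hx.1 s⟩

theorem ncard_fiber {n : ℕ} (hn : n ≠ 0) {x : ℤ → State} (hx : x ∈ good n) :
    {y ∈ periodic n | p n y = p n x}.ncard = n := by
  rw [fiber_eq hn hx, Set.InjOn.ncard_image, Set.ncard_coe_finset, Finset.card_range]
  have key (s t : ℕ) (ht : t < n) (hlt : s < t) (h : shift s x = shift t x) : False := by
    refine hx.2.2 ⟨t - s, by omega, by omega, fun i => ?_⟩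
    have := congrFun h (i - s)
    simp only [shift] at this
    rw [sub_add_cancel] at this
    rw [this, Nat.cast_sub hlt.le]
    congr 1
    ring
  intro s hs t ht h
  simp only [Finset.coe_range, Set.mem_Iio] at hs ht
  rcases lt_trichotomy s t with hlt | hlt | hlt
  · exact (key s t ht hlt h).elim
  · exact hlt
  · exact (key t s hs hlt h.symm).elim

theorem mem_good_of_p_eq {n : ℕ} (hn : n ≠ 0) {x y : ℤ → State} (hx : x ∈ good n)
    (hy : y ∈ periodic n) (h : p n y = p n x) : y ∈ good n := by
  have : y ∈ {y ∈ periodic n | p n y = p n x} := ⟨hy, h⟩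
  rw [fiber_eq hn hx] at this
  obtain ⟨s, _, rfl⟩ := this
  exact shift_mem_good hx s

theorem classes_subset {n : ℕ} (hn : 5 ≤ n) :
    classes n ⊆ p n '' good n ∪ (p n '' (periodic n \ good n) ∪
      (fun w => ConjClasses.mk (eval w)) '' crooked n) := by
  intro C hC
  rcases exists_straight hn hC with ⟨x, hx, h, hs⟩ | ⟨w, hw, h⟩
  · by_cases hxg : x ∈ good n
    · exact .inl ⟨x, hxg, h⟩
    · exact .inr (.inl ⟨x, ⟨hx, hxg⟩, h⟩)
  · exact .inr (.inr ⟨w, hw, h⟩)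

theorem classes_finite {n : ℕ} (hn : 5 ≤ n) : (classes n).Finite := by
  have h := (periodic_finite_and_ncard_le (show n ≠ 0 by omega)).1
  exact (((h.subset fun x hx => hx.1).image _).union (((h.subset Set.sdiff_subset).image _).union
    ((crooked_finite_and_ncard_le n).1.image _))).subset (classes_subset hn)

/-! ### Comparing uniform measures -/

/-- `G` is a union of whole fibres of size `n`, so the uniform measure on `G` pushes forward to that
on its image. Passing from `G` to `J` and from the image to `F` costs the missing fractions. -/
theorem abs_card_div_sub_le {α β : Type*} [DecidableEq β] {J G : Finset α} {F S : Finset β}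
    {f : α → β} {n : ℕ} (hn : n ≠ 0) (hGJ : G ⊆ J) (hGn : G.Nonempty) (hf : ∀ x ∈ J, f x ∈ F)
    (hfib : ∀ x ∈ G, {y ∈ J | f y = f x}.card = n)
    (hG : ∀ x ∈ G, ∀ y ∈ J, f y = f x → y ∈ G) :
    |({x ∈ J | f x ∈ S}.card : ℝ) / J.card - ((F ∩ S).card : ℝ) / F.card| ≤
      2 * (((J.card : ℝ) - G.card) / J.card + ((F.card : ℝ) - (G.image f).card) / F.card) := by
  classical
  have hcount (T : Finset β) : {x ∈ G | f x ∈ T}.card = n * (G.image f ∩ T).card := by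
    rw [Finset.card_eq_sum_card_fiberwise (f := f) (t := G.image f ∩ T), mul_comm,
      ← smul_eq_mul, Finset.sum_const_nat (m := n)]
    · rfl
    · intro C hC
      obtain ⟨hC, hCT⟩ := Finset.mem_inter.1 hC
      obtain ⟨x, hx, rfl⟩ := Finset.mem_image.1 hC
      rw [← hfib x hx]
      congr 1
      ext y
      simp only [Finset.mem_filter]
      exact ⟨fun h => ⟨hGJ h.1.1, h.2⟩, fun h => ⟨⟨hG x hx y h.1 h.2, h.2 ▸ hCT⟩, h.2⟩⟩
    · intro x hx
      have := Finset.mem_filter.1 hx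
      exact Finset.mem_inter.2 ⟨Finset.mem_image_of_mem _ this.1, this.2⟩
  have hFG : G.image f ⊆ F := Finset.image_subset_iff.2 fun x hx => hf x (hGJ hx)
  have hg : G.card = n * (G.image f).card := by
    have := hcount (G.image f)
    rwa [Finset.inter_self, Finset.filter_true_of_mem fun x hx => Finset.mem_image_of_mem _ hx]
      at this
  have h1 : {x ∈ J | f x ∈ S}.card ≤ {x ∈ G | f x ∈ S}.card + (J.card - G.card) := by
    rw [← Finset.card_sdiff_of_subset hGJ]
    refine (Finset.card_le_card ?_).trans (Finset.card_union_le _ _)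
    intro x hx
    simp only [Finset.mem_union, Finset.mem_filter, Finset.mem_sdiff] at hx ⊢
    tauto
  have h2 : {x ∈ G | f x ∈ S}.card ≤ {x ∈ J | f x ∈ S}.card :=
    Finset.card_le_card (Finset.filter_subset_filter _ hGJ)
  have h3 : (F ∩ S).card ≤ (G.image f ∩ S).card + (F.card - (G.image f).card) := by
    rw [← Finset.card_sdiff_of_subset hFG]
    refine (Finset.card_le_card ?_).trans (Finset.card_union_le _ _)
    intro x hx
    simp only [Finset.mem_union, Finset.mem_inter, Finset.mem_sdiff] at hx ⊢
    tauto
  have h4 : (G.image f ∩ S).card ≤ (F ∩ S).card :=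
    Finset.card_le_card (Finset.inter_subset_inter_right hFG)
  have h5 : (G.image f ∩ S).card ≤ (G.image f).card := Finset.card_le_card Finset.inter_subset_left
  rw [hcount] at h1 h2
  have h6 := Finset.card_le_card hGJ
  have h7 := Finset.card_le_card hFG
  have hm : 0 < (G.image f).card := Finset.card_pos.2 (hGn.image f)
  generalize {x ∈ J | f x ∈ S}.card = A at *
  generalize (F ∩ S).card = B at *
  generalize (G.image f ∩ S).card = s at *
  generalize (G.image f).card = m at *
  rw [hg] at h1 h6 ⊢
  generalize J.card = a at *
  generalize F.card = b at *
  have hn' : 0 < n := Nat.pos_of_ne_zero hn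
  have ha : (0 : ℝ) < a := by
    have : 0 < n * m := Nat.mul_pos hn' hm
    exact_mod_cast this.trans_le h6
  have hb : (0 : ℝ) < b := by exact_mod_cast hm.trans_le h7
  have h1' : (A : ℝ) ≤ n * s + (a - n * m) := by
    have : A + n * m ≤ n * s + a := by omega
    have : (A : ℝ) + n * m ≤ n * s + a := by exact_mod_cast this
    linarith
  have h2' : (n : ℝ) * s ≤ A := by exact_mod_cast h2
  have h3' : (B : ℝ) ≤ s + (b - m) := by
    have : B + m ≤ s + b := by omega
    have : (B : ℝ) + m ≤ s + b := by exact_mod_cast this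
    linarith
  have h4' : (s : ℝ) ≤ B := by exact_mod_cast h4
  have hm' : (0 : ℝ) < m := by exact_mod_cast hm
  have hn1 : (0 : ℝ) < n := by exact_mod_cast hn'
  have h6' : (n : ℝ) * m ≤ a := by exact_mod_cast h6
  have h7' : (m : ℝ) ≤ b := by exact_mod_cast h7
  obtain ⟨r, hr⟩ : ∃ r : ℝ, r = s / m := ⟨_, rfl⟩
  have hr0 : 0 ≤ r := by rw [hr]; positivity
  have hr1 : r ≤ 1 := by
    rw [hr, div_le_one hm']
    exact_mod_cast h5
  have hs : (s : ℝ) = r * m := by rw [hr]; field_simp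
  obtain ⟨α, hα⟩ : ∃ α : ℝ, α = ((a : ℝ) - n * m) / a := ⟨_, rfl⟩
  obtain ⟨γ, hγ⟩ : ∃ γ : ℝ, γ = ((b : ℝ) - m) / b := ⟨_, rfl⟩
  have hα0 : 0 ≤ α := by rw [hα]; exact div_nonneg (by linarith) ha.le
  have hγ0 : 0 ≤ γ := by rw [hγ]; exact div_nonneg (by linarith) hb.le
  have e1 : (A : ℝ) / a ≤ r * (1 - α) + α := by
    rw [hα, div_le_iff₀ ha]
    have : (r * (1 - (a - n * m) / a) + (a - n * m) / a) * (a : ℝ) = n * (r * m) + (a - n * m) := by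
      field_simp
      ring
    rw [this, ← hs]
    exact h1'
  have e2 : r * (1 - α) ≤ (A : ℝ) / a := by
    rw [hα, le_div_iff₀ ha]
    have : (r * (1 - (a - n * m) / a)) * (a : ℝ) = n * (r * m) := by
      field_simp
      ring
    rw [this, ← hs]
    exact h2'
  have e3 : (B : ℝ) / b ≤ r * (1 - γ) + γ := by
    rw [hγ, div_le_iff₀ hb]
    have : (r * (1 - (b - m) / b) + (b - m) / b) * (b : ℝ) = r * m + (b - m) := by
      field_simp
      ring
    rw [this, ← hs]
    exact h3'
  have e4 : r * (1 - γ) ≤ (B : ℝ) / b := by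
    rw [hγ, le_div_iff₀ hb]
    have : (r * (1 - (b - m) / b)) * (b : ℝ) = r * m := by
      field_simp
      ring
    rw [this, ← hs]
    exact h4'
  have e5 : r * α ≤ α := mul_le_of_le_one_left hα0 hr1
  have e6 : r * γ ≤ γ := mul_le_of_le_one_left hγ0 hr1
  have e7 : 0 ≤ r * α := mul_nonneg hr0 hα0
  have e8 : 0 ≤ r * γ := mul_nonneg hr0 hγ0
  push_cast
  rw [← hα, ← hγ, abs_le]
  constructor <;> nlinarith

theorem uniformOn_real {Ω : Type*} [MeasurableSpace Ω] [MeasurableSingletonClass Ω] {s : Set Ω}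
    (hs : s.Finite) (t : Set Ω) : (uniformOn s).real t = ((s ∩ t).ncard : ℝ) / s.ncard := by
  have h (r : Set Ω) (hr : r.Finite) : Measure.count r = r.ncard := by
    rw [Measure.count_apply_finite r hr, Set.ncard_eq_toFinset_card r hr]
  rw [Measure.real, uniformOn, cond_apply hs.measurableSet, h _ hs,
    h _ (hs.subset Set.inter_subset_left), ENNReal.toReal_mul, ENNReal.toReal_inv,
    ENNReal.toReal_natCast, ENNReal.toReal_natCast, div_eq_inv_mul]

/-- By the Hahn decomposition the total variation is the difference on one set minus that on its
complement. -/
theorem tvNorm_le {X : Type*} [MeasurableSpace X] (m₁ m₂ : Measure X) [IsFiniteMeasure m₁]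
    [IsFiniteMeasure m₂] {e : ℝ} (h : ∀ S, MeasurableSet S → |m₁.real S - m₂.real S| ≤ e) :
    tvNorm m₁ m₂ ≤ ENNReal.ofReal (2 * e) := by
  set s := m₁.toSignedMeasure - m₂.toSignedMeasure with hs
  have hval {S : Set X} (hS : MeasurableSet S) : s S = m₁.real S - m₂.real S := by
    rw [hs, sub_apply, Measure.toSignedMeasure_apply_measurable hS,
      Measure.toSignedMeasure_apply_measurable hS]
  obtain ⟨i, hi, hi1, hi2, hp, hq⟩ := s.toJordanDecomposition_spec
  rw [tvNorm, ← hs, SignedMeasure.totalVariation, Measure.add_apply, hp, hq,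
    SignedMeasure.toMeasureOfZeroLE_apply _ hi1 hi MeasurableSet.univ,
    SignedMeasure.toMeasureOfLEZero_apply _ hi2 hi.compl MeasurableSet.univ, ← ENNReal.coe_add]
  rw [← ENNReal.ofReal_coe_nnreal]
  refine ENNReal.ofReal_le_ofReal ?_
  simp only [NNReal.coe_add, NNReal.coe_mk, Set.inter_univ]
  rw [hval hi, hval hi.compl]
  have h1 := (abs_le.1 (h i hi)).2
  have h2 := (abs_le.1 (h iᶜ hi.compl)).1
  linarith

/-! ### The limit -/

open Classical in
theorem tvNorm_map_le {n : ℕ} (hn : 5 ≤ n) (hg : (good n).Nonempty) :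
    tvNorm ((lam n).map (p n)) (mu n) ≤ ENNReal.ofReal (2 * (2 *
      (((periodic n).ncard - (good n).ncard : ℝ) / (periodic n).ncard +
        ((classes n).ncard - (p n '' good n).ncard : ℝ) / (classes n).ncard))) := by
  have hn0 : n ≠ 0 := by omega
  have hJ := (periodic_finite_and_ncard_le hn0).1
  have hG : (good n).Finite := hJ.subset fun x hx => hx.1
  have hF := classes_finite hn
  refine tvNorm_le _ _ fun S hS => ?_
  have hFS : (classes n ∩ S).Finite := hF.subset Set.inter_subset_left
  have := abs_card_div_sub_le (J := hJ.toFinset) (G := hG.toFinset) (F := hF.toFinset)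
    (S := hFS.toFinset) (f := p n) hn0 (Set.Finite.toFinset_subset_toFinset.2 fun x hx => hx.1)
    (by simpa using hg)
    (fun x hx => hF.mem_toFinset.2 (mapsTo_p n (hJ.mem_toFinset.1 hx))) (fun x hx => by
      refine Eq.trans ?_ (ncard_fiber hn0 (hG.mem_toFinset.1 hx))
      rw [← Set.ncard_coe_finset]
      congr 1
      ext y
      simp)
    (fun x hx y hy h => hG.mem_toFinset.2
      (mem_good_of_p_eq hn0 (hG.mem_toFinset.1 hx) (hJ.mem_toFinset.1 hy) h))
  simp only [← Set.ncard_coe_finset, Finset.coe_filter, Finset.coe_inter, Finset.coe_image,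
    Set.Finite.coe_toFinset, Set.Finite.mem_toFinset] at this
  rw [map_measureReal_apply (measurable_p n) hS, lam, mu, uniformOn_real hJ, uniformOn_real hF]
  convert this using 5
  · congr 1
    ext x
    simp only [Set.mem_inter_iff, Set.mem_preimage, Set.mem_ofPred_eq]
    exact ⟨fun h => ⟨h.1, mapsTo_p n h.1, h.2⟩, fun h => ⟨h.1, h.2.2⟩⟩
  · congr 1
    ext x
    simp

/-- A bound for the number of exceptional sequences and words, in terms of all sequences. -/
noncomputable def defect (n : ℕ) : ℝ :=
  n * ((periodic n \ good n).ncard + (crooked n).ncard) / (periodic n).ncard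

/-- The factor `n` in `defect` appears because the image of the good sequences is smaller than their
set by that factor. The missing fractions are at most `defect n` and `2 * defect n`, and 2 · 2 · 3 =
12. -/
theorem tvNorm_map_le_defect {n : ℕ} (hn : 5 ≤ n) (hJ0 : 0 < (periodic n).ncard)
    (hd : defect n ≤ 1 / 2) :
    tvNorm ((lam n).map (p n)) (mu n) ≤ ENNReal.ofReal (12 * defect n) := by
  have hn0 : n ≠ 0 := by omega
  have hJ := (periodic_finite_and_ncard_le hn0).1
  have hG : (good n).Finite := hJ.subset fun x hx => hx.1
  have hF := classes_finite hn
  have hGJ : good n ⊆ periodic n := fun x hx => hx.1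
  have hsub : p n '' good n ⊆ classes n := by
    rintro _ ⟨x, hx, rfl⟩
    exact mapsTo_p n hx.1
  have c1 : (good n).ncard + (periodic n \ good n).ncard = (periodic n).ncard := by
    rw [add_comm, Set.ncard_sdiff_add_ncard_of_subset hGJ hJ]
  have c2 : (classes n).ncard ≤ (p n '' good n).ncard +
      ((periodic n \ good n).ncard + (crooked n).ncard) := by
    have f1 := hG.image (p n)
    have f2 := (hJ.subset (Set.sdiff_subset (t := good n))).image (p n)
    have f3 := (crooked_finite_and_ncard_le n).1.image fun w => ConjClasses.mk (eval w)
    refine (Set.ncard_le_ncard (classes_subset hn) (f1.union (f2.union f3))).trans ?_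
    refine (Set.ncard_union_le _ _).trans (Nat.add_le_add_left ?_ _)
    refine (Set.ncard_union_le _ _).trans (Nat.add_le_add ?_ ?_)
    · exact Set.ncard_image_le (hJ.subset Set.sdiff_subset)
    · exact Set.ncard_image_le (crooked_finite_and_ncard_le n).1
  have c3 : (good n).ncard ≤ n * (p n '' good n).ncard := by
    classical
    have := Finset.card_le_mul_card_image (f := p n) hG.toFinset n (fun C hC => by
      obtain ⟨x, hx, rfl⟩ := Finset.mem_image.1 hC
      refine le_trans ?_ (ncard_fiber hn0 (hG.mem_toFinset.1 hx)).le
      rw [← Set.ncard_coe_finset]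
      refine Set.ncard_le_ncard (fun y hy => ?_) (hJ.subset fun y hy => hy.1)
      have := Finset.mem_filter.1 hy
      exact ⟨hGJ (hG.mem_toFinset.1 this.1), this.2⟩)
    simpa only [← Set.ncard_coe_finset, Finset.coe_image, Set.Finite.coe_toFinset] using this
  have c4 := Set.ncard_le_ncard hsub hF
  set N := (periodic n \ good n).ncard
  set K := (crooked n).ncard
  set a := (periodic n).ncard
  set g := (good n).ncard
  set m := (p n '' good n).ncard
  set b := (classes n).ncard
  have ha : (0 : ℝ) < a := by exact_mod_cast hJ0
  have hn1 : (1 : ℝ) ≤ n := by exact_mod_cast Nat.one_le_iff_ne_zero.2 hn0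
  have hdef : defect n * a = n * (N + K) := by
    change (n : ℝ) * (N + K) / a * a = _
    field_simp
  have hNK : (0 : ℝ) ≤ N + K := by positivity
  have d1 : (g : ℝ) + N = a := by exact_mod_cast c1
  have d2 : (b : ℝ) ≤ m + (N + K) := by exact_mod_cast c2
  have d3 : (g : ℝ) ≤ n * m := by exact_mod_cast c3
  have d4 : (m : ℝ) ≤ b := by exact_mod_cast c4
  have hN : (N : ℝ) ≤ defect n * a := by
    rw [hdef]
    have : (0 : ℝ) ≤ K := by positivity
    nlinarith
  have hg2 : (a : ℝ) ≤ 2 * g := by nlinarith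
  have hgpos : (0 : ℝ) < g := by linarith
  have hgne : (good n).Nonempty := by
    rw [← Set.ncard_pos hG]
    exact_mod_cast hgpos
  refine (tvNorm_map_le hn hgne).trans (ENNReal.ofReal_le_ofReal ?_)
  have hm : (0 : ℝ) < m := by
    by_contra h
    nlinarith
  have hb : (0 : ℝ) < b := hm.trans_le d4
  have e1 : ((a : ℝ) - g) / a ≤ defect n := by
    rw [div_le_iff₀ ha]
    linarith
  have e2 : ((b : ℝ) - m) / b ≤ 2 * defect n := by
    rw [div_le_iff₀ hb]
    have hd0 : 0 ≤ defect n := by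
      by_contra h
      nlinarith [mul_nonneg (zero_le_one.trans hn1) hNK]
    have h1 : n * (N + K : ℝ) ≤ n * (2 * defect n * b) := by
      rw [← hdef]
      have : (a : ℝ) ≤ n * (2 * b) := by nlinarith
      nlinarith
    have h2 := le_of_mul_le_mul_left h1 (by linarith)
    linarith
  linarith

theorem defect_le (m : ℕ) :
    defect (m + 2) ≤ 300000 * ((m + 2 : ℕ) : ℝ) ^ 2 * (64 / 65 : ℝ) ^ m := by
  set n := m + 2 with hn
  have hn0 : n ≠ 0 := by omega
  have hJ := (periodic_finite_and_ncard_le hn0).1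
  have h1 : (periodic n \ good n).ncard ≤
      {x ∈ periodic n | ¬ Straight x}.ncard + {x ∈ periodic n | Imprimitive n x}.ncard := by
    refine (Set.ncard_le_ncard ?_ ((hJ.subset fun x hx => hx.1).union
      (hJ.subset fun x hx => hx.1))).trans (Set.ncard_union_le _ _)
    rintro x ⟨hx, hxg⟩
    by_cases hs : Straight x
    · refine .inr ⟨hx, ?_⟩
      by_contra hp
      exact hxg ⟨hx, hs, hp⟩
    · exact .inl ⟨hx, hs⟩
  have h2 := ncard_not_straight_le hn0
  have h3 := ncard_imprimitive_le n
  have h4 := (crooked_finite_and_ncard_le n).2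
  have h5 := le_ncard_periodic m
  rw [← hn] at h5
  set A := {x ∈ periodic n | ¬ Straight x}.ncard
  set I := {x ∈ periodic n | Imprimitive n x}.ncard
  rw [defect]
  generalize (periodic n \ good n).ncard = N at *
  generalize (crooked n).ncard = K at *
  generalize (periodic n).ncard = a at *
  have h2' : (5 : ℝ) ^ n * A ≤ 1408 * 32 ^ n := by exact_mod_cast h2
  have h3' : (I : ℝ) ≤ 88 * n * 4 ^ n := by exact_mod_cast h3
  have h4' : (K : ℝ) ≤ 8 * 6 ^ n := by exact_mod_cast h4
  have h5' : (13 : ℝ) ^ m ≤ 2 ^ m * a := by exact_mod_cast h5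
  have h1' : (N : ℝ) ≤ A + I := by exact_mod_cast h1
  have hA : (A : ℝ) ≤ 1408 * (32 / 5) ^ n := by
    rw [div_pow, mul_div_assoc', le_div_iff₀ (by positivity), mul_comm]
    exact h2'
  have ha : (13 / 2 : ℝ) ^ m ≤ a := by
    rw [div_pow, div_le_iff₀ (by positivity), mul_comm]
    exact h5'
  have ha0 : (0 : ℝ) < a := lt_of_lt_of_le (by positivity) ha
  have hn1 : (1 : ℝ) ≤ n := by exact_mod_cast Nat.one_le_iff_ne_zero.2 hn0
  have p1 : (4 : ℝ) ^ n ≤ (32 / 5) ^ n := pow_le_pow_left₀ (by norm_num) (by norm_num) n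
  have p2 : (6 : ℝ) ^ n ≤ (32 / 5) ^ n := pow_le_pow_left₀ (by norm_num) (by norm_num) n
  have hP : (0 : ℝ) < (32 / 5) ^ n := by positivity
  have hPm : (32 / 5 : ℝ) ^ n = (64 / 65) ^ m * (13 / 2) ^ m * (32 / 5) ^ 2 := by
    rw [← mul_pow, hn, pow_add]
    norm_num
  -- 1504 = 1408 + 88 + 8, from the three kinds of exceptions.
  have hNK : (N + K : ℝ) ≤ 1504 * n * (32 / 5) ^ n := by nlinarith
  rw [div_le_iff₀ ha0]
  calc n * (N + K : ℝ) ≤ n * (1504 * n * (32 / 5) ^ n) := by gcongr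
    -- 64/65 is the ratio of the growth rates 32/5 and 13/2.
    _ = 1504 * (32 / 5) ^ 2 * n ^ 2 * (64 / 65) ^ m * (13 / 2) ^ m := by rw [hPm]; ring
    _ ≤ 300000 * n ^ 2 * (64 / 65) ^ m * a := by
      gcongr
      norm_num

theorem tendsto_defect : Tendsto defect atTop (𝓝 0) := by
  rw [← tendsto_add_atTop_iff_nat 2]
  have h : Tendsto (fun m : ℕ => 300000 * (65 / 64 : ℝ) ^ 2 *
      (((m + 2 : ℕ) : ℝ) ^ 2 * (64 / 65 : ℝ) ^ (m + 2))) atTop (𝓝 0) := by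
    have := (tendsto_add_atTop_iff_nat 2).2
      (tendsto_pow_const_mul_const_pow_of_abs_lt_one 2 (r := 64 / 65) (by rw [abs_lt]; norm_num))
    simpa using this.const_mul (300000 * (65 / 64 : ℝ) ^ 2)
  refine squeeze_zero (fun m => ?_) (fun m => (defect_le m).trans_eq ?_) h
  · rw [defect]; positivity
  · rw [pow_add]; ring

theorem tendsto_tvNorm :
    Tendsto (fun n : ℕ => tvNorm ((lam n).map (p n)) (mu n)) atTop (𝓝 0) := by
  have h1 : Tendsto (fun n => ENNReal.ofReal (12 * defect n)) atTop (𝓝 0) := by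
    have := ENNReal.tendsto_ofReal (tendsto_defect.const_mul 12)
    simpa using this
  refine tendsto_of_tendsto_of_tendsto_of_le_of_le' tendsto_const_nhds h1
    (.of_forall fun _ => bot_le) ?_
  filter_upwards [eventually_ge_atTop 5,
    tendsto_defect.eventually_le_const (show (0 : ℝ) < 1 / 2 by norm_num)] with n hn hd
  refine tvNorm_map_le_defect hn ?_ hd
  obtain ⟨m, rfl⟩ := Nat.exists_eq_add_of_le' (show 2 ≤ n by omega)
  have := le_ncard_periodic m
  by_contra h0
  have h0 : (periodic (m + 2)).ncard = 0 := by omega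
  rw [h0, mul_zero] at this
  exact absurd this (not_le.2 (by positivity))

end Snake

theorem mainTheorem4 :
    (∀ n : ℕ, Set.MapsTo (Snake.p n) (Snake.periodic n) (Snake.classes n)) ∧
    Tendsto (fun n : ℕ => Snake.tvNorm ((Snake.lam n).map (Snake.p n)) (Snake.mu n))
      atTop (𝓝 0) :=
  ⟨Snake.mapsTo_p, Snake.tendsto_tvNorm⟩
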